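/- Let $p,q\ge 1$ and $n=p+q+1$. On $\mathbb R^{n+3}$ let $\langle x,y\rangle=-x_1y_1+x_2y_2+\cdots+x_{n+2}y_{n+2}-x_{n+3}y_{n+3}$, and let $\Lambda^{2n-1}$ be the set of projective lines on the Lie quadric $\langle x,x\rangle=0$, i.e. of two-dimensional totally isotropic subspaces of $\mathbb R^{n+3}$. Identify $\Lambda^{2n-1}$ with the unit tangent bundle $T_1S^n=\{(x,\xi)\in S^n\times S^n: x\cdot\xi=0\}$ by $(x,\xi)\mapsto[(1,x,0),(0,\xi,1)]$; this gives it a smooth structure and the contact form $\omega(X,Z)=X\cdot\xi$. The Lie sphere transformations are those induced by $B\in O(n+1,2)$; they act on $\Lambda^{2n-1}$. Manifolds are smooth, Hausdorff, second countable and without boundary; connected spaces are non-empty. A Legendre submanifold is a smooth immersion $\lambda:M^{n-1}\to\Lambda^{2n-1}$ with $\lambda^*\omega=0$. Write $\lambda=[Z,W]$ with smooth $Z,W:M\to\mathbb R^{n+3}$. The principal space at $x$ of a point $K=[rZ(x)+sW(x)]$ of the line $\lambda(x)$ is the space of all $X\in T_xM$ with $r\,dZ(X)+s\,dW(X)\in\mathrm{Span}\{Z(x),W(x)\}$;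 $K$ is a curvature sphere of $\lambda$ at $x$ if this space is non-zero, and its multiplicity is the dimension of this space. A curvature surface is a connected (injectively immersed) submanifold $S\subset M$ such that for each $x\in S$ the tangent space $T_xS$ is the principal space of a curvature sphere $K(x)$ at $x$. $\lambda$ is proper Dupin if $K$ is constant along each curvature surface and the number of distinct curvature spheres is constant on $M$. A cyclide of Dupin of characteristic $(p,q)$ is a proper Dupin submanifold with exactly two distinct curvature spheres at each point, of respective multiplicities $p$ and $q$. The Legendre lift of the standard product $S^q(1/\sqrt2)\times S^p(1/\sqrt2)\subset S^n\subset\mathbb R^{q+1}\times\mathbb R^{p+1}=\mathbb R^{n+1}$ is $\sigma:S^q\times S^p\to\Lambda^{2n-1}$, $\sigma(v,u)=[(1,f,0),(0,\xi,1)]$ with $f=(v,u)/\sqrt2$ and unit normal $\xi=(v,-u)/\sqrt2$. **(a)** Every connected cyclide of Dupin $\lambda:M\to\Lambda^{2n-1}$ of characteristic $(p,q)$ is contained in a unique compact connected cyclide of Dupin of characteristic $(p,q)$. That is, there is an injective cyclide $\nu:S^q\times S^p\to\Lambda^{2n-1}$ of characteristic $(p,q)$ (whose domain is compact and connected) and a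 local diffeomorphism $j:M\to S^q\times S^p$ with $\lambda=\nu\circ j$. If $\nu':N\to\Lambda^{2n-1}$ is any compact connected cyclide of characteristic $(p,q)$ with $\lambda(M)\subset\nu'(N)$, then $\nu'(N)=\nu(S^q\times S^p)$ and $\nu'=\nu\circ\pi$ for a surjective local diffeomorphism $\pi:N\to S^q\times S^p$; if $\nu'$ is injective, then $\nu'=\nu\circ\Phi$ for a diffeomorphism $\Phi$. **(b)** Every compact connected cyclide of Dupin $\lambda:M\to\Lambda^{2n-1}$ of characteristic $(p,q)$ is Lie equivalent to $\sigma$. That is, there is a Lie sphere transformation $\beta$ with $\beta(\lambda(M))=\sigma(S^q\times S^p)$ and $\beta\lambda=\sigma\circ\varphi$ for a surjective local diffeomorphism $\varphi:M\to S^q\times S^p$; if $\lambda$ is injective, then $\beta\lambda=\sigma\circ\Phi$ for a diffeomorphism $\Phi:M\to S^q\times S^p$. Thus any two compact connected cyclides $\lambda:M\to\Lambda^{2n-1}$, $\mu:N\to\Lambda^{2n-1}$ of characteristic $(p,q)$ are Lie equivalent: there is a Lie sphere transformation $\beta$ with $\beta(\lambda(M))=\mu(N)$, and, if $\lambda$ and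 $\mu$ are injective, $\beta\lambda=\mu\circ\Phi$ for a diffeomorphism $\Phi:M\to N$. -/

import Mathlib

open Set Function Module
open scoped Manifold ContDiff LinearAlgebra.Projectivization

noncomputable section

namespace LieSphere

/-! ### Lie sphere geometry of the unit sphere `S^n ⊂ ℝ^{n+1}` -/

/-- `ℝ^k` with its Euclidean inner product. -/
abbrev Euc (k : ℕ) : Type := EuclideanSpace ℝ (Fin k)

/-- The vector space `ℝ^{n+3}`, with coordinates written `(x₁, (x₂, …, x_{n+2}), x_{n+3})`. -/
abbrev LieVec (n : ℕ) : Type := ℝ × Euc (n + 1) × ℝ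

/-- The Lie scalar product `-x₁y₁ + x₂y₂ + ⋯ + x_{n+2}y_{n+2} - x_{n+3}y_{n+3}`,
of signature `(n+1, 2)`. -/
def lieProd {n : ℕ} (x y : LieVec n) : ℝ :=
  -(x.1 * y.1) + inner ℝ x.2.1 y.2.1 - x.2.2 * y.2.2

/-- `Λ^{2n-1}`: the set of projective lines on the Lie quadric, i.e. of two-dimensional linear
subspaces of `ℝ^{n+3}` on which the Lie scalar product vanishes. -/
structure LieLine (n : ℕ) where
  /-- the underlying linear subspace -/
  plane : Submodule ℝ (LieVec n)
  finrank_eq : finrank ℝ plane = 2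
  isotropic : ∀ x ∈ plane, ∀ y ∈ plane, lieProd x y = 0

/-- The point sphere `(1, x, 0)`. -/
def pointSphere {n : ℕ} (x : Euc (n + 1)) : LieVec n := (1, x, 0)

/-- The great sphere `(0, ξ, 1)`. -/
def greatSphere {n : ℕ} (ξ : Euc (n + 1)) : LieVec n := (0, ξ, 1)

/-- The unit tangent bundle `T₁S^n`, as a subset of `ℝ^{n+1} × ℝ^{n+1}`. -/
def unitTangent (n : ℕ) : Set (Euc (n + 1) × Euc (n + 1)) :=
  {c | ‖c.1‖ = 1 ∧ ‖c.2‖ = 1 ∧ inner ℝ c.1 c.2 = 0}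

theorem finrank_span_contact {n : ℕ} (x ξ : Euc (n + 1)) :
    finrank ℝ (Submodule.span ℝ {pointSphere x, greatSphere ξ}) = 2 := by
  have h : LinearIndependent ℝ ![pointSphere x, greatSphere ξ] := by
    rw [LinearIndependent.pair_iff]
    intro s t hst
    simp only [pointSphere, greatSphere, Prod.ext_iff, Prod.fst_add, Prod.snd_add,
      Prod.smul_fst, Prod.smul_snd, smul_eq_mul, mul_one, mul_zero, add_zero, zero_add,
      Prod.fst_zero, Prod.snd_zero] at hst
    exact ⟨hst.1, hst.2.2⟩
  have := finrank_span_eq_card h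
  rwa [Matrix.range_cons_cons_empty, Fintype.card_fin] at this

theorem isotropic_span_contact {n : ℕ} {c : Euc (n + 1) × Euc (n + 1)}
    (hc : c ∈ unitTangent n) :
    ∀ x ∈ Submodule.span ℝ {pointSphere c.1, greatSphere c.2},
      ∀ y ∈ Submodule.span ℝ {pointSphere c.1, greatSphere c.2}, lieProd x y = 0 := by
  obtain ⟨h1, h2, h3⟩ := hc
  have h3' : inner ℝ c.2 c.1 = 0 := by rw [real_inner_comm]; exact h3
  intro x hx y hy
  obtain ⟨a, b, rfl⟩ := Submodule.mem_span_pair.1 hx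
  obtain ⟨a', b', rfl⟩ := Submodule.mem_span_pair.1 hy
  simp [lieProd, pointSphere, greatSphere, inner_add_left, inner_add_right, inner_smul_left,
    inner_smul_right, h3, h3', h1, h2]
  ring

/-- The correspondence `T₁S^n → Λ^{2n-1}`, `(x, ξ) ↦ [(1, x, 0), (0, ξ, 1)]`. -/
def contactLine {n : ℕ} (c : unitTangent n) : LieLine n where
  plane := Submodule.span ℝ {pointSphere c.1.1, greatSphere c.1.2}
  finrank_eq := finrank_span_contact _ _
  isotropic := isotropic_span_contact c.2

/-- The elements of the group `O(n+1, 2)`, which induce the Lie sphere transformations. -/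
def IsLieOrthogonal {n : ℕ} (B : LieVec n ≃ₗ[ℝ] LieVec n) : Prop :=
  ∀ x y, lieProd (B x) (B y) = lieProd x y

/-- The Lie sphere transformations: those of the form `P(B)` with `B ∈ O(n+1, 2)`. -/
abbrev LieTransf (n : ℕ) : Type := {B : LieVec n ≃ₗ[ℝ] LieVec n // IsLieOrthogonal B}

/-- The action of a Lie sphere transformation on the lines of the Lie quadric. -/
def LieTransf.act {n : ℕ} (β : LieTransf n) (ℓ : LieLine n) : LieLine n where
  plane := ℓ.plane.map (β.1 : LieVec n →ₗ[ℝ] LieVec n)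
  finrank_eq := by
    rw [← ℓ.finrank_eq]
    exact LinearEquiv.finrank_map_eq β.1 ℓ.plane
  isotropic := by
    rintro _ ⟨x, hx, rfl⟩ _ ⟨y, hy, rfl⟩
    exact (β.2 x y).trans (ℓ.isotropic x hx y hy)

/-! ### Legendre submanifolds, curvature spheres, Dupin submanifolds -/

section Legendre

variable {E : Type*} [NormedAddCommGroup E] [NormedSpace ℝ E]
  {H : Type*} [TopologicalSpace H] (I : ModelWithCorners ℝ E H)
  {M : Type*} [TopologicalSpace M] [ChartedSpace H M] {n : ℕ}

/-- A Legendre submanifold `lam : M^{n-1} → Λ^{2n-1}`. The differentiable structure and the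
contact form of `Λ^{2n-1}` are those of `T₁S^n ⊂ ℝ^{n+1} × ℝ^{n+1}`, transported by `contactLine`;
the contact form of `T₁S^n` is `ω_{(x, ξ)}(X, Z) = X · ξ`. So `lam` corresponds to a smooth map
`μ = (f, ξ)` into `T₁S^n` that is an immersion with `μ^*ω = 0`. -/
def IsLegendre (lam : M → LieLine n) : Prop :=
  finrank ℝ E + 1 = n ∧
  ∃ μ : M → unitTangent n,
    (∀ x, lam x = contactLine (μ x)) ∧
    ContMDiff I 𝓘(ℝ, Euc (n + 1)) ∞ (fun x => (μ x).1.1) ∧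
    ContMDiff I 𝓘(ℝ, Euc (n + 1)) ∞ (fun x => (μ x).1.2) ∧
    (∀ (x : M) (X : TangentSpace I x),
      mvfderiv I (fun y => (μ y).1.1) x X = 0 → mvfderiv I (fun y => (μ y).1.2) x X = 0 →
        X = 0) ∧
    ∀ (x : M) (X : TangentSpace I x),
      inner ℝ (mvfderiv I (fun y => (μ y).1.1) x X) (μ x).1.2 = 0

/-- `lam = [Z, W]` for smooth maps `Z, W : M → ℝ^{n+3}`. -/
def IsParametrization (lam : M → LieLine n) (Z W : M → LieVec n) : Prop :=
  ContMDiff I 𝓘(ℝ, LieVec n) ∞ Z ∧ ContMDiff I 𝓘(ℝ, LieVec n) ∞ W ∧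
    ∀ x, (lam x).plane = Submodule.span ℝ {Z x, W x}

/-- The principal space at `x` of a point `K` of the projective line `lam x`: the tangent vectors
`X` such that `r dZ(X) + s dW(X) ∈ Span {Z(x), W(x)}`, where `lam = [Z, W]` and
`K = [r Z(x) + s W(x)]`. (The condition does not depend on `Z`, `W`, `r`, `s`.) -/
def principalSpace (lam : M → LieLine n) (x : M) (K : ℙ ℝ (LieVec n)) :
    Submodule ℝ (TangentSpace I x) where
  carrier := {X | ∀ Z W : M → LieVec n, IsParametrization I lam Z W → ∀ r s : ℝ,
    r • Z x + s • W x ∈ K.submodule →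
    r • mvfderiv I Z x X + s • mvfderiv I W x X ∈ (lam x).plane}
  zero_mem' := by
    intro Z W _ r s _
    simp
  add_mem' := by
    intro X Y hX hY Z W hZW r s hK
    have h := Submodule.add_mem _ (hX Z W hZW r s hK) (hY Z W hZW r s hK)
    rw [map_add, map_add, smul_add, smul_add, add_add_add_comm]
    exact h
  smul_mem' := by
    intro c X hX Z W hZW r s hK
    have h := Submodule.smul_mem _ c (hX Z W hZW r s hK)
    rw [map_smul, map_smul, smul_comm r c, smul_comm s c, ← smul_add]
    exact h

/-- `K` is a curvature sphere of `lam` at `x`: a point of the line `lam x` with a nonzero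
principal vector. -/
def IsCurvatureSphere (lam : M → LieLine n) (x : M) (K : ℙ ℝ (LieVec n)) : Prop :=
  K.submodule ≤ (lam x).plane ∧ ∃ X ∈ principalSpace I lam x K, X ≠ 0

/-- The multiplicity of a curvature sphere: the dimension of its principal space. -/
def multiplicity (lam : M → LieLine n) (x : M) (K : ℙ ℝ (LieVec n)) : ℕ :=
  finrank ℝ (principalSpace I lam x K)

/-- The map `ι : S → M` from a manifold `S` of dimension `m` is a curvature surface of `lam` with
corresponding curvature sphere map `K`: a connected (injectively immersed) submanifold whose
tangent space at each point is the principal space of the curvature sphere `K`. -/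
def IsCurvatureSurface (lam : M → LieLine n) (m : ℕ) {S : Type} [TopologicalSpace S]
    [ChartedSpace (Euc m) S] (ι : S → M) (K : S → ℙ ℝ (LieVec n)) : Prop :=
  ConnectedSpace S ∧ Injective ι ∧ ContMDiff (𝓡 m) I ∞ ι ∧
  (∀ s, Injective (mfderiv (𝓡 m) I ι s)) ∧
  ∀ s, IsCurvatureSphere I lam (ι s) (K s) ∧
    LinearMap.range (mfderiv (𝓡 m) I ι s).toLinearMap = principalSpace I lam (ι s) (K s)

/-- A Dupin submanifold: a Legendre submanifold such that along each curvature surface the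
corresponding curvature sphere map is constant. -/
def IsDupin (lam : M → LieLine n) : Prop :=
  IsLegendre I lam ∧
  ∀ (m : ℕ) (S : Type) [TopologicalSpace S] [ChartedSpace (Euc m) S] [IsManifold (𝓡 m) ∞ S]
    [T2Space S] [SecondCountableTopology S] (ι : S → M) (K : S → ℙ ℝ (LieVec n)),
    IsCurvatureSurface I lam m ι K → ∀ s t, K s = K t

/-- A proper Dupin submanifold: the number of distinct curvature spheres is constant. -/
def IsProperDupin (lam : M → LieLine n) : Prop :=
  IsDupin I lam ∧ ∃ g : ℕ, ∀ x, {K | IsCurvatureSphere I lam x K}.encard = g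

/-- A cyclide of Dupin of characteristic `(p, q)`: a proper Dupin submanifold with two distinct
curvature spheres, of respective multiplicities `p` and `q`, at each point. -/
def IsCyclide (p q : ℕ) (lam : M → LieLine n) : Prop :=
  IsProperDupin I lam ∧ ∀ x, ∃ K₁ K₂ : ℙ ℝ (LieVec n), K₁ ≠ K₂ ∧
    {K | IsCurvatureSphere I lam x K} = {K₁, K₂} ∧
    multiplicity I lam x K₁ = p ∧ multiplicity I lam x K₂ = q

end Legendre

section Equivalence

variable {E : Type*} [NormedAddCommGroup E] [NormedSpace ℝ E]
  {H : Type*} [TopologicalSpace H] (I : ModelWithCorners ℝ E H)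
  {M : Type*} [TopologicalSpace M] [ChartedSpace H M]
  {E' : Type*} [NormedAddCommGroup E'] [NormedSpace ℝ E']
  {H' : Type*} [TopologicalSpace H'] (J : ModelWithCorners ℝ E' H')
  {N : Type*} [TopologicalSpace N] [ChartedSpace H' N] {n : ℕ}

/-- `lam` is a restriction of `mu`: it factors through `mu` by a local diffeomorphism of the
domains. If `lam` is injective, then it is, up to a diffeomorphism of its domain, the restriction
of `mu` to an open subset. -/
def IsRestriction (lam : M → LieLine n) (mu : N → LieLine n) : Prop :=
  ∃ j : M → N, IsLocalDiffeomorph I J ∞ j ∧ ∀ x, lam x = mu (j x)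

/-- `lam` is a covering of `mu`: it factors through `mu` by a surjective local diffeomorphism of
the domains. -/
def IsCoveringOf (lam : M → LieLine n) (mu : N → LieLine n) : Prop :=
  ∃ j : M → N, IsLocalDiffeomorph I J ∞ j ∧ Surjective j ∧ ∀ x, lam x = mu (j x)

/-- `lam` and `mu` agree up to a diffeomorphism of their domains. -/
def IsReparametrization (lam : M → LieLine n) (mu : N → LieLine n) : Prop :=
  ∃ Φ : M ≃ₘ^∞⟮I, J⟯ N, ∀ x, lam x = mu (Φ x)

end Equivalence

/-! ### The standard product of two spheres -/

/-- The unit sphere `S^k ⊂ ℝ^{k+1}`, with its standard manifold structure modelled on `𝓡 k`. -/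
abbrev Sph (k : ℕ) : Type := Metric.sphere (0 : Euc (k + 1)) 1

/-- The identification `ℝ^{q+1} × ℝ^{p+1} = ℝ^{n+1}` for `p + q = n - 1`. -/
def glue {p q n : ℕ} (hn : p + q + 1 = n) (v : Euc (q + 1)) (u : Euc (p + 1)) : Euc (n + 1) :=
  WithLp.toLp 2 fun i => Fin.append v.ofLp u.ofLp (Fin.cast (by omega) i)

theorem inner_glue {p q n : ℕ} (hn : p + q + 1 = n) (v v' : Euc (q + 1)) (u u' : Euc (p + 1)) :
    inner ℝ (glue hn v u) (glue hn v' u') = inner ℝ v v' + inner ℝ u u' := by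
  simp only [PiLp.inner_apply, glue]
  have h : n + 1 = (q + 1) + (p + 1) := by omega
  rw [← (finCongr h.symm).sum_comp, Fin.sum_univ_add]
  simp

/-- The inclusion of `S^q(1/√2) × S^p(1/√2)` in `S^n`, parametrized by `S^q × S^p`. -/
def stdProd {p q n : ℕ} (hn : p + q + 1 = n) (y : Sph q × Sph p) : Euc (n + 1) :=
  glue hn ((1 / √2 : ℝ) • (y.1 : Euc (q + 1))) ((1 / √2 : ℝ) • (y.2 : Euc (p + 1)))

/-- A field of unit normals to `stdProd` in `S^n`. -/
def stdNormal {p q n : ℕ} (hn : p + q + 1 = n) (y : Sph q × Sph p) : Euc (n + 1) :=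
  glue hn ((1 / √2 : ℝ) • (y.1 : Euc (q + 1))) (-((1 / √2 : ℝ) • (y.2 : Euc (p + 1))))

theorem std_mem_unitTangent {p q n : ℕ} (hn : p + q + 1 = n) (y : Sph q × Sph p) :
    (stdProd hn y, stdNormal hn y) ∈ unitTangent n := by
  have h2 : (√2)⁻¹ * (√2)⁻¹ = (1 / 2 : ℝ) := by
    rw [← mul_inv, Real.mul_self_sqrt (by norm_num)]; norm_num
  have hv : ‖(y.1 : Euc (q + 1))‖ = 1 := by simp
  have hu : ‖(y.2 : Euc (p + 1))‖ = 1 := by simp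
  have key : ∀ z : Euc (n + 1), inner ℝ z z = 1 → ‖z‖ = 1 := by
    intro z hz
    rw [real_inner_self_eq_norm_sq] at hz
    nlinarith [norm_nonneg z]
  refine ⟨key _ ?_, key _ ?_, ?_⟩ <;> dsimp only [stdProd, stdNormal] <;> rw [inner_glue] <;>
    simp only [inner_neg_left, inner_neg_right, inner_smul_left, inner_smul_right] <;>
    simp only [real_inner_self_eq_norm_sq, hv, hu, one_div, one_pow, mul_one, h2,
      RCLike.conj_to_real] <;>
    linarith [h2]

/-- The Legendre lift of the standard product `S^q(1/√2) × S^p(1/√2) ⊂ S^n`. (The lift with the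
opposite field of normals is its image under the transformation `x_{n+3} ↦ -x_{n+3}`.) -/
def stdLift {p q n : ℕ} (hn : p + q + 1 = n) (y : Sph q × Sph p) : LieLine n :=
  contactLine ⟨(stdProd hn y, stdNormal hn y), std_mem_unitTangent hn y⟩

end LieSphere

end

open LieSphere

noncomputable section

namespace LieSphere

/-! ### The Lie scalar product -/

section Algebra

variable {n : ℕ}

/-! Near a point, each line of the cyclide is spanned by its two curvature spheres, normalised as
`k₁ = αA + B` and `k₂ = βA + B` for a frame `A`, `B` in which `A` is an immersion. The curvatures
`α`, `β` are smooth because their sum and product solve a linear system with smooth coefficients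
(`LocalCyclide.exists_smooth_curvatures`). Each curvature is constant along its own principal
directions: by the Codazzi equation if the multiplicity is at least two, and by the Dupin condition,
applied to lines of curvature, if it is one (`CurvatureData.fderiv_left_eq_zero`). Hence the kernels
of `dk₁` and `dk₂` are exactly the two complementary principal spaces, and on a product
neighbourhood `k₁` and `k₂` vary independently (`exists_isBox`).

Independence is decisive. Any value of `k₁` and any value of `k₂` lie on a common isotropic line, so
the two families span orthogonal subspaces. These have dimensions at least `q + 2` and `p + 2`,
which add up to `n + 3`, and each contains a negative vector. As the signature is `(n+1, 2)`, the
whole space is the orthogonal sum of two Lorentz spaces, and some `C` in `O(n+1, 2)` carries the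
corresponding splitting for the standard product to this one (`exists_lieTransf_of_orthogonal`). The
isotropic lines that meet both factors are precisely those of `C ∘ σ` (`mem_range_act_stdLift`), so
near the point the cyclide lies in this image.

A box determines the image that contains it (`IsBox.range_eq_range`), so on a connected domain an
open-and-closed argument yields a single `C` (`IsCyclide.exists_forall_mem_range`). An immersion of
the same dimension with lines in `C ∘ σ` factors through it by a local diffeomorphism, which is onto
if the domain is compact, since its image is then open and closed. The cyclide sought in (a) is `C ∘
σ`, its uniqueness is the rigidity of boxes, and the equivalence in (b) is the inverse of `C`. -/

theorem lieProd_comm (x y : LieVec n) : lieProd x y = lieProd y x := by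
  simp only [lieProd, real_inner_comm]; ring

theorem lieProd_add_left (x y z : LieVec n) :
    lieProd (x + y) z = lieProd x z + lieProd y z := by
  simp only [lieProd, Prod.fst_add, Prod.snd_add, inner_add_left]; ring

theorem lieProd_smul_left (c : ℝ) (x z : LieVec n) : lieProd (c • x) z = c * lieProd x z := by
  simp only [lieProd, Prod.smul_fst, Prod.smul_snd, real_inner_smul_left, smul_eq_mul]; ring

theorem lieProd_add_right (x y z : LieVec n) :
    lieProd x (y + z) = lieProd x y + lieProd x z := by
  simp only [lieProd_comm x, lieProd_add_left]

theorem lieProd_smul_right (c : ℝ) (x z : LieVec n) : lieProd x (c • z) = c * lieProd x z := by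
  simp only [lieProd_comm x, lieProd_smul_left]

/-- The Lie scalar product as a bilinear form. -/
def lieForm (n : ℕ) : LinearMap.BilinForm ℝ (LieVec n) :=
  LinearMap.mk₂ ℝ lieProd lieProd_add_left lieProd_smul_left lieProd_add_right
    lieProd_smul_right

@[simp] theorem lieForm_apply (x y : LieVec n) : lieForm n x y = lieProd x y := rfl

/-- The Lie scalar product as a continuous bilinear map. -/
def lieBilin (n : ℕ) : LieVec n →L[ℝ] LieVec n →L[ℝ] ℝ :=
  LinearMap.toContinuousLinearMap
    ((LinearMap.toContinuousLinearMap : (LieVec n →ₗ[ℝ] ℝ) ≃ₗ[ℝ] _).toLinearMap ∘ₗ lieForm n)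

@[simp] theorem lieBilin_apply (x y : LieVec n) : lieBilin n x y = lieProd x y := rfl

@[simp] theorem lieProd_zero_left (x : LieVec n) : lieProd 0 x = 0 := by
  simpa using lieProd_smul_left 0 0 x

@[simp] theorem lieProd_zero_right (x : LieVec n) : lieProd x 0 = 0 := by
  simpa using lieProd_smul_right 0 x 0

theorem lieProd_sub_left (x y z : LieVec n) :
    lieProd (x - y) z = lieProd x z - lieProd y z := by
  simp only [← lieForm_apply, map_sub, LinearMap.sub_apply]

theorem lieProd_sub_right (x y z : LieVec n) :
    lieProd x (y - z) = lieProd x y - lieProd x z := by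
  simp only [← lieForm_apply, map_sub]

/-- On vectors whose first and last coordinates vanish the form is Euclidean. These "horizontal"
vectors are the source of all positivity below: derivatives of the frame `(1, f, 0)`, `(0, ξ, 1)`
are horizontal, and an isotropic plane contains no horizontal vector but zero. -/
theorem lieProd_horizontal_self_nonneg {x : LieVec n} (h1 : x.1 = 0) (h2 : x.2.2 = 0) :
    0 ≤ lieProd x x := by
  simp only [lieProd, h1, h2, mul_zero, neg_zero, zero_add, sub_zero]
  exact real_inner_self_nonneg

theorem lieProd_horizontal_self_eq_zero {x : LieVec n} (h1 : x.1 = 0) (h2 : x.2.2 = 0)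
    (h : lieProd x x = 0) : x = 0 := by
  simp only [lieProd, h1, h2, mul_zero, neg_zero, zero_add, sub_zero] at h
  exact Prod.ext h1 (Prod.ext (inner_self_eq_zero.1 h) h2)

theorem lieProd_horizontal_self_pos {x : LieVec n} (h1 : x.1 = 0) (h2 : x.2.2 = 0)
    (h : x ≠ 0) : 0 < lieProd x x :=
  (lieProd_horizontal_self_nonneg h1 h2).lt_of_ne
    fun h0 => h (lieProd_horizontal_self_eq_zero h1 h2 h0.symm)

theorem lieProd_nondegenerate {x : LieVec n} (h : ∀ y, lieProd x y = 0) : x = 0 := by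
  have h1 := h (1, 0, 0)
  have h2 := h (0, 0, 1)
  have h3 := h (0, x.2.1, 0)
  simp only [lieProd, mul_one, mul_zero, inner_zero_right, add_zero, sub_zero, zero_sub,
    neg_eq_zero, neg_zero, zero_add] at h1 h2 h3
  exact Prod.ext h1 (Prod.ext (inner_self_eq_zero.1 h3) h2)

/-- The orthogonal complement of a negative definite plane is positive definite. -/
theorem lieProd_self_pos_of_orthogonal {t₁ t₂ z : LieVec n} (h₁ : lieProd t₁ t₁ = -1)
    (h₂ : lieProd t₂ t₂ = -1) (h₁₂ : lieProd t₁ t₂ = 0) (hz₁ : lieProd t₁ z = 0)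
    (hz₂ : lieProd t₂ z = 0) (hz : z ≠ 0) : 0 < lieProd z z := by
  -- `α`, `β`, `γ` are the coefficients of the linear relation between the projections of `t₁`,
  -- `t₂`, `z` to the plane of the first and last coordinates. If `γ = 0`, the Lagrange identity and
  -- Cauchy–Schwarz bound the sum of the squared lengths of the projections of `t₁` and `t₂` by 1,
  -- although each is at least 1.
  set γ := t₁.1 * t₂.2.2 - t₁.2.2 * t₂.1 with hγ
  have hγ0 : γ ≠ 0 := by
    intro h0
    have cs := real_inner_mul_inner_self_le t₁.2.1 t₂.2.1
    have n₁ : (0 : ℝ) ≤ inner ℝ t₁.2.1 t₁.2.1 := real_inner_self_nonneg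
    have n₂ : (0 : ℝ) ≤ inner ℝ t₂.2.1 t₂.2.1 := real_inner_self_nonneg
    simp only [lieProd] at h₁ h₂ h₁₂
    have e₁ : inner ℝ t₁.2.1 t₁.2.1 = t₁.1 * t₁.1 + t₁.2.2 * t₁.2.2 - 1 := by linarith
    have e₂ : inner ℝ t₂.2.1 t₂.2.1 = t₂.1 * t₂.1 + t₂.2.2 * t₂.2.2 - 1 := by linarith
    have e₃ : inner ℝ t₁.2.1 t₂.2.1 = t₁.1 * t₂.1 + t₁.2.2 * t₂.2.2 := by linarith
    rw [e₁] at n₁ cs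
    rw [e₂] at n₂ cs
    rw [e₃] at cs
    have : γ * γ = 0 := by rw [h0, mul_zero]
    rw [hγ] at this
    nlinarith
  set α := t₂.1 * z.2.2 - t₂.2.2 * z.1
  set β := z.1 * t₁.2.2 - z.2.2 * t₁.1
  set y : LieVec n := α • t₁ + β • t₂ + γ • z with hy
  have y1 : y.1 = 0 := by
    simp only [hy, Prod.fst_add, Prod.smul_fst, smul_eq_mul, α, β, γ]; ring
  have y2 : y.2.2 = 0 := by
    simp only [hy, Prod.snd_add, Prod.smul_snd, smul_eq_mul, α, β, γ]; ring
  have hyy : lieProd y y = -(α ^ 2) - β ^ 2 + γ ^ 2 * lieProd z z := by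
    simp only [hy, lieProd_add_left, lieProd_add_right, lieProd_smul_left, lieProd_smul_right,
      h₁, h₂, h₁₂, hz₁, hz₂, lieProd_comm t₂ t₁, lieProd_comm z t₁, lieProd_comm z t₂]
    ring
  by_contra hneg
  push Not at hneg
  -- Since `y` is horizontal, `-α² - β² + γ²⟨z, z⟩ ≥ 0`. If `⟨z, z⟩ ≤ 0`, this forces `α = β = 0`,
  -- so that `z` itself is horizontal and hence positive.
  have hnn := lieProd_horizontal_self_nonneg y1 y2
  have hγ2 : 0 < γ ^ 2 := by positivity
  have hαβ : α = 0 ∧ β = 0 := by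
    have : γ ^ 2 * lieProd z z ≤ 0 := mul_nonpos_of_nonneg_of_nonpos hγ2.le hneg
    constructor <;> nlinarith [sq_nonneg α, sq_nonneg β]
  rw [hαβ.1, hαβ.2, zero_smul, zero_smul, zero_add, zero_add] at hy
  have z1 : z.1 = 0 := by
    have : γ * z.1 = 0 := by rw [← y1, hy]; simp
    exact (mul_eq_zero.1 this).resolve_left hγ0
  have z2 : z.2.2 = 0 := by
    have : γ * z.2.2 = 0 := by rw [← y2, hy]; simp
    exact (mul_eq_zero.1 this).resolve_left hγ0
  exact absurd (lieProd_horizontal_self_pos z1 z2 hz) (not_lt.2 hneg)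

/-- A positive definite subspace contains orthonormal families of any size up to its dimension. -/
theorem exists_orthonormal_of_pos (F : Submodule ℝ (LieVec n)) {m : ℕ} (hm : m ≤ finrank ℝ F)
    (hpos : ∀ z ∈ F, z ≠ 0 → 0 < lieProd z z) :
    ∃ e : Fin m → LieVec n, (∀ i, e i ∈ F) ∧
      ∀ i j, lieProd (e i) (e j) = if i = j then 1 else 0 := by
  have hsymm : LinearMap.IsSymm ((lieForm n).restrict F) :=
    ⟨fun x y => lieProd_comm x.1 y.1⟩
  obtain ⟨v, hv⟩ := LinearMap.BilinForm.exists_orthogonal_basis hsymm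
  have hvp : ∀ i, 0 < lieProd (v i : LieVec n) (v i) := fun i =>
    hpos _ (v i).2 fun h => v.ne_zero i (Subtype.ext h)
  refine ⟨fun i => (√(lieProd (v (Fin.castLE hm i) : LieVec n) (v (Fin.castLE hm i))))⁻¹ •
    (v (Fin.castLE hm i) : LieVec n), fun i => F.smul_mem _ (v _).2, fun i j => ?_⟩
  rw [lieProd_smul_left, lieProd_smul_right]
  split_ifs with hij
  · subst hij
    have := hvp (Fin.castLE hm i)
    rw [← mul_assoc, ← mul_inv, Real.mul_self_sqrt this.le, inv_mul_cancel₀ this.ne']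
  · have : lieProd (v (Fin.castLE hm i) : LieVec n) (v (Fin.castLE hm j)) = 0 :=
      hv (fun h => hij (Fin.castLE_injective hm h))
    rw [this]; ring

theorem finrank_le_inf_ker_add_one (F : Submodule ℝ (LieVec n)) (φ : LieVec n →ₗ[ℝ] ℝ) :
    finrank ℝ F ≤ finrank ℝ (F ⊓ LinearMap.ker φ : Submodule ℝ (LieVec n)) + 1 := by
  have h := LinearMap.finrank_range_add_finrank_ker (φ.domRestrict F)
  have h1 : finrank ℝ (LinearMap.range (φ.domRestrict F)) ≤ 1 :=
    (Submodule.finrank_le _).trans_eq (finrank_self ℝ)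
  have h2 : finrank ℝ (LinearMap.ker (φ.domRestrict F)) =
      finrank ℝ (F ⊓ LinearMap.ker φ : Submodule ℝ (LieVec n)) := by
    rw [← Submodule.finrank_map_subtype_eq, LinearMap.ker_domRestrict,
      Submodule.map_comap_subtype]
  omega

/-! ### Lie sphere transformations -/

theorem LieLine.ext_plane {ℓ ℓ' : LieLine n} (h : ℓ.plane = ℓ'.plane) : ℓ = ℓ' := by
  cases ℓ; cases ℓ'; cases h; rfl

/-- The inverse of a Lie sphere transformation. -/
def LieTransf.inv (β : LieTransf n) : LieTransf n :=
  ⟨β.1.symm, fun x y => by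
    have := β.2 (β.1.symm x) (β.1.symm y)
    rwa [LinearEquiv.apply_symm_apply, LinearEquiv.apply_symm_apply, eq_comm] at this⟩

/-- The composition of two Lie sphere transformations. -/
def LieTransf.comp (β γ : LieTransf n) : LieTransf n :=
  ⟨γ.1.trans β.1, fun _ _ => (β.2 _ _).trans (γ.2 _ _)⟩

theorem LieTransf.comp_act (β γ : LieTransf n) (ℓ : LieLine n) :
    (β.comp γ).act ℓ = β.act (γ.act ℓ) := by
  apply LieLine.ext_plane
  simp only [LieTransf.act, LieTransf.comp]
  rw [← Submodule.map_comp]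
  rfl

theorem LieTransf.inv_act_act (β : LieTransf n) (ℓ : LieLine n) : β.inv.act (β.act ℓ) = ℓ := by
  apply LieLine.ext_plane
  simp only [LieTransf.act, LieTransf.inv]
  rw [← Submodule.map_comp]
  simp

theorem LieTransf.act_inv_act (β : LieTransf n) (ℓ : LieLine n) : β.act (β.inv.act ℓ) = ℓ := by
  apply LieLine.ext_plane
  simp only [LieTransf.act, LieTransf.inv]
  rw [← Submodule.map_comp]
  simp

theorem LieTransf.act_injective (β : LieTransf n) : Injective β.act := fun ℓ ℓ' h => by
  rw [← β.inv_act_act ℓ, h, β.inv_act_act]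

theorem LieTransf.mem_act_plane (β : LieTransf n) (ℓ : LieLine n) (x : LieVec n) :
    x ∈ (β.act ℓ).plane ↔ β.1.symm x ∈ ℓ.plane := by
  simp only [LieTransf.act]
  constructor
  · rintro ⟨y, hy, rfl⟩
    simpa using hy
  · intro h
    exact ⟨_, h, by simp⟩

end Algebra

/-! ### The two factors of the standard product -/

section Standard

variable {p q n : ℕ} (hn : p + q + 1 = n)

/-- The component in `ℝ^{q+1}` of a vector of `ℝ^{n+1} = ℝ^{q+1} × ℝ^{p+1}`. -/
def leftPart : Euc (n + 1) →ₗ[ℝ] Euc (q + 1) where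
  toFun w := WithLp.toLp 2 fun i => w (Fin.cast (by omega) (Fin.castAdd (p + 1) i))
  map_add' _ _ := rfl
  map_smul' _ _ := rfl

/-- The component in `ℝ^{p+1}` of a vector of `ℝ^{n+1} = ℝ^{q+1} × ℝ^{p+1}`. -/
def rightPart : Euc (n + 1) →ₗ[ℝ] Euc (p + 1) where
  toFun w := WithLp.toLp 2 fun i => w (Fin.cast (by omega) (Fin.natAdd (q + 1) i))
  map_add' _ _ := rfl
  map_smul' _ _ := rfl

theorem leftPart_apply (w : Euc (n + 1)) (i : Fin (q + 1)) :
    leftPart hn w i = w (Fin.cast (by omega) (Fin.castAdd (p + 1) i)) := rfl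

theorem rightPart_apply (w : Euc (n + 1)) (i : Fin (p + 1)) :
    rightPart hn w i = w (Fin.cast (by omega) (Fin.natAdd (q + 1) i)) := rfl

@[simp] theorem leftPart_glue (v : Euc (q + 1)) (u : Euc (p + 1)) :
    leftPart hn (glue hn v u) = v := by
  ext i; simp [leftPart_apply, glue]

@[simp] theorem rightPart_glue (v : Euc (q + 1)) (u : Euc (p + 1)) :
    rightPart hn (glue hn v u) = u := by
  ext i; simp [rightPart_apply, glue]

@[simp] theorem glue_leftPart_rightPart (w : Euc (n + 1)) :
    glue hn (leftPart hn w) (rightPart hn w) = w := by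
  ext i
  have h : n + 1 = (q + 1) + (p + 1) := by omega
  obtain ⟨j, rfl⟩ : ∃ j : Fin ((q + 1) + (p + 1)), i = Fin.cast h.symm j := ⟨Fin.cast h i, by simp⟩
  induction j using Fin.addCases <;> simp [leftPart_apply, rightPart_apply, glue]

/-- `glue` as a linear map. -/
def glueL : Euc (q + 1) × Euc (p + 1) →ₗ[ℝ] Euc (n + 1) where
  toFun y := glue hn y.1 y.2
  map_add' x y := by
    rw [← glue_leftPart_rightPart hn (glue hn x.1 x.2 + glue hn y.1 y.2)]
    simp
  map_smul' c x := by
    rw [← glue_leftPart_rightPart hn (_ • glue hn x.1 x.2)]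
    simp

theorem inner_eq_parts (w w' : Euc (n + 1)) :
    inner ℝ w w' = inner ℝ (leftPart hn w) (leftPart hn w') +
      inner ℝ (rightPart hn w) (rightPart hn w') := by
  conv_lhs => rw [← glue_leftPart_rightPart hn w, ← glue_leftPart_rightPart hn w']
  exact inner_glue hn _ _ _ _

/-- The coordinates of the first factor: the component in the span of the spheres
`(1, √2 (v, 0), 1)`. -/
def coordOne : LieVec n →ₗ[ℝ] ℝ × Euc (q + 1) where
  toFun x := (x.1 + x.2.2, leftPart hn x.2.1)
  map_add' x y := by
    simp only [Prod.fst_add, Prod.snd_add, map_add, Prod.mk_add_mk, Prod.mk.injEq, and_true]; ring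
  map_smul' c x := by simp [mul_add]

/-- The coordinates of the second factor: the component in the span of the spheres
`(1, √2 (0, u), -1)`. -/
def coordTwo : LieVec n →ₗ[ℝ] ℝ × Euc (p + 1) where
  toFun x := (x.1 - x.2.2, rightPart hn x.2.1)
  map_add' x y := by
    simp only [Prod.fst_add, Prod.snd_add, map_add, Prod.mk_add_mk, Prod.mk.injEq, and_true]; ring
  map_smul' c x := by simp [mul_sub]

theorem eq_zero_of_coord {x : LieVec n} (h1 : coordOne hn x = 0) (h2 : coordTwo hn x = 0) :
    x = 0 := by
  simp only [coordOne, coordTwo, LinearMap.coe_mk, AddHom.coe_mk, Prod.mk_eq_zero] at h1 h2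
  refine Prod.ext ?_ (Prod.ext ?_ ?_)
  · simp only [Prod.fst_zero]; linarith
  · rw [← glue_leftPart_rightPart hn x.2.1, h1.2, h2.2]
    exact (glueL hn).map_zero
  · simp only [Prod.snd_zero]; linarith

/-- The identity `2(ab + cd) = (a + c)(b + d) + (a - c)(b - d)` divides the two negative directions
between the factors. Each factor becomes a Lorentz space whose negative coordinate carries the
weight 1/2. -/
theorem lieProd_eq_coord (x y : LieVec n) :
    lieProd x y = -((coordOne hn x).1 * (coordOne hn y).1) / 2 +
      inner ℝ (coordOne hn x).2 (coordOne hn y).2 -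
      (coordTwo hn x).1 * (coordTwo hn y).1 / 2 +
      inner ℝ (coordTwo hn x).2 (coordTwo hn y).2 := by
  simp only [lieProd, coordOne, coordTwo, LinearMap.coe_mk, AddHom.coe_mk,
    inner_eq_parts hn x.2.1 y.2.1]
  ring

/-- The sphere `(1, √2 (v, 0), 1)`. -/
def stdOne (v : Euc (q + 1)) : LieVec n := (1, √2 • glue hn v 0, 1)

/-- The sphere `(1, √2 (0, u), -1)`. -/
def stdTwo (u : Euc (p + 1)) : LieVec n := (1, √2 • glue hn 0 u, -1)

@[simp] theorem coordOne_stdOne (v : Euc (q + 1)) : coordOne hn (stdOne hn v) = (2, √2 • v) := by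
  simp only [coordOne, stdOne, LinearMap.coe_mk, AddHom.coe_mk, map_smul, leftPart_glue]
  norm_num

@[simp] theorem coordTwo_stdOne (v : Euc (q + 1)) : coordTwo hn (stdOne hn v) = 0 := by
  simp [coordTwo, stdOne]

@[simp] theorem coordTwo_stdTwo (u : Euc (p + 1)) : coordTwo hn (stdTwo hn u) = (2, √2 • u) := by
  simp only [coordTwo, stdTwo, LinearMap.coe_mk, AddHom.coe_mk, map_smul, rightPart_glue]
  norm_num

@[simp] theorem coordOne_stdTwo (u : Euc (p + 1)) : coordOne hn (stdTwo hn u) = 0 := by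
  simp [coordOne, stdTwo]

theorem eq_of_coord {x y : LieVec n} (h1 : coordOne hn x = coordOne hn y)
    (h2 : coordTwo hn x = coordTwo hn y) : x = y := by
  rw [← sub_eq_zero]
  apply eq_zero_of_coord hn <;> simp [h1, h2]

/-- The two spanning spheres are the sum and the difference of the point sphere and the great sphere
of the contact element: `f + ξ = √2 (v, 0)` and `f - ξ = √2 (0, u)`. -/
theorem stdLift_plane (y : Sph q × Sph p) :
    (stdLift hn y).plane = Submodule.span ℝ {stdOne hn (y.1 : Euc (q + 1)), stdTwo hn y.2.1} := by
  have hs : √2 * (√2)⁻¹ = 1 := mul_inv_cancel₀ (by positivity)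
  have hs2 : √2 * √2 = 2 := Real.mul_self_sqrt (by norm_num)
  have hi : (√2)⁻¹ + (√2)⁻¹ = √2 := by
    field_simp; rw [sq, hs2]; norm_num
  have h1 : stdOne hn (y.1 : Euc (q + 1)) =
      pointSphere (stdProd hn y) + greatSphere (stdNormal hn y) := by
    apply eq_of_coord hn
    · rw [coordOne_stdOne]
      simp [coordOne, pointSphere, greatSphere, stdProd, stdNormal, ← add_smul, hi]
      norm_num
    · rw [coordTwo_stdOne]
      simp [coordTwo, pointSphere, greatSphere, stdProd, stdNormal, Prod.ext_iff]
  have h2 : stdTwo hn (y.2 : Euc (p + 1)) =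
      pointSphere (stdProd hn y) - greatSphere (stdNormal hn y) := by
    apply eq_of_coord hn
    · rw [coordOne_stdTwo]
      simp [coordOne, pointSphere, greatSphere, stdProd, stdNormal, Prod.ext_iff]
    · rw [coordTwo_stdTwo]
      simp [coordTwo, pointSphere, greatSphere, stdProd, stdNormal, ← add_smul, hi]
      norm_num
  simp only [stdLift, contactLine]
  apply le_antisymm <;> rw [Submodule.span_le] <;> rintro x (rfl | rfl) <;>
    rw [SetLike.mem_coe, Submodule.mem_span_pair]
  · exact ⟨1 / 2, 1 / 2, by rw [h1, h2]; module⟩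
  · exact ⟨1 / 2, -1 / 2, by rw [h1, h2]; module⟩
  · exact ⟨1, 1, by rw [h1]; module⟩
  · exact ⟨1, -1, by rw [h2]; module⟩

/-- In a Lorentz space a nonzero null vector has a nonzero time coordinate, and dividing by it
leaves a point of a sphere. So the projectivized light cone of the first factor is `S^q`. -/
theorem exists_stdOne_of_null {x : LieVec n} (hx : x ≠ 0) (h0 : lieProd x x = 0)
    (h2 : coordTwo hn x = 0) : ∃ (v : Sph q) (c : ℝ), c ≠ 0 ∧ x = c • stdOne hn (v : Euc (q + 1)) := by
  rw [lieProd_eq_coord hn, h2] at h0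
  simp only [Prod.fst_zero, Prod.snd_zero, inner_zero_right, mul_zero, zero_div, sub_zero, add_zero,
    real_inner_self_eq_norm_sq] at h0
  set a := (coordOne hn x).1 with ha
  set w := (coordOne hn x).2 with hw
  have ha0 : a ≠ 0 := by
    intro h
    rw [h] at h0
    have : w = 0 := by
      have : ‖w‖ ^ 2 = 0 := by linarith
      simpa using this
    exact hx (eq_zero_of_coord hn (Prod.ext h this) h2)
  have hs2 : √2 ^ 2 = 2 := Real.sq_sqrt (by norm_num)
  have hs0 : √2 ≠ 0 := by positivity
  refine ⟨⟨(√2 / a) • w, ?_⟩, a / 2, by simpa using ha0, eq_of_coord hn ?_ ?_⟩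
  · rw [mem_sphere_zero_iff_norm, ← sq_eq_sq₀ (norm_nonneg _) zero_le_one, norm_smul, mul_pow,
      Real.norm_eq_abs, sq_abs, div_pow, hs2]
    field_simp
    linarith
  · rw [map_smul, coordOne_stdOne]
    ext1
    · simp [← ha]
    · simp only [Prod.smul_snd, smul_smul, ← hw]
      rw [show a / 2 * (√2 * (√2 / a)) = 1 by field_simp; linarith, one_smul]
  · simp [h2]

theorem exists_stdTwo_of_null {x : LieVec n} (hx : x ≠ 0) (h0 : lieProd x x = 0)
    (h1 : coordOne hn x = 0) : ∃ (u : Sph p) (c : ℝ), c ≠ 0 ∧ x = c • stdTwo hn (u : Euc (p + 1)) := by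
  rw [lieProd_eq_coord hn, h1] at h0
  simp only [Prod.fst_zero, Prod.snd_zero, inner_zero_right, mul_zero, zero_div, zero_sub, add_zero,
    real_inner_self_eq_norm_sq, neg_zero] at h0
  set a := (coordTwo hn x).1 with ha
  set w := (coordTwo hn x).2 with hw
  have ha0 : a ≠ 0 := by
    intro h
    rw [h] at h0
    have : w = 0 := by
      have : ‖w‖ ^ 2 = 0 := by linarith
      simpa using this
    exact hx (eq_zero_of_coord hn h1 (Prod.ext h this))
  have hs2 : √2 ^ 2 = 2 := Real.sq_sqrt (by norm_num)
  have hs0 : √2 ≠ 0 := by positivity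
  refine ⟨⟨(√2 / a) • w, ?_⟩, a / 2, by simpa using ha0, eq_of_coord hn ?_ ?_⟩
  · rw [mem_sphere_zero_iff_norm, ← sq_eq_sq₀ (norm_nonneg _) zero_le_one, norm_smul, mul_pow,
      Real.norm_eq_abs, sq_abs, div_pow, hs2]
    field_simp
    linarith
  · simp [h1]
  · rw [map_smul, coordTwo_stdTwo]
    ext1
    · simp [← ha]
    · simp only [Prod.smul_snd, smul_smul, ← hw]
      rw [show a / 2 * (√2 * (√2 / a)) = 1 by field_simp; linarith, one_smul]

theorem linearIndependent_std (v : Euc (q + 1)) (u : Euc (p + 1)) :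
    LinearIndependent ℝ ![stdOne hn v, stdTwo hn u] := by
  rw [LinearIndependent.pair_iff]
  intro s t h
  have h1 := congrArg (fun x => (coordOne hn x).1) h
  have h2 := congrArg (fun x => (coordTwo hn x).1) h
  simp at h1 h2
  exact ⟨h1, h2⟩

theorem finrank_span_std (v : Euc (q + 1)) (u : Euc (p + 1)) :
    finrank ℝ (Submodule.span ℝ {stdOne hn v, stdTwo hn u}) = 2 := by
  have := finrank_span_eq_card (linearIndependent_std hn v u)
  rwa [Matrix.range_cons_cons_empty, Fintype.card_fin] at this

theorem eq_stdLift_of_mem {ℓ : LieLine n} {y : Sph q × Sph p}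
    (h1 : stdOne hn (y.1 : Euc (q + 1)) ∈ ℓ.plane) (h2 : stdTwo hn (y.2 : Euc (p + 1)) ∈ ℓ.plane) :
    ℓ = stdLift hn y := by
  apply LieLine.ext_plane
  rw [stdLift_plane]
  refine (Submodule.eq_of_le_of_finrank_eq ?_ ?_).symm
  · rw [Submodule.span_le]
    rintro x (rfl | rfl)
    exacts [h1, h2]
  · rw [finrank_span_std, ℓ.finrank_eq]

theorem stdLift_injective : Injective (stdLift hn) := by
  have hs0 : √2 ≠ 0 := by positivity
  intro y y' h
  have hpl : (stdLift hn y).plane = (stdLift hn y').plane := by rw [h]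
  rw [stdLift_plane, stdLift_plane] at hpl
  have m1 : stdOne hn (y.1 : Euc (q + 1)) ∈ Submodule.span ℝ
      {stdOne hn (y'.1 : Euc (q + 1)), stdTwo hn y'.2.1} :=
    hpl ▸ Submodule.subset_span (by simp)
  have m2 : stdTwo hn (y.2 : Euc (p + 1)) ∈ Submodule.span ℝ
      {stdOne hn (y'.1 : Euc (q + 1)), stdTwo hn y'.2.1} :=
    hpl ▸ Submodule.subset_span (by simp)
  obtain ⟨a, b, hab⟩ := Submodule.mem_span_pair.1 m1
  obtain ⟨c, d, hcd⟩ := Submodule.mem_span_pair.1 m2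
  have h1 := congrArg (coordOne hn) hab
  have h2 := congrArg (coordTwo hn) hcd
  simp [Prod.ext_iff] at h1 h2
  rw [h1.1, one_smul] at h1
  rw [h2.1, one_smul] at h2
  exact Prod.ext (Subtype.ext (smul_right_injective _ hs0 h1.2).symm)
    (Subtype.ext (smul_right_injective _ hs0 h2.2).symm)

/-- The lines of the image of the standard product under a Lie sphere transformation are those
that meet both factors. -/
theorem mem_range_act_stdLift (C : LieTransf n) (ℓ : LieLine n) :
    ℓ ∈ Set.range (fun y => C.act (stdLift hn y)) ↔
      (∃ x ∈ ℓ.plane, x ≠ 0 ∧ coordTwo hn (C.1.symm x) = 0) ∧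
      (∃ x ∈ ℓ.plane, x ≠ 0 ∧ coordOne hn (C.1.symm x) = 0) := by
  constructor
  · rintro ⟨y, rfl⟩
    have hli := linearIndependent_std hn (y.1 : Euc (q + 1)) (y.2 : Euc (p + 1))
    refine ⟨⟨C.1 (stdOne hn (y.1 : Euc (q + 1))), ?_, ?_, by simp⟩,
      ⟨C.1 (stdTwo hn (y.2 : Euc (p + 1))), ?_, ?_, by simp⟩⟩
    · rw [C.mem_act_plane, LinearEquiv.symm_apply_apply, stdLift_plane]
      exact Submodule.subset_span (by simp)
    · exact fun h => hli.ne_zero 0 (by simpa using h)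
    · rw [C.mem_act_plane, LinearEquiv.symm_apply_apply, stdLift_plane]
      exact Submodule.subset_span (by simp)
    · exact fun h => hli.ne_zero 1 (by simpa using h)
  · rintro ⟨⟨x, hx, hx0, hx2⟩, ⟨z, hz, hz0, hz1⟩⟩
    obtain ⟨v, c, hc, hv⟩ := exists_stdOne_of_null hn (x := C.1.symm x) (by simpa using hx0)
      (by rw [← ℓ.isotropic x hx x hx]; exact C.inv.2 x x) hx2
    obtain ⟨u, d, hd, hu⟩ := exists_stdTwo_of_null hn (x := C.1.symm z) (by simpa using hz0)
      (by rw [← ℓ.isotropic z hz z hz]; exact C.inv.2 z z) hz1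
    refine ⟨(v, u), ?_⟩
    have : C.inv.act ℓ = stdLift hn (v, u) := by
      apply eq_stdLift_of_mem
      · have : C.1.symm x ∈ (C.inv.act ℓ).plane := (C.inv.mem_act_plane _ _).2 (by
          simpa [LieTransf.inv] using hx)
        rw [hv] at this
        simpa [smul_smul, hc] using (C.inv.act ℓ).plane.smul_mem c⁻¹ this
      · have : C.1.symm z ∈ (C.inv.act ℓ).plane := (C.inv.mem_act_plane _ _).2 (by
          simpa [LieTransf.inv] using hz)
        rw [hu] at this
        simpa [smul_smul, hd] using (C.inv.act ℓ).plane.smul_mem d⁻¹ this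
    simp only [← this, C.act_inv_act]

end Standard

end LieSphere

end

noncomputable section

namespace LieSphere

/-! ### Orthogonal Lorentz splittings and the Lie sphere transformations that realize them -/

section Factors

variable {p q n : ℕ} (hn : p + q + 1 = n)

theorem exists_lieProd_self_eq_neg_one {F : Submodule ℝ (LieVec n)}
    (h : ∃ x ∈ F, lieProd x x < 0) : ∃ t ∈ F, lieProd t t = -1 := by
  obtain ⟨x, hx, hneg⟩ := h
  refine ⟨(√(-lieProd x x))⁻¹ • x, F.smul_mem _ hx, ?_⟩
  have h0 : 0 < -lieProd x x := by linarith
  rw [lieProd_smul_left, lieProd_smul_right, ← mul_assoc, ← mul_inv, Real.mul_self_sqrt h0.le]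
  rw [inv_neg, neg_mul, inv_mul_cancel₀ hneg.ne]

/-- A subspace in which a unit negative vector has a positive definite orthogonal complement
contains an isometric copy of a Lorentz space. -/
theorem exists_lorentz_isometry {m : ℕ} {F : Submodule ℝ (LieVec n)} {t : LieVec n} (ht : t ∈ F)
    (htt : lieProd t t = -1) (hd : m + 1 ≤ finrank ℝ F)
    (hpos : ∀ z ∈ F, lieProd t z = 0 → z ≠ 0 → 0 < lieProd z z) :
    ∃ C : ℝ × Euc m →ₗ[ℝ] LieVec n, (∀ z, C z ∈ F) ∧
      ∀ z w, lieProd (C z) (C w) = -(z.1 * w.1) / 2 + inner ℝ z.2 w.2 := by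
  obtain ⟨e, he, hee⟩ := exists_orthonormal_of_pos (m := m) (F ⊓ LinearMap.ker (lieForm n t))
    (by have := finrank_le_inf_ker_add_one F (lieForm n t); omega)
    (fun z hz hz0 => hpos z hz.1 hz.2 hz0)
  have s2 : (√2)⁻¹ * (√2)⁻¹ = (1 / 2 : ℝ) := by
    rw [← mul_inv, Real.mul_self_sqrt (by norm_num)]; norm_num
  -- The factor `(√2)⁻¹` gives the negative direction the square `-1/2`, which is the weight of the
  -- first component of `coordOne` and `coordTwo`.
  let C : ℝ × Euc m →ₗ[ℝ] LieVec n :=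
    ((√2)⁻¹ • LinearMap.fst ℝ ℝ (Euc m)).smulRight t +
      (∑ i, (EuclideanSpace.proj (𝕜 := ℝ) i).toLinearMap.smulRight (e i)) ∘ₗ
        LinearMap.snd ℝ ℝ (Euc m)
  have hC : ∀ z, C z = ((√2)⁻¹ * z.1) • t + ∑ i, z.2 i • e i := fun z => by simp [C]
  refine ⟨C, fun z => ?_, fun z w => ?_⟩
  · rw [hC]
    exact F.add_mem (F.smul_mem _ ht) (F.sum_mem fun i _ => F.smul_mem _ (he i).1)
  · have h1 : ∀ i, lieProd t (e i) = 0 := fun i => (he i).2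
    have h2 : ∀ i, lieProd (e i) t = 0 := fun i => by rw [lieProd_comm, h1]
    rw [hC, hC, PiLp.inner_apply]
    simp only [← lieForm_apply, map_add, LinearMap.add_apply, map_sum, map_smul,
      LinearMap.smul_apply, LinearMap.sum_apply]
    simp only [lieForm_apply, h1, h2, htt, hee, smul_eq_mul, mul_zero, Finset.sum_const_zero,
      add_zero, zero_add, mul_ite, mul_one, RCLike.inner_apply, conj_trivial]
    rw [show (√2)⁻¹ * w.1 * ((√2)⁻¹ * z.1 * -1) = -(z.1 * w.1) * ((√2)⁻¹ * (√2)⁻¹) by ring, s2]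
    simp [div_eq_mul_inv]

/-- Two orthogonal subspaces of the dimensions and signatures of the factors of the standard
product are the images of these factors under a Lie sphere transformation. -/
theorem exists_lieTransf_of_orthogonal {F₁ F₂ : Submodule ℝ (LieVec n)}
    (horth : ∀ x ∈ F₁, ∀ y ∈ F₂, lieProd x y = 0)
    (hd₁ : q + 2 ≤ finrank ℝ F₁) (hd₂ : p + 2 ≤ finrank ℝ F₂)
    (hneg₁ : ∃ x ∈ F₁, lieProd x x < 0) (hneg₂ : ∃ x ∈ F₂, lieProd x x < 0) :
    ∃ C : LieTransf n, (∀ x, x ∈ F₁ ↔ coordTwo hn (C.1.symm x) = 0) ∧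
      ∀ x, x ∈ F₂ ↔ coordOne hn (C.1.symm x) = 0 := by
  obtain ⟨t₁, ht₁, h₁⟩ := exists_lieProd_self_eq_neg_one hneg₁
  obtain ⟨t₂, ht₂, h₂⟩ := exists_lieProd_self_eq_neg_one hneg₂
  have h₁₂ : lieProd t₁ t₂ = 0 := horth _ ht₁ _ ht₂
  obtain ⟨C₁, m₁, i₁⟩ := exists_lorentz_isometry ht₁ h₁ hd₁ fun z hz hz1 hz0 =>
    lieProd_self_pos_of_orthogonal h₁ h₂ h₁₂ hz1
      (by rw [lieProd_comm]; exact horth _ hz _ ht₂) hz0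
  obtain ⟨C₂, m₂, i₂⟩ := exists_lorentz_isometry ht₂ h₂ hd₂ fun z hz hz1 hz0 =>
    lieProd_self_pos_of_orthogonal h₁ h₂ h₁₂ (horth _ ht₁ _ hz) hz1 hz0
  -- Lower bounds on the dimensions suffice: `T` preserves a nondegenerate form, so it is injective
  -- and therefore bijective. That the factors fill all of `F₁` and `F₂` is then read off by pairing
  -- with the opposite factor.
  let T : LieVec n →ₗ[ℝ] LieVec n := C₁ ∘ₗ coordOne hn + C₂ ∘ₗ coordTwo hn
  have hT : ∀ x, T x = C₁ (coordOne hn x) + C₂ (coordTwo hn x) := fun x => rfl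
  have hiso : ∀ x y, lieProd (T x) (T y) = lieProd x y := fun x y => by
    rw [hT, hT, lieProd_add_left, lieProd_add_right, lieProd_add_right, i₁, i₂,
      horth _ (m₁ _) _ (m₂ _), lieProd_comm (C₂ _) (C₁ _), horth _ (m₁ _) _ (m₂ _),
      lieProd_eq_coord hn]
    ring
  have hinj : Injective T := by
    rw [injective_iff_map_eq_zero]
    intro x hx
    exact lieProd_nondegenerate fun y => by rw [← hiso, hx, lieProd_zero_left]
  let B := LinearEquiv.ofInjectiveEndo T hinj
  have hBs : ∀ x, T (B.symm x) = x := fun x => B.apply_symm_apply x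
  -- a vector orthogonal to all `C₁ z` has vanishing first coordinates, and similarly for `C₂`
  have nd : ∀ {k : ℕ} (z : ℝ × Euc k), (∀ w : ℝ × Euc k, -(z.1 * w.1) / 2 + inner ℝ z.2 w.2 = 0) →
      z = 0 := fun z hz => by
    have a := hz (1, 0)
    have b := hz (0, z.2)
    simp only [mul_one, inner_zero_right, add_zero, mul_zero, neg_zero, zero_div, zero_add] at a b
    exact Prod.ext (by simp only [Prod.fst_zero]; linarith) (inner_self_eq_zero.1 b)
  refine ⟨⟨B, hiso⟩, fun x => ⟨fun hx => ?_, fun hx => ?_⟩, fun x => ⟨fun hx => ?_, fun hx => ?_⟩⟩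
  · refine nd _ fun w => ?_
    rw [← i₂]
    have := horth _ hx _ (m₂ w)
    rw [← hBs x, hT, lieProd_add_left, horth _ (m₁ _) _ (m₂ _), zero_add] at this
    exact this
  · have : T (B.symm x) ∈ F₁ := by
      rw [hT, show coordTwo hn (B.symm x) = 0 from hx, map_zero, add_zero]; exact m₁ _
    rwa [hBs] at this
  · refine nd _ fun w => ?_
    rw [← i₁]
    have := horth _ (m₁ w) _ hx
    rw [← hBs x, hT, lieProd_add_right, horth _ (m₁ _) _ (m₂ _), add_zero, lieProd_comm] at this
    exact this
  · have : T (B.symm x) ∈ F₂ := by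
      rw [hT, show coordOne hn (B.symm x) = 0 from hx, map_zero, zero_add]; exact m₂ _
    rwa [hBs] at this

end Factors

/-! ### Boxes of spheres and the rigidity of the images of the standard product -/

section Box

/-- Two vector valued functions on a set vary independently of each other. -/
def IsBox {Y V : Type*} (S : Set Y) (k₁ k₂ : Y → V) : Prop :=
  ∀ y ∈ S, ∀ z ∈ S, ∃ w ∈ S, k₁ w = k₁ y ∧ k₂ w = k₂ z

theorem IsBox.symm {Y V : Type*} {S : Set Y} {k₁ k₂ : Y → V} (h : IsBox S k₁ k₂) :
    IsBox S k₂ k₁ := fun y hy z hz => by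
  obtain ⟨w, hw, h₁, h₂⟩ := h z hz y hy
  exact ⟨w, hw, h₂, h₁⟩

variable {Y V W₁ W₂ : Type*} [AddCommGroup V] [Module ℝ V]
  [AddCommGroup W₁] [Module ℝ W₁] [AddCommGroup W₂] [Module ℝ W₂]

/-- With `y` fixed, every value `k₂ z` shares a plane with `k₁ y`. A nonzero vector of that plane in
the kernel of `c` has a nonzero `k₂ z` coefficient, because `c (k₁ y) ≠ 0`; it expresses `c (k₂ z)`
as a multiple of `c (k₁ y)`. -/
theorem IsBox.map_mem_span {S : Set Y} {k₁ k₂ : Y → V} (h : IsBox S k₁ k₂) (c : V →ₗ[ℝ] W₁)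
    (hc : ∀ y ∈ S, ∃ x ∈ Submodule.span ℝ {k₁ y, k₂ y}, x ≠ 0 ∧ c x = 0)
    {y : Y} (hy : y ∈ S) (hcy : c (k₁ y) ≠ 0) :
    (Submodule.span ℝ (k₂ '' S)).map c ≤ Submodule.span ℝ {c (k₁ y)} := by
  rw [Submodule.map_span, Submodule.span_le]
  rintro _ ⟨_, ⟨z, hz, rfl⟩, rfl⟩
  obtain ⟨w, hw, hw₁, hw₂⟩ := h y hy z hz
  obtain ⟨x, hx, hx0, hcx⟩ := hc w hw
  rw [hw₁, hw₂] at hx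
  obtain ⟨a, b, rfl⟩ := Submodule.mem_span_pair.1 hx
  rw [map_add, map_smul, map_smul] at hcx
  have hb : b ≠ 0 := by
    rintro rfl
    rw [zero_smul, add_zero] at hcx hx0
    rcases smul_eq_zero.1 hcx with rfl | h'
    · exact hx0 (zero_smul _ _)
    · exact hcy h'
  rw [SetLike.mem_coe, Submodule.mem_span_singleton]
  refine ⟨-(b⁻¹ * a), ?_⟩
  have : c (k₂ z) = b⁻¹ • (b • c (k₂ z)) := by rw [smul_smul, inv_mul_cancel₀ hb, one_smul]
  rw [this, ← neg_eq_of_add_eq_zero_right hcx]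
  module

/-- If every plane spanned by `k₁` and `k₂` meets the kernels of two jointly injective linear
maps, then one of them vanishes on all values of `k₁`. -/
theorem IsBox.forall_or_forall [FiniteDimensional ℝ V] {S : Set Y} {k₁ k₂ : Y → V} (h : IsBox S k₁ k₂)
    (c₁ : V →ₗ[ℝ] W₁) (c₂ : V →ₗ[ℝ] W₂) (hc : ∀ x, c₁ x = 0 → c₂ x = 0 → x = 0)
    (hc₁ : ∀ y ∈ S, ∃ x ∈ Submodule.span ℝ {k₁ y, k₂ y}, x ≠ 0 ∧ c₁ x = 0)
    (hc₂ : ∀ y ∈ S, ∃ x ∈ Submodule.span ℝ {k₁ y, k₂ y}, x ≠ 0 ∧ c₂ x = 0)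
    (hd : 3 ≤ finrank ℝ (Submodule.span ℝ (k₂ '' S))) :
    (∀ y ∈ S, c₁ (k₁ y) = 0) ∨ ∀ y ∈ S, c₂ (k₁ y) = 0 := by
  by_contra! hcon
  obtain ⟨⟨y, hy, hy1⟩, z, hz, hz2⟩ := hcon
  have l₁ := h.map_mem_span c₁ hc₁ hy hy1
  have l₂ := h.map_mem_span c₂ hc₂ hz hz2
  set F := Submodule.span ℝ (k₂ '' S)
  -- If neither map vanishes on all values of `k₁`, both send the span of `k₂` into lines. Being
  -- jointly injective, they would embed this span in a plane, against `hd`.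
  let f : F →ₗ[ℝ] (Submodule.span ℝ {c₁ (k₁ y)}) × (Submodule.span ℝ {c₂ (k₁ z)}) :=
    ((c₁.domRestrict F).codRestrict _ fun x => l₁ ⟨x, x.2, rfl⟩).prod
      ((c₂.domRestrict F).codRestrict _ fun x => l₂ ⟨x, x.2, rfl⟩)
  have hf : Injective f := by
    rw [injective_iff_map_eq_zero]
    intro x hx
    have h1 := congrArg (fun w => (w.1 : W₁)) hx
    have h2 := congrArg (fun w => (w.2 : W₂)) hx
    exact Subtype.ext (hc _ h1 h2)
  have := LinearMap.finrank_le_finrank_of_injective hf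
  rw [finrank_prod, finrank_span_singleton hy1, finrank_span_singleton hz2] at this
  omega

variable {p q n : ℕ} (hn : p + q + 1 = n)

theorem finrank_ker_coordTwo_comp (C : LieTransf n) :
    finrank ℝ (LinearMap.ker (coordTwo hn ∘ₗ C.1.symm.toLinearMap)) ≤ q + 2 := by
  let f := (coordOne hn ∘ₗ C.1.symm.toLinearMap).domRestrict
    (LinearMap.ker (coordTwo hn ∘ₗ C.1.symm.toLinearMap))
  have hf : Injective f := by
    rw [injective_iff_map_eq_zero]
    intro x hx
    exact Subtype.ext (C.1.symm.map_eq_zero_iff.1 (eq_zero_of_coord hn hx x.2))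
  have := LinearMap.finrank_le_finrank_of_injective hf
  simp only [finrank_prod, finrank_self, finrank_euclideanSpace_fin] at this
  omega

theorem finrank_ker_coordOne_comp (C : LieTransf n) :
    finrank ℝ (LinearMap.ker (coordOne hn ∘ₗ C.1.symm.toLinearMap)) ≤ p + 2 := by
  let f := (coordTwo hn ∘ₗ C.1.symm.toLinearMap).domRestrict
    (LinearMap.ker (coordOne hn ∘ₗ C.1.symm.toLinearMap))
  have hf : Injective f := by
    rw [injective_iff_map_eq_zero]
    intro x hx
    exact Subtype.ext (C.1.symm.map_eq_zero_iff.1 (eq_zero_of_coord hn x.2 hx))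
  have := LinearMap.finrank_le_finrank_of_injective hf
  simp only [finrank_prod, finrank_self, finrank_euclideanSpace_fin] at this
  omega

/-- By independence, any value of `k₁` and any value of `k₂`, taken at unrelated points, occur
together on one isotropic line; orthogonality then passes to the spans by bilinearity. -/
theorem IsBox.orthogonal {S : Set Y} {k₁ k₂ : Y → LieVec n} {L : Y → LieLine n}
    (h : IsBox S k₁ k₂) (hL : ∀ y ∈ S, (L y).plane = Submodule.span ℝ {k₁ y, k₂ y}) :
    ∀ x ∈ Submodule.span ℝ (k₁ '' S), ∀ y ∈ Submodule.span ℝ (k₂ '' S), lieProd x y = 0 := by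
  intro x hx y hy
  induction hx using Submodule.span_induction with
  | mem x hx =>
    obtain ⟨a, ha, rfl⟩ := hx
    induction hy using Submodule.span_induction with
    | mem y hy =>
      obtain ⟨b, hb, rfl⟩ := hy
      obtain ⟨w, hw, h₁, h₂⟩ := h a ha b hb
      rw [← h₁, ← h₂]
      exact (L w).isotropic _ (by rw [hL w hw]; exact Submodule.subset_span (by simp)) _
        (by rw [hL w hw]; exact Submodule.subset_span (by simp))
    | zero => simp
    | add x y _ _ h₁ h₂ => rw [lieProd_add_right, h₁, h₂, add_zero]
    | smul a x _ h => rw [lieProd_smul_right, h, mul_zero]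
  | zero => simp
  | add x y _ _ h₁ h₂ => rw [lieProd_add_left, h₁, h₂, add_zero]
  | smul a x _ h => rw [lieProd_smul_left, h, mul_zero]

/-- If all lines of a sufficiently large box belong to the image of the standard product under
`C`, then the spans of the box are the images of the two factors. -/
theorem IsBox.span_eq_factors (hp : 1 ≤ p) (hq : 1 ≤ q) {S : Set Y} {k₁ k₂ : Y → LieVec n}
    {L : Y → LieLine n} (h : IsBox S k₁ k₂)
    (hL : ∀ y ∈ S, (L y).plane = Submodule.span ℝ {k₁ y, k₂ y})
    (hd₁ : q + 2 ≤ finrank ℝ (Submodule.span ℝ (k₁ '' S)))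
    (hd₂ : p + 2 ≤ finrank ℝ (Submodule.span ℝ (k₂ '' S)))
    (C : LieTransf n) (hC : ∀ y ∈ S, L y ∈ Set.range (fun y => C.act (stdLift hn y))) :
    (Submodule.span ℝ (k₁ '' S) = LinearMap.ker (coordTwo hn ∘ₗ C.1.symm.toLinearMap) ∧
      Submodule.span ℝ (k₂ '' S) = LinearMap.ker (coordOne hn ∘ₗ C.1.symm.toLinearMap)) ∨
    (Submodule.span ℝ (k₁ '' S) = LinearMap.ker (coordOne hn ∘ₗ C.1.symm.toLinearMap) ∧
      Submodule.span ℝ (k₂ '' S) = LinearMap.ker (coordTwo hn ∘ₗ C.1.symm.toLinearMap)) := by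
  set c₁ := coordOne hn ∘ₗ C.1.symm.toLinearMap with hc₁
  set c₂ := coordTwo hn ∘ₗ C.1.symm.toLinearMap with hc₂
  have hjoint : ∀ x, c₁ x = 0 → c₂ x = 0 → x = 0 := fun x h1 h2 =>
    C.1.symm.map_eq_zero_iff.1 (eq_zero_of_coord hn h1 h2)
  have meet := fun y hy => (mem_range_act_stdLift hn C (L y)).1 (hC y hy)
  have e₁ : ∀ y ∈ S, ∃ x ∈ Submodule.span ℝ {k₁ y, k₂ y}, x ≠ 0 ∧ c₁ x = 0 := fun y hy => by
    rw [← hL y hy]; exact (meet y hy).2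
  have e₂ : ∀ y ∈ S, ∃ x ∈ Submodule.span ℝ {k₁ y, k₂ y}, x ≠ 0 ∧ c₂ x = 0 := fun y hy => by
    rw [← hL y hy]; exact (meet y hy).1
  have a₁ := h.forall_or_forall c₁ c₂ hjoint e₁ e₂ (by omega)
  have a₂ := h.symm.forall_or_forall c₁ c₂ hjoint
    (fun y hy => by rw [Set.pair_comm]; exact e₁ y hy)
    (fun y hy => by rw [Set.pair_comm]; exact e₂ y hy) (by omega)
  have f₁ : finrank ℝ (LinearMap.ker c₁) ≤ p + 2 := finrank_ker_coordOne_comp hn C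
  have f₂ : finrank ℝ (LinearMap.ker c₂) ≤ q + 2 := finrank_ker_coordTwo_comp hn C
  have le_of : ∀ {k : Y → LieVec n} {W : Type} [AddCommGroup W] [Module ℝ W]
      (c : LieVec n →ₗ[ℝ] W), (∀ y ∈ S, c (k y) = 0) →
      Submodule.span ℝ (k '' S) ≤ LinearMap.ker c := fun c hk => by
    rw [Submodule.span_le]; rintro _ ⟨y, hy, rfl⟩; exact hk y hy
  have horth := h.orthogonal hL
  have korth : ∀ x ∈ LinearMap.ker c₁, ∀ y ∈ LinearMap.ker c₂, lieProd x y = 0 := by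
    intro x hx y hy
    have hx' : coordOne hn (C.1.symm x) = 0 := hx
    have hy' : coordTwo hn (C.1.symm y) = 0 := hy
    rw [← C.inv.2 x y]
    change lieProd (C.1.symm x) (C.1.symm y) = 0
    rw [lieProd_eq_coord hn, hx', hy']
    simp
  have kdecomp : ∀ x, ∃ a ∈ LinearMap.ker c₁, ∃ b ∈ LinearMap.ker c₂, x = a + b := by
    intro x
    obtain ⟨z, rfl⟩ := C.1.surjective x
    refine ⟨C.1 ((z.1 - z.2.2) / 2, glue hn 0 (rightPart hn z.2.1), -((z.1 - z.2.2) / 2)), ?_,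
      C.1 ((z.1 + z.2.2) / 2, glue hn (leftPart hn z.2.1) 0, ((z.1 + z.2.2) / 2)), ?_, ?_⟩
    · simp [hc₁, coordOne]
    · simp [hc₂, coordTwo]
    · rw [← map_add]
      congr 1
      refine Prod.ext ?_ (Prod.ext ?_ ?_)
      · simp; ring
      · simp only [Prod.snd_add, Prod.fst_add]
        have := (glueL hn).map_add (0, rightPart hn z.2.1) (leftPart hn z.2.1, 0)
        simp only [Prod.mk_add_mk, zero_add, add_zero] at this
        exact (glue_leftPart_rightPart hn z.2.1).symm.trans this
      · simp; ring
  have nz : ∀ {F : Submodule ℝ (LieVec n)}, 2 ≤ finrank ℝ F →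
      (∀ x ∈ F, x = 0) → False := fun {F} hF h0 => by
    have : F = ⊥ := (Submodule.eq_bot_iff F).2 h0
    rw [this, finrank_bot] at hF; omega
  -- If both families lay in the same kernel, one of them would fill it by dimension. The other
  -- would then be orthogonal to both kernels, hence to everything, and so be zero. The mixed cases
  -- give the two alternatives; the one that exchanges the factors forces `p = q`.
  rcases a₁ with a₁ | a₁ <;> rcases a₂ with a₂ | a₂
  · exfalso
    have g₁ := le_of c₁ a₁
    have g₂ := le_of c₁ a₂
    have g := Submodule.eq_of_le_of_finrank_le g₂ (f₁.trans hd₂)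
    refine nz (F := Submodule.span ℝ (k₁ '' S)) (by omega) fun x hx =>
      lieProd_nondegenerate fun y => ?_
    obtain ⟨a, ha, b, hb, rfl⟩ := kdecomp y
    rw [lieProd_add_right, horth x hx a (g ▸ ha), korth x (g₁ hx) b hb, add_zero]
  · right
    have g₁ := le_of c₁ a₁
    have g₂ := le_of c₂ a₂
    have d₁ := Submodule.finrank_mono g₁
    have d₂ := Submodule.finrank_mono g₂
    exact ⟨Submodule.eq_of_le_of_finrank_le g₁ (by omega),
      Submodule.eq_of_le_of_finrank_le g₂ (by omega)⟩
  · left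
    have g₁ := le_of c₂ a₁
    have g₂ := le_of c₁ a₂
    exact ⟨Submodule.eq_of_le_of_finrank_le g₁ (by omega),
      Submodule.eq_of_le_of_finrank_le g₂ (by omega)⟩
  · exfalso
    have g₁ := le_of c₂ a₁
    have g₂ := le_of c₂ a₂
    have g := Submodule.eq_of_le_of_finrank_le g₁ (f₂.trans hd₁)
    refine nz (F := Submodule.span ℝ (k₂ '' S)) (by omega) fun x hx =>
      lieProd_nondegenerate fun y => ?_
    obtain ⟨a, ha, b, hb, rfl⟩ := kdecomp y
    rw [lieProd_add_right, lieProd_comm x a, korth a ha x (g₂ hx), lieProd_comm x b,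
      horth b (g ▸ hb) x hx, add_zero]

/-- Two images of the standard product which contain the lines of a sufficiently large box
coincide. -/
theorem IsBox.range_eq_range (hp : 1 ≤ p) (hq : 1 ≤ q) {S : Set Y} {k₁ k₂ : Y → LieVec n}
    {L : Y → LieLine n} (h : IsBox S k₁ k₂)
    (hL : ∀ y ∈ S, (L y).plane = Submodule.span ℝ {k₁ y, k₂ y})
    (hd₁ : q + 2 ≤ finrank ℝ (Submodule.span ℝ (k₁ '' S)))
    (hd₂ : p + 2 ≤ finrank ℝ (Submodule.span ℝ (k₂ '' S)))
    (C D : LieTransf n) (hC : ∀ y ∈ S, L y ∈ Set.range (fun y => C.act (stdLift hn y)))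
    (hD : ∀ y ∈ S, L y ∈ Set.range (fun y => D.act (stdLift hn y))) :
    Set.range (fun y => C.act (stdLift hn y)) = Set.range (fun y => D.act (stdLift hn y)) := by
  have key : (LinearMap.ker (coordTwo hn ∘ₗ C.1.symm.toLinearMap) =
        LinearMap.ker (coordTwo hn ∘ₗ D.1.symm.toLinearMap) ∧
      LinearMap.ker (coordOne hn ∘ₗ C.1.symm.toLinearMap) =
        LinearMap.ker (coordOne hn ∘ₗ D.1.symm.toLinearMap)) ∨
      (LinearMap.ker (coordTwo hn ∘ₗ C.1.symm.toLinearMap) =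
        LinearMap.ker (coordOne hn ∘ₗ D.1.symm.toLinearMap) ∧
      LinearMap.ker (coordOne hn ∘ₗ C.1.symm.toLinearMap) =
        LinearMap.ker (coordTwo hn ∘ₗ D.1.symm.toLinearMap)) := by
    rcases h.span_eq_factors hn hp hq hL hd₁ hd₂ C hC with ⟨a, b⟩ | ⟨a, b⟩ <;>
      rcases h.span_eq_factors hn hp hq hL hd₁ hd₂ D hD with ⟨c, d⟩ | ⟨c, d⟩ <;>
      rw [← a, ← b, ← c, ← d] <;> simp
  ext ℓ
  rw [mem_range_act_stdLift, mem_range_act_stdLift]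
  have m₁ : ∀ (T : LieTransf n) (x : LieVec n), coordOne hn (T.1.symm x) = 0 ↔
      x ∈ LinearMap.ker (coordOne hn ∘ₗ T.1.symm.toLinearMap) := fun _ _ => Iff.rfl
  have m₂ : ∀ (T : LieTransf n) (x : LieVec n), coordTwo hn (T.1.symm x) = 0 ↔
      x ∈ LinearMap.ker (coordTwo hn ∘ₗ T.1.symm.toLinearMap) := fun _ _ => Iff.rfl
  simp only [m₁, m₂]
  rcases key with ⟨a, b⟩ | ⟨a, b⟩
  · rw [a, b]
  · rw [a, b, and_comm]

end Box

end LieSphere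

end

noncomputable section

namespace LieSphere

open scoped Topology
open Filter

/-! ### Cyclides in a chart -/

section Calculus

variable {E : Type*} [NormedAddCommGroup E] [NormedSpace ℝ E] {n : ℕ}

theorem fderiv_lieProd {F G : E → LieVec n} {x : E} (hF : DifferentiableAt ℝ F x)
    (hG : DifferentiableAt ℝ G x) (X : E) :
    fderiv ℝ (fun y => lieProd (F y) (G y)) x X =
      lieProd (F x) (fderiv ℝ G x X) + lieProd (fderiv ℝ F x X) (G x) := by
  have := (lieBilin n).fderiv_of_bilinear hF hG
  simp only [lieBilin_apply] at this
  rw [this]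
  simp

theorem lieProd_fderiv_eq_zero {F G : E → LieVec n} {x : E} (hF : DifferentiableAt ℝ F x)
    (hG : DifferentiableAt ℝ G x) (h : ∀ᶠ y in 𝓝 x, lieProd (F y) (G y) = 0) (X : E) :
    lieProd (F x) (fderiv ℝ G x X) + lieProd (fderiv ℝ F x X) (G x) = 0 := by
  rw [← fderiv_lieProd hF hG, EventuallyEq.fderiv_eq (f := fun _ => (0 : ℝ)) h]
  simp

theorem _root_.ContDiffOn.lieProd {F G : E → LieVec n} {U : Set E} {m : WithTop ℕ∞}
    (hF : ContDiffOn ℝ m F U) (hG : ContDiffOn ℝ m G U) :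
    ContDiffOn ℝ m (fun y => lieProd (F y) (G y)) U :=
  (lieBilin n).isBoundedBilinearMap.contDiff.comp₂_contDiffOn hF hG

/-- The rank is lower semicontinuous, so the dimension of the kernel cannot jump up nearby. -/
theorem eventually_finrank_ker_le [FiniteDimensional ℝ E] {F : Type*} [NormedAddCommGroup F]
    [NormedSpace ℝ F] {Y : Type*} [TopologicalSpace Y] {G : Y → E →L[ℝ] F} {x₀ : Y}
    (hG : ContinuousAt G x₀) :
    ∀ᶠ x in 𝓝 x₀, finrank ℝ (LinearMap.ker (G x : E →ₗ[ℝ] F)) ≤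
      finrank ℝ (LinearMap.ker (G x₀ : E →ₗ[ℝ] F)) := by
  have hr : ∀ f : E →L[ℝ] F, (f : E →ₗ[ℝ] F).rank =
      (finrank ℝ (LinearMap.range (f : E →ₗ[ℝ] F)) : Cardinal) := fun f =>
    (finrank_eq_rank ℝ _).symm
  have hopen := isOpen_setOfPred_nat_le_rank (𝕜 := ℝ) (E := E) (F := F)
    (finrank ℝ (LinearMap.range (G x₀ : E →ₗ[ℝ] F)))
  filter_upwards [hG.preimage_mem_nhds (hopen.mem_nhds (by
    simp only [mem_ofPred_eq, hr]; exact le_rfl))] with x hx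
  have hx' : finrank ℝ (LinearMap.range (G x₀ : E →ₗ[ℝ] F)) ≤
      finrank ℝ (LinearMap.range (G x : E →ₗ[ℝ] F)) := by
    have : ((finrank ℝ (LinearMap.range (G x₀ : E →ₗ[ℝ] F)) : ℕ) : Cardinal) ≤
      (G x : E →ₗ[ℝ] F).rank := hx
    rw [hr] at this
    exact_mod_cast this
  have h1 := LinearMap.finrank_range_add_finrank_ker (G x : E →ₗ[ℝ] F)
  have h2 := LinearMap.finrank_range_add_finrank_ker (G x₀ : E →ₗ[ℝ] F)
  omega

end Calculus

/-! ### Shears, principal spaces and smooth curvature functions -/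

section Local

variable {E : Type*} [NormedAddCommGroup E] [NormedSpace ℝ E] {n : ℕ}

/-- The principal space of the sphere `r A + s B` at `x`, for frames `A`, `B` whose derivatives
are transversal to the lines `[A, B]`. -/
def curvKer (A B : E → LieVec n) (x : E) (r s : ℝ) : Submodule ℝ E :=
  LinearMap.ker (r • fderiv ℝ A x + s • fderiv ℝ B x : E →L[ℝ] LieVec n).toLinearMap

theorem mem_curvKer {A B : E → LieVec n} {x : E} {r s : ℝ} {X : E} :
    X ∈ curvKer A B x r s ↔ r • fderiv ℝ A x X + s • fderiv ℝ B x X = 0 := Iff.rfl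

theorem curvKer_mul (A B : E → LieVec n) (x : E) (r s : ℝ) {c : ℝ} (hc : c ≠ 0) :
    curvKer A B x (c * r) (c * s) = curvKer A B x r s := by
  ext X
  rw [mem_curvKer, mem_curvKer, mul_smul, mul_smul, ← smul_add, smul_eq_zero_iff_right hc]

/-- A cyclide of Dupin of characteristic `(p, q)` on an open subset `U` of `E`, spanned by two
frames `A`, `B` which differ by a constant linear transformation from the frame `(1, f, 0)`,
`(0, ξ, 1)`. -/
structure LocalCyclide (p q : ℕ) (U : Set E) (A B : E → LieVec n) : Prop where
  pos_left : 1 ≤ p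
  pos_right : 1 ≤ q
  finrank_eq : finrank ℝ E = p + q
  isOpen : IsOpen U
  smooth_fst : ContDiffOn ℝ ∞ A U
  smooth_snd : ContDiffOn ℝ ∞ B U
  null_fst : ∀ x ∈ U, lieProd (A x) (A x) = 0
  null_snd : ∀ x ∈ U, lieProd (B x) (B x) = 0
  isotropic : ∀ x ∈ U, lieProd (A x) (B x) = 0
  contact : ∀ x ∈ U, ∀ X, lieProd (fderiv ℝ A x X) (B x) = 0
  horizontal_fst : ∀ x ∈ U, ∀ X, (fderiv ℝ A x X).1 = 0 ∧ (fderiv ℝ A x X).2.2 = 0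
  horizontal_snd : ∀ x ∈ U, ∀ X, (fderiv ℝ B x X).1 = 0 ∧ (fderiv ℝ B x X).2.2 = 0
  two : ∀ x ∈ U, ∃ r₁ s₁ r₂ s₂ : ℝ, r₁ * s₂ - r₂ * s₁ ≠ 0 ∧
    finrank ℝ (curvKer A B x r₁ s₁) = p ∧ finrank ℝ (curvKer A B x r₂ s₂) = q ∧
    ∀ r s, curvKer A B x r s ≠ ⊥ → r * s₁ - r₁ * s = 0 ∨ r * s₂ - r₂ * s = 0
  -- Only one-dimensional curvature surfaces are retained, parametrized by the whole real line: for
  -- higher multiplicity the Codazzi equation makes the Dupin condition superfluous.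
  dupin : ∀ c : ℝ → E, ContDiff ℝ ∞ c → (∀ t, c t ∈ U) → Injective c → (∀ t, deriv c t ≠ 0) →
    ∀ r s : ℝ → ℝ, (∀ t, (r t ≠ 0 ∨ s t ≠ 0) ∧
      curvKer A B (c t) (r t) (s t) = Submodule.span ℝ {deriv c t}) →
    ∀ t t', r t * s t' - r t' * s t = 0

namespace LocalCyclide

variable {p q : ℕ} {U : Set E} {A B : E → LieVec n}

theorem contDiffAt_fst (h : LocalCyclide p q U A B) {x : E} (hx : x ∈ U) : ContDiffAt ℝ ∞ A x :=
  h.smooth_fst.contDiffAt (h.isOpen.mem_nhds hx)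

theorem contDiffAt_snd (h : LocalCyclide p q U A B) {x : E} (hx : x ∈ U) : ContDiffAt ℝ ∞ B x :=
  h.smooth_snd.contDiffAt (h.isOpen.mem_nhds hx)

theorem differentiableAt_fst (h : LocalCyclide p q U A B) {x : E} (hx : x ∈ U) :
    DifferentiableAt ℝ A x := (h.contDiffAt_fst hx).differentiableAt (by simp)

theorem differentiableAt_snd (h : LocalCyclide p q U A B) {x : E} (hx : x ∈ U) :
    DifferentiableAt ℝ B x := (h.contDiffAt_snd hx).differentiableAt (by simp)

theorem swap (h : LocalCyclide p q U A B) : LocalCyclide q p U A B :=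
  { h with
    pos_left := h.pos_right
    pos_right := h.pos_left
    finrank_eq := h.finrank_eq.trans (add_comm _ _)
    two := fun x hx => by
      obtain ⟨r₁, s₁, r₂, s₂, h0, h1, h2, h3⟩ := h.two x hx
      exact ⟨r₂, s₂, r₁, s₁, fun h' => h0 (by linarith), h2, h1, fun r s hrs => (h3 r s hrs).symm⟩ }

theorem mono (h : LocalCyclide p q U A B) {U' : Set E} (hU : U' ⊆ U) (ho : IsOpen U') :
    LocalCyclide p q U' A B where
  pos_left := h.pos_left
  pos_right := h.pos_right
  finrank_eq := h.finrank_eq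
  isOpen := ho
  smooth_fst := h.smooth_fst.mono hU
  smooth_snd := h.smooth_snd.mono hU
  null_fst x hx := h.null_fst x (hU hx)
  null_snd x hx := h.null_snd x (hU hx)
  isotropic x hx := h.isotropic x (hU hx)
  contact x hx := h.contact x (hU hx)
  horizontal_fst x hx := h.horizontal_fst x (hU hx)
  horizontal_snd x hx := h.horizontal_snd x (hU hx)
  two x hx := h.two x (hU hx)
  dupin c hc hcU := h.dupin c hc fun t => hU (hcU t)

theorem lieProd_fst_fderiv_fst (h : LocalCyclide p q U A B) {x : E} (hx : x ∈ U) (X : E) :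
    lieProd (A x) (fderiv ℝ A x X) = 0 := by
  have := lieProd_fderiv_eq_zero (h.differentiableAt_fst hx) (h.differentiableAt_fst hx)
    (by filter_upwards [h.isOpen.mem_nhds hx] with y hy using h.null_fst y hy) X
  rw [lieProd_comm (fderiv ℝ A x X)] at this
  linarith

theorem lieProd_snd_fderiv_snd (h : LocalCyclide p q U A B) {x : E} (hx : x ∈ U) (X : E) :
    lieProd (B x) (fderiv ℝ B x X) = 0 := by
  have := lieProd_fderiv_eq_zero (h.differentiableAt_snd hx) (h.differentiableAt_snd hx)
    (by filter_upwards [h.isOpen.mem_nhds hx] with y hy using h.null_snd y hy) X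
  rw [lieProd_comm (fderiv ℝ B x X)] at this
  linarith

theorem lieProd_fst_fderiv_snd (h : LocalCyclide p q U A B) {x : E} (hx : x ∈ U) (X : E) :
    lieProd (A x) (fderiv ℝ B x X) = 0 := by
  have := lieProd_fderiv_eq_zero (h.differentiableAt_fst hx) (h.differentiableAt_snd hx)
    (by filter_upwards [h.isOpen.mem_nhds hx] with y hy using h.isotropic y hy) X
  rwa [h.contact x hx, add_zero] at this

theorem differentiableAt_fderiv_fst (h : LocalCyclide p q U A B) {x : E} (hx : x ∈ U) :
    DifferentiableAt ℝ (fderiv ℝ A) x :=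
  ((h.contDiffAt_fst hx).fderiv_right (m := ∞) (by exact_mod_cast le_top)).differentiableAt
    (by simp)

theorem differentiableAt_fderiv_snd (h : LocalCyclide p q U A B) {x : E} (hx : x ∈ U) :
    DifferentiableAt ℝ (fderiv ℝ B) x :=
  ((h.contDiffAt_snd hx).fderiv_right (m := ∞) (by exact_mod_cast le_top)).differentiableAt
    (by simp)

theorem fderiv_fderiv_fst_symm (h : LocalCyclide p q U A B) {x : E} (hx : x ∈ U) (X Y : E) :
    fderiv ℝ (fderiv ℝ A) x X Y = fderiv ℝ (fderiv ℝ A) x Y X :=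
  ((h.contDiffAt_fst hx).isSymmSndFDerivAt (by
    rw [minSmoothness_of_isRCLikeNormedField]; exact WithTop.coe_le_coe.2 le_top)).eq X Y

theorem fderiv_fderiv_snd_symm (h : LocalCyclide p q U A B) {x : E} (hx : x ∈ U) (X Y : E) :
    fderiv ℝ (fderiv ℝ B) x X Y = fderiv ℝ (fderiv ℝ B) x Y X :=
  ((h.contDiffAt_snd hx).isSymmSndFDerivAt (by
    rw [minSmoothness_of_isRCLikeNormedField]; exact WithTop.coe_le_coe.2 le_top)).eq X Y

theorem _root_.fderiv_fderiv_apply {F : Type*} [NormedAddCommGroup F] [NormedSpace ℝ F]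
    {f : E → F} {x : E} (hf : DifferentiableAt ℝ (fderiv ℝ f) x) (X Y : E) :
    fderiv ℝ (fun y => fderiv ℝ f y Y) x X = fderiv ℝ (fderiv ℝ f) x X Y := by
  rw [fderiv_clm_apply hf (differentiableAt_const Y)]
  simp

/-- The second fundamental form is symmetric. -/
theorem lieProd_fderiv_symm (h : LocalCyclide p q U A B) {x : E} (hx : x ∈ U) (X Y : E) :
    lieProd (fderiv ℝ A x X) (fderiv ℝ B x Y) = lieProd (fderiv ℝ A x Y) (fderiv ℝ B x X) := by
  -- Differentiating the contact condition `⟨dA Y, B⟩ = 0` along `X` expresses the second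
  -- fundamental form through `⟨D²A(X, Y), B⟩`, which is symmetric in `X` and `Y`.
  have key : ∀ X Y, lieProd (fderiv ℝ A x Y) (fderiv ℝ B x X) +
      lieProd (fderiv ℝ (fderiv ℝ A) x X Y) (B x) = 0 := fun X Y => by
    rw [← fderiv_fderiv_apply (h.differentiableAt_fderiv_fst hx)]
    exact lieProd_fderiv_eq_zero (F := fun y => fderiv ℝ A y Y)
      ((h.differentiableAt_fderiv_fst hx).clm_apply (differentiableAt_const Y))
      (h.differentiableAt_snd hx)
      (by filter_upwards [h.isOpen.mem_nhds hx] with y hy using h.contact y hy Y) X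
  have h1 := key X Y
  have h2 := key Y X
  rw [h.fderiv_fderiv_fst_symm hx] at h1
  linarith

theorem fderiv_shear (h : LocalCyclide p q U A B) (t : ℝ) {x : E} (hx : x ∈ U) (X : E) :
    fderiv ℝ (fun y => A y + t • B y) x X = fderiv ℝ A x X + t • fderiv ℝ B x X := by
  have := (h.differentiableAt_fst hx).hasFDerivAt.add
    ((h.differentiableAt_snd hx).hasFDerivAt.const_smul t)
  rw [HasFDerivAt.fderiv (f := fun y => A y + t • B y) this]
  rfl

theorem curvKer_shear (h : LocalCyclide p q U A B) (t : ℝ) {x : E} (hx : x ∈ U) (r s : ℝ) :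
    curvKer (fun y => A y + t • B y) B x r s = curvKer A B x r (r * t + s) := by
  ext X
  rw [mem_curvKer, mem_curvKer, h.fderiv_shear t hx]
  rw [show r • (fderiv ℝ A x X + t • fderiv ℝ B x X) + s • fderiv ℝ B x X =
    r • fderiv ℝ A x X + (r * t + s) • fderiv ℝ B x X by module]

/-- Replacing `A` by `A + tB` leaves every line unchanged and amounts to passing to a parallel
hypersurface. It serves to move away from focal points, where `A` fails to be an immersion. -/
theorem shear (h : LocalCyclide p q U A B) (t : ℝ) :
    LocalCyclide p q U (fun y => A y + t • B y) B := by
  have hd := fun x (hx : x ∈ U) X => h.fderiv_shear t hx X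
  refine
    { pos_left := h.pos_left
      pos_right := h.pos_right
      finrank_eq := h.finrank_eq
      isOpen := h.isOpen
      smooth_fst := h.smooth_fst.add (h.smooth_snd.const_smul t)
      smooth_snd := h.smooth_snd
      null_fst := fun x hx => ?_
      null_snd := h.null_snd
      isotropic := fun x hx => ?_
      contact := fun x hx X => ?_
      horizontal_fst := fun x hx X => ?_
      horizontal_snd := h.horizontal_snd
      two := fun x hx => ?_
      dupin := fun c hc hcU hci hc0 r s hrs t₁ t₂ => ?_ }
  · simp only [lieProd_add_left, lieProd_add_right, lieProd_smul_left, lieProd_smul_right,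
      h.null_fst x hx, h.null_snd x hx, h.isotropic x hx, lieProd_comm (B x) (A x)]
    ring
  · simp only [lieProd_add_left, lieProd_smul_left, h.null_snd x hx, h.isotropic x hx]
    ring
  · rw [hd x hx, lieProd_add_left, lieProd_smul_left, h.contact x hx,
      lieProd_comm (fderiv ℝ B x X), h.lieProd_snd_fderiv_snd hx]
    ring
  · rw [hd x hx]
    obtain ⟨a, b⟩ := h.horizontal_fst x hx X
    obtain ⟨c, d⟩ := h.horizontal_snd x hx X
    simp [a, b, c, d]
  · obtain ⟨r₁, s₁, r₂, s₂, h0, h1, h2, h3⟩ := h.two x hx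
    refine ⟨r₁, s₁ - r₁ * t, r₂, s₂ - r₂ * t, fun h' => h0 (by linarith), ?_, ?_,
      fun r s hrs => ?_⟩
    · rw [h.curvKer_shear t hx, add_sub_cancel, h1]
    · rw [h.curvKer_shear t hx, add_sub_cancel, h2]
    · rw [h.curvKer_shear t hx] at hrs
      exact (h3 _ _ hrs).imp (fun e => by linarith) (fun e => by linarith)
  · have := h.dupin c hc hcU hci hc0 r (fun τ => r τ * t + s τ) (fun τ => ⟨?_, ?_⟩) t₁ t₂
    · linarith
    · by_contra! h'
      obtain ⟨a, b⟩ := h'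
      rw [a, zero_mul, zero_add] at b
      exact (hrs τ).1.elim (fun x => x a) (fun x => x b)
    · rw [← h.curvKer_shear t (hcU τ), (hrs τ).2]

/-- After a shear the first frame is an immersion at a given point. -/
theorem exists_shear_injective (h : LocalCyclide p q U A B) {x : E} (hx : x ∈ U) :
    ∃ t : ℝ, ∀ X, fderiv ℝ (fun y => A y + t • B y) x X = 0 → X = 0 := by
  obtain ⟨r₁, s₁, r₂, s₂, h0, h1, h2, h3⟩ := h.two x hx
  -- The value `t` is bad only if `A + tB` is one of the two curvature spheres. Each of the two
  -- linear functions of `t` is not identically zero and so has at most one root; hence one of the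
  -- values 0, 1, 2 avoids both.
  obtain ⟨t, ht1, ht2⟩ : ∃ t : ℝ, s₁ - r₁ * t ≠ 0 ∧ s₂ - r₂ * t ≠ 0 := by
    by_contra! hcon
    have key : ∀ t, s₁ - r₁ * t = 0 ∨ s₂ - r₂ * t = 0 := fun t => by
      by_cases h' : s₁ - r₁ * t = 0
      · exact Or.inl h'
      · exact Or.inr (hcon t h')
    have nz : ∀ {r s t t' : ℝ}, t ≠ t' → s - r * t = 0 → s - r * t' = 0 → r = 0 ∧ s = 0 :=
      fun {r s t t'} hne e e' => by
        have : r * (t - t') = 0 := by linarith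
        have hr : r = 0 := (mul_eq_zero.1 this).resolve_right (sub_ne_zero.2 hne)
        exact ⟨hr, by rw [hr] at e; linarith⟩
    have z1 : r₁ = 0 ∧ s₁ = 0 → False := fun ⟨a, b⟩ => h0 (by rw [a, b]; ring)
    have z2 : r₂ = 0 ∧ s₂ = 0 → False := fun ⟨a, b⟩ => h0 (by rw [a, b]; ring)
    have k0 := key 0
    have k1 := key 1
    have k2 := key 2
    rcases k0 with k0 | k0 <;> rcases k1 with k1 | k1 <;> rcases k2 with k2 | k2 <;>
    first
    | exact z1 (nz (by norm_num) k0 k1)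
    | exact z1 (nz (by norm_num) k0 k2)
    | exact z1 (nz (by norm_num) k1 k2)
    | exact z2 (nz (by norm_num) k0 k1)
    | exact z2 (nz (by norm_num) k0 k2)
    | exact z2 (nz (by norm_num) k1 k2)
  refine ⟨t, fun X hX => ?_⟩
  have hmem : X ∈ curvKer (fun y => A y + t • B y) B x 1 0 := by
    rw [mem_curvKer, hX]; simp
  rw [h.curvKer_shear t hx] at hmem
  by_contra hX0
  rcases h3 1 (1 * t + 0) (fun hb => hX0 (by rw [hb] at hmem; exact hmem)) with e | e
  · exact ht1 (by linarith)
  · exact ht2 (by linarith)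

theorem finiteDimensional (h : LocalCyclide p q U A B) : FiniteDimensional ℝ E :=
  FiniteDimensional.of_finrank_pos (by rw [h.finrank_eq]; have := h.pos_left; omega)

/-- Where the first frame is an immersion, the curvature spheres are of the form `κ A + B`. -/
theorem exists_curvatures (h : LocalCyclide p q U A B) {x : E} (hx : x ∈ U)
    (hinj : ∀ X, fderiv ℝ A x X = 0 → X = 0) :
    ∃ κ₁ κ₂ : ℝ, κ₁ ≠ κ₂ ∧ finrank ℝ (curvKer A B x κ₁ 1) = p ∧
      finrank ℝ (curvKer A B x κ₂ 1) = q := by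
  obtain ⟨r₁, s₁, r₂, s₂, h0, h1, h2, -⟩ := h.two x hx
  have hp := h.pos_left
  have hq := h.pos_right
  have ker0 : ∀ r : ℝ, r ≠ 0 → finrank ℝ (curvKer A B x r 0) = 0 := fun r hr => by
    have : curvKer A B x r 0 = ⊥ := (Submodule.eq_bot_iff _).2 fun X hX => by
      rw [mem_curvKer, zero_smul, add_zero, smul_eq_zero_iff_right hr] at hX
      exact hinj X hX
    rw [this, finrank_bot]
  -- With `s = 0` the sphere would be a multiple of `A`, whose principal space is zero since `A` is
  -- an immersion. So both curvature spheres can be normalised to have coefficient 1 at `B`.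
  have hs1 : s₁ ≠ 0 := by
    rintro rfl
    have : r₁ ≠ 0 := by rintro rfl; simp at h0
    rw [ker0 _ this] at h1; omega
  have hs2 : s₂ ≠ 0 := by
    rintro rfl
    have : r₂ ≠ 0 := by rintro rfl; simp at h0
    rw [ker0 _ this] at h2; omega
  refine ⟨r₁ / s₁, r₂ / s₂, fun e => h0 ?_, ?_, ?_⟩
  · rw [div_eq_div_iff hs1 hs2] at e; linarith
  · rw [← curvKer_mul A B x _ _ hs1, mul_div_cancel₀ _ hs1, mul_one, h1]
  · rw [← curvKer_mul A B x _ _ hs2, mul_div_cancel₀ _ hs2, mul_one, h2]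

end LocalCyclide

/-- The two principal spaces decompose the tangent space. -/
theorem exists_add_mem_curvKer [FiniteDimensional ℝ E] {A B : E → LieVec n} {x : E} {α β : ℝ}
    (hinj : ∀ X, fderiv ℝ A x X = 0 → X = 0) (hne : α ≠ β)
    (hd : finrank ℝ E = finrank ℝ (curvKer A B x α 1) + finrank ℝ (curvKer A B x β 1)) (X : E) :
    ∃ Y ∈ curvKer A B x α 1, ∃ Z ∈ curvKer A B x β 1, Y + Z = X := by
  have hdis : Disjoint (curvKer A B x α 1) (curvKer A B x β 1) := by
    rw [Submodule.disjoint_def]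
    intro X h1 h2
    rw [mem_curvKer] at h1 h2
    apply hinj
    have : (α - β) • fderiv ℝ A x X = 0 := by
      rw [show (α - β) • fderiv ℝ A x X = (α • fderiv ℝ A x X + (1 : ℝ) • fderiv ℝ B x X) -
        (β • fderiv ℝ A x X + (1 : ℝ) • fderiv ℝ B x X) by module, h1, h2, sub_zero]
    exact (smul_eq_zero.1 this).resolve_left (sub_ne_zero.2 hne)
  have := Submodule.eq_top_of_disjoint _ _ hd.le hdis
  exact Submodule.mem_sup.1 (this ▸ Submodule.mem_top)

namespace LocalCyclide

variable {p q : ℕ} {U : Set E} {A B : E → LieVec n}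

/-- The third fundamental form is a combination of the first and the second one. -/
theorem lieProd_curvature_eq_zero (h : LocalCyclide p q U A B) {x : E} (hx : x ∈ U)
    (hinj : ∀ X, fderiv ℝ A x X = 0 → X = 0) {α β : ℝ} (hne : α ≠ β)
    (hd : finrank ℝ (curvKer A B x α 1) + finrank ℝ (curvKer A B x β 1) = p + q) (V W : E) :
    lieProd (α • fderiv ℝ A x V + fderiv ℝ B x V) (β • fderiv ℝ A x W + fderiv ℝ B x W) = 0 := by
  have := h.finiteDimensional
  have hd' := h.finrank_eq.trans hd.symm
  obtain ⟨V₁, hV₁, V₂, hV₂, rfl⟩ := exists_add_mem_curvKer hinj hne hd' V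
  obtain ⟨W₁, hW₁, W₂, hW₂, rfl⟩ := exists_add_mem_curvKer hinj hne hd' W
  simp only [mem_curvKer, one_smul] at hV₁ hV₂ hW₁ hW₂
  have e₁ : α • fderiv ℝ A x (V₁ + V₂) + fderiv ℝ B x (V₁ + V₂) = (α - β) • fderiv ℝ A x V₂ := by
    rw [map_add, map_add, show α • (fderiv ℝ A x V₁ + fderiv ℝ A x V₂) +
      (fderiv ℝ B x V₁ + fderiv ℝ B x V₂) = (α • fderiv ℝ A x V₁ + fderiv ℝ B x V₁) +
      (β • fderiv ℝ A x V₂ + fderiv ℝ B x V₂) + (α - β) • fderiv ℝ A x V₂ by module, hV₁, hV₂,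
      zero_add, zero_add]
  have e₂ : β • fderiv ℝ A x (W₁ + W₂) + fderiv ℝ B x (W₁ + W₂) = (β - α) • fderiv ℝ A x W₁ := by
    rw [map_add, map_add, show β • (fderiv ℝ A x W₁ + fderiv ℝ A x W₂) +
      (fderiv ℝ B x W₁ + fderiv ℝ B x W₂) = (α • fderiv ℝ A x W₁ + fderiv ℝ B x W₁) +
      (β • fderiv ℝ A x W₂ + fderiv ℝ B x W₂) + (β - α) • fderiv ℝ A x W₁ by module, hW₁, hW₂,
      zero_add, zero_add]
  have b₁ : fderiv ℝ B x W₁ = (-α) • fderiv ℝ A x W₁ := by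
    rw [neg_smul]; exact eq_neg_of_add_eq_zero_right hW₁
  have b₂ : fderiv ℝ B x V₂ = (-β) • fderiv ℝ A x V₂ := by
    rw [neg_smul]; exact eq_neg_of_add_eq_zero_right hV₂
  have hs := h.lieProd_fderiv_symm hx V₂ W₁
  rw [b₁, b₂, lieProd_smul_right, lieProd_smul_right, lieProd_comm (fderiv ℝ A x W₁)] at hs
  -- The principal spaces are orthogonal, as eigenspaces of a self-adjoint operator for distinct
  -- eigenvalues. The operator `αdA + dB` sees only the second component of `V`, and `βdA + dB` only
  -- the first component of `W`.
  have h0 : lieProd (fderiv ℝ A x V₂) (fderiv ℝ A x W₁) = 0 := by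
    have : (β - α) * lieProd (fderiv ℝ A x V₂) (fderiv ℝ A x W₁) = 0 := by linarith
    exact (mul_eq_zero.1 this).resolve_left (sub_ne_zero.2 hne.symm)
  rw [e₁, e₂, lieProd_smul_left, lieProd_smul_right, h0, mul_zero, mul_zero]

theorem eventually_injective (h : LocalCyclide p q U A B) {x₀ : E} (hx₀ : x₀ ∈ U)
    (hinj : ∀ X, fderiv ℝ A x₀ X = 0 → X = 0) :
    ∀ᶠ x in 𝓝 x₀, ∀ X, fderiv ℝ A x X = 0 → X = 0 := by
  have := h.finiteDimensional
  have hb : LinearMap.ker (fderiv ℝ A x₀ : E →ₗ[ℝ] LieVec n) = ⊥ :=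
    (Submodule.eq_bot_iff _).2 hinj
  filter_upwards [eventually_finrank_ker_le (h.differentiableAt_fderiv_fst hx₀).continuousAt]
    with x hx
  rw [hb, finrank_bot, Nat.le_zero, Submodule.finrank_eq_zero] at hx
  exact (Submodule.eq_bot_iff _).1 hx

/-- The curvatures are, locally and up to order, smooth functions. -/
theorem exists_smooth_curvatures (h : LocalCyclide p q U A B) {x₀ : E} (hx₀ : x₀ ∈ U)
    (hinj : ∀ X, fderiv ℝ A x₀ X = 0 → X = 0) :
    ∃ U' ⊆ U, IsOpen U' ∧ x₀ ∈ U' ∧ ∃ α β : E → ℝ, ContDiffOn ℝ ∞ α U' ∧ ContDiffOn ℝ ∞ β U' ∧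
      ∀ x ∈ U', (∀ X, fderiv ℝ A x X = 0 → X = 0) ∧ α x ≠ β x ∧
        ((finrank ℝ (curvKer A B x (α x) 1) = p ∧ finrank ℝ (curvKer A B x (β x) 1) = q) ∨
         (finrank ℝ (curvKer A B x (α x) 1) = q ∧ finrank ℝ (curvKer A B x (β x) 1) = p)) := by
  have := h.finiteDimensional
  have hp := h.pos_left
  have hq := h.pos_right
  have dA : ContDiffOn ℝ ∞ (fderiv ℝ A) U :=
    h.smooth_fst.fderiv_of_isOpen h.isOpen (by exact_mod_cast le_top)
  have dB : ContDiffOn ℝ ∞ (fderiv ℝ B) U :=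
    h.smooth_snd.fderiv_of_isOpen h.isOpen (by exact_mod_cast le_top)
  have dA' : ∀ X, ContDiffOn ℝ ∞ (fun y => fderiv ℝ A y X) U := fun X =>
    dA.clm_apply contDiffOn_const
  have dB' : ∀ X, ContDiffOn ℝ ∞ (fun y => fderiv ℝ B y X) U := fun X =>
    dB.clm_apply contDiffOn_const
  let I₁ : E → E → ℝ := fun X y => lieProd (fderiv ℝ A y X) (fderiv ℝ A y X)
  let I₂ : E → E → ℝ := fun X y => lieProd (fderiv ℝ A y X) (fderiv ℝ B y X)
  let I₃ : E → E → ℝ := fun X y => lieProd (fderiv ℝ B y X) (fderiv ℝ B y X)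
  have s₁ : ∀ X, ContDiffOn ℝ ∞ (I₁ X) U := fun X => (dA' X).lieProd (dA' X)
  have s₂ : ∀ X, ContDiffOn ℝ ∞ (I₂ X) U := fun X => (dA' X).lieProd (dB' X)
  have s₃ : ∀ X, ContDiffOn ℝ ∞ (I₃ X) U := fun X => (dB' X).lieProd (dB' X)
  obtain ⟨a, b, hab, ha, hb⟩ := h.exists_curvatures hx₀ hinj
  obtain ⟨X, hX, hX0⟩ : ∃ X ∈ curvKer A B x₀ a 1, X ≠ 0 := by
    apply Submodule.exists_mem_ne_zero_of_ne_bot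
    intro e; rw [e, finrank_bot] at ha; omega
  obtain ⟨Y, hY, hY0⟩ : ∃ Y ∈ curvKer A B x₀ b 1, Y ≠ 0 := by
    apply Submodule.exists_mem_ne_zero_of_ne_bot
    intro e; rw [e, finrank_bot] at hb; omega
  -- By `rel` below, `I₃ + tI₂ + dI₁ = 0` on every vector, where `t` and `d` are the sum and the
  -- product of the curvatures. Two fixed vectors `X`, `Y` give a linear system for `(t, d)` with
  -- smooth coefficients. Its determinant is nonzero at `x₀`, since there `X` and `Y` are principal
  -- for different curvatures, and Cramer's rule solves it nearby.
  let det : E → ℝ := fun y => I₁ X y * I₂ Y y - I₁ Y y * I₂ X y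
  have sdet : ContDiffOn ℝ ∞ det U := ((s₁ X).mul (s₂ Y)).sub ((s₁ Y).mul (s₂ X))
  have posI : ∀ {Z : E}, Z ≠ 0 → 0 < I₁ Z x₀ := fun {Z} hZ =>
    lieProd_horizontal_self_pos (h.horizontal_fst _ hx₀ Z).1 (h.horizontal_fst _ hx₀ Z).2
      fun e => hZ (hinj Z e)
  have I₂eq : ∀ {κ : ℝ} {Z : E}, Z ∈ curvKer A B x₀ κ 1 → I₂ Z x₀ = -κ * I₁ Z x₀ :=
    fun {κ Z} hZ => by
      have e : fderiv ℝ B x₀ Z = (-κ) • fderiv ℝ A x₀ Z := by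
        rw [mem_curvKer, one_smul] at hZ
        rw [neg_smul]; exact eq_neg_of_add_eq_zero_right hZ
      simp only [I₁, I₂, e, lieProd_smul_right]
  have hdet0 : det x₀ ≠ 0 := by
    have : det x₀ = (a - b) * (I₁ X x₀ * I₁ Y x₀) := by
      simp only [det, I₂eq hX, I₂eq hY]; ring
    rw [this]
    exact mul_ne_zero (sub_ne_zero.2 hab) (mul_pos (posI hX0) (posI hY0)).ne'
  have hev : ∀ᶠ x in 𝓝 x₀, x ∈ U ∧ (∀ X, fderiv ℝ A x X = 0 → X = 0) ∧ det x ≠ 0 :=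
    (h.isOpen.eventually_mem hx₀).and ((h.eventually_injective hx₀ hinj).and
      ((sdet.continuousOn.continuousAt (h.isOpen.mem_nhds hx₀)).eventually_ne hdet0))
  obtain ⟨U', hU', hU'o, hxU'⟩ := eventually_nhds_iff.1 hev
  have hsub : U' ⊆ U := fun x hx => (hU' x hx).1
  let t : E → ℝ := fun y => -(I₁ X y * I₃ Y y - I₁ Y y * I₃ X y) / det y
  let d : E → ℝ := fun y => (I₂ X y * I₃ Y y - I₂ Y y * I₃ X y) / det y
  have st : ContDiffOn ℝ ∞ t U' := ((((s₁ X).mul (s₃ Y)).sub ((s₁ Y).mul (s₃ X))).neg.mono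
    hsub).div (sdet.mono hsub) fun x hx => (hU' x hx).2.2
  have sd : ContDiffOn ℝ ∞ d U' := ((((s₂ X).mul (s₃ Y)).sub ((s₂ Y).mul (s₃ X))).mono
    hsub).div (sdet.mono hsub) fun x hx => (hU' x hx).2.2
  have key : ∀ x ∈ U', ∃ κ₁ κ₂ : ℝ, κ₁ ≠ κ₂ ∧ finrank ℝ (curvKer A B x κ₁ 1) = p ∧
      finrank ℝ (curvKer A B x κ₂ 1) = q ∧ t x = κ₁ + κ₂ ∧ d x = κ₁ * κ₂ := by
    intro x hx
    obtain ⟨hxU, hxi, hxd⟩ := hU' x hx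
    obtain ⟨κ₁, κ₂, hκ, h1, h2⟩ := h.exists_curvatures hxU hxi
    refine ⟨κ₁, κ₂, hκ, h1, h2, ?_⟩
    have rel : ∀ Z, I₃ Z x + (κ₁ + κ₂) * I₂ Z x + κ₁ * κ₂ * I₁ Z x = 0 := fun Z => by
      have := h.lieProd_curvature_eq_zero hxU hxi hκ (by rw [h1, h2]) Z Z
      simp only [lieProd_add_left, lieProd_add_right, lieProd_smul_left, lieProd_smul_right,
        lieProd_comm (fderiv ℝ B x Z) (fderiv ℝ A x Z)] at this
      simp only [I₁, I₂, I₃]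
      linarith
    have rX := rel X
    have rY := rel Y
    constructor
    · simp only [t]
      rw [div_eq_iff hxd]
      simp only [det]
      linear_combination I₁ Y x * rX - I₁ X x * rY
    · simp only [d]
      rw [div_eq_iff hxd]
      simp only [det]
      linear_combination I₂ X x * rY - I₂ Y x * rX
  -- The discriminant is `(κ₁ - κ₂)²`, so its square root is smooth, and so are the two roots.
  -- Sorting them by size may attach either multiplicity to the larger one, whence the disjunction.
  have hdisc : ∀ x ∈ U', 0 < t x ^ 2 - 4 * d x := fun x hx => by
    obtain ⟨κ₁, κ₂, hκ, -, -, h1, h2⟩ := key x hx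
    rw [h1, h2, show (κ₁ + κ₂) ^ 2 - 4 * (κ₁ * κ₂) = (κ₁ - κ₂) ^ 2 by ring]
    exact sq_pos_of_ne_zero (sub_ne_zero.2 hκ)
  have sdisc : ContDiffOn ℝ ∞ (fun x => √(t x ^ 2 - 4 * d x)) U' :=
    ((st.pow 2).sub (contDiffOn_const.mul sd)).sqrt fun x hx => (hdisc x hx).ne'
  refine ⟨U', hsub, hU'o, hxU', fun x => (t x + √(t x ^ 2 - 4 * d x)) / 2,
    fun x => (t x - √(t x ^ 2 - 4 * d x)) / 2, (st.add sdisc).div_const 2,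
    (st.sub sdisc).div_const 2, fun x hx => ⟨(hU' x hx).2.1, ?_, ?_⟩⟩
  · have := Real.sqrt_pos.2 (hdisc x hx)
    intro e; simp only at e; linarith
  · obtain ⟨κ₁, κ₂, hκ, f1, f2, h1, h2⟩ := key x hx
    have hsq : √(t x ^ 2 - 4 * d x) = |κ₁ - κ₂| := by
      rw [h1, h2, show (κ₁ + κ₂) ^ 2 - 4 * (κ₁ * κ₂) = (κ₁ - κ₂) ^ 2 by ring, Real.sqrt_sq_eq_abs]
    rcases le_total κ₂ κ₁ with hle | hle
    · left
      have e₁ : (t x + √(t x ^ 2 - 4 * d x)) / 2 = κ₁ := by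
        rw [hsq, h1, abs_of_nonneg (by linarith)]; ring
      have e₂ : (t x - √(t x ^ 2 - 4 * d x)) / 2 = κ₂ := by
        rw [hsq, h1, abs_of_nonneg (by linarith)]; ring
      exact ⟨(congrArg (fun κ => finrank ℝ (curvKer A B x κ 1)) e₁).trans f1,
        (congrArg (fun κ => finrank ℝ (curvKer A B x κ 1)) e₂).trans f2⟩
    · right
      have e₁ : (t x + √(t x ^ 2 - 4 * d x)) / 2 = κ₂ := by
        rw [hsq, h1, abs_of_nonpos (by linarith)]; ring
      have e₂ : (t x - √(t x ^ 2 - 4 * d x)) / 2 = κ₁ := by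
        rw [hsq, h1, abs_of_nonpos (by linarith)]; ring
      exact ⟨(congrArg (fun κ => finrank ℝ (curvKer A B x κ 1)) e₁).trans f2,
        (congrArg (fun κ => finrank ℝ (curvKer A B x κ 1)) e₂).trans f1⟩

end LocalCyclide

/-- A local cyclide with smooth curvature functions `α`, `β` of respective multiplicities
`p`, `q`. -/
structure CurvatureData (p q : ℕ) (U : Set E) (A B : E → LieVec n) (α β : E → ℝ) : Prop
    extends LocalCyclide p q U A B where
  smooth_left : ContDiffOn ℝ ∞ α U
  smooth_right : ContDiffOn ℝ ∞ β U
  ne : ∀ x ∈ U, α x ≠ β x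
  injective : ∀ x ∈ U, ∀ X, fderiv ℝ A x X = 0 → X = 0
  finrank_left : ∀ x ∈ U, finrank ℝ (curvKer A B x (α x) 1) = p
  finrank_right : ∀ x ∈ U, finrank ℝ (curvKer A B x (β x) 1) = q

variable {p q : ℕ} {U : Set E} {A B : E → LieVec n} {α β : E → ℝ}

theorem CurvatureData.swap (h : CurvatureData p q U A B α β) : CurvatureData q p U A B β α where
  toLocalCyclide := h.toLocalCyclide.swap
  smooth_left := h.smooth_right
  smooth_right := h.smooth_left
  ne x hx := (h.ne x hx).symm
  injective := h.injective
  finrank_left := h.finrank_right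
  finrank_right := h.finrank_left

theorem LocalCyclide.exists_curvatureData (h : LocalCyclide p q U A B) {x₀ : E} (hx₀ : x₀ ∈ U)
    (hinj : ∀ X, fderiv ℝ A x₀ X = 0 → X = 0) :
    ∃ U' ⊆ U, x₀ ∈ U' ∧ ∃ α β : E → ℝ, CurvatureData p q U' A B α β := by
  have := h.finiteDimensional
  obtain ⟨U₁, hU₁, ho, hx₁, α, β, sα, sβ, hr⟩ := h.exists_smooth_curvatures hx₀ hinj
  have aux : ∀ α β : E → ℝ, ContDiffOn ℝ ∞ α U₁ → ContDiffOn ℝ ∞ β U₁ →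
      (∀ x ∈ U₁, (∀ X, fderiv ℝ A x X = 0 → X = 0) ∧ α x ≠ β x ∧
        ((finrank ℝ (curvKer A B x (α x) 1) = p ∧ finrank ℝ (curvKer A B x (β x) 1) = q) ∨
         (finrank ℝ (curvKer A B x (α x) 1) = q ∧ finrank ℝ (curvKer A B x (β x) 1) = p))) →
      finrank ℝ (curvKer A B x₀ (α x₀) 1) = p → finrank ℝ (curvKer A B x₀ (β x₀) 1) = q →
      ∃ U' ⊆ U, x₀ ∈ U' ∧ ∃ α β : E → ℝ, CurvatureData p q U' A B α β := by
    intro α β sα sβ hr h1 h2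
    have cont : ∀ {γ : E → ℝ}, ContDiffOn ℝ ∞ γ U₁ →
        ContinuousAt (fun x => γ x • fderiv ℝ A x + (1 : ℝ) • fderiv ℝ B x) x₀ := fun sγ =>
      ((sγ.continuousOn.continuousAt (ho.mem_nhds hx₁)).smul
        (h.differentiableAt_fderiv_fst hx₀).continuousAt).add
        ((h.differentiableAt_fderiv_snd hx₀).continuousAt.const_smul (1 : ℝ))
    -- Near `x₀` the dimensions are at most `p` and `q` by semicontinuity. As they are `p` and `q`
    -- in some order, the order cannot change except when `p = q`, where it does not matter.
    have hev : ∀ᶠ x in 𝓝 x₀, x ∈ U₁ ∧ finrank ℝ (curvKer A B x (α x) 1) ≤ p ∧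
        finrank ℝ (curvKer A B x (β x) 1) ≤ q := by
      filter_upwards [ho.mem_nhds hx₁, eventually_finrank_ker_le (cont sα),
        eventually_finrank_ker_le (cont sβ)] with x hx e1 e2
      exact ⟨hx, e1.trans_eq h1, e2.trans_eq h2⟩
    obtain ⟨U', hU', hU'o, hxU'⟩ := eventually_nhds_iff.1 hev
    have hsub : U' ⊆ U₁ := fun x hx => (hU' x hx).1
    refine ⟨U', hsub.trans hU₁, hxU', α, β,
      { toLocalCyclide := h.mono (hsub.trans hU₁) hU'o
        smooth_left := sα.mono hsub
        smooth_right := sβ.mono hsub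
        ne := fun x hx => (hr x (hsub hx)).2.1
        injective := fun x hx => (hr x (hsub hx)).1
        finrank_left := fun x hx => ?_
        finrank_right := fun x hx => ?_ }⟩
    · obtain ⟨-, l1, l2⟩ := hU' x hx
      rcases (hr x (hsub hx)).2.2 with ⟨e1, e2⟩ | ⟨e1, e2⟩ <;> omega
    · obtain ⟨-, l1, l2⟩ := hU' x hx
      rcases (hr x (hsub hx)).2.2 with ⟨e1, e2⟩ | ⟨e1, e2⟩ <;> omega
  rcases (hr x₀ hx₁).2.2 with ⟨e1, e2⟩ | ⟨e1, e2⟩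
  · exact aux α β sα sβ hr e1 e2
  · exact aux β α sβ sα (fun x hx => ⟨(hr x hx).1, (hr x hx).2.1.symm,
      (hr x hx).2.2.symm.imp And.symm And.symm⟩) e2 e1

end Local

end LieSphere

end

noncomputable section

namespace LieSphere

open scoped Topology
open Filter

/-! ### The curvatures are constant along their principal directions -/

section IntegralCurve

variable {E : Type*} [NormedAddCommGroup E] [NormedSpace ℝ E]

/-- Integral curves of a smooth vector field are smooth. -/
theorem contDiffOn_integralCurve {v : E → E} {O : Set E} {J : Set ℝ} {c : ℝ → E}
    (hJ : IsOpen J) (hv : ContDiffOn ℝ ∞ v O) (hcO : ∀ t ∈ J, c t ∈ O)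
    (hc : ∀ t ∈ J, HasDerivAt c (v (c t)) t) : ContDiffOn ℝ ∞ c J := by
  have hd : DifferentiableOn ℝ c J := fun t ht => (hc t ht).differentiableAt.differentiableWithinAt
  rw [contDiffOn_infty]
  intro m
  induction m with
  | zero => exact contDiffOn_zero.2 hd.continuousOn
  -- Bootstrapping: the derivative is `v ∘ c`, which is as smooth as `c` is already known to be.
  | succ m ih =>
    push_cast
    rw [contDiffOn_succ_iff_deriv_of_isOpen hJ]
    refine ⟨hd, by simp, ?_⟩
    exact ((hv.of_le (by exact_mod_cast le_top)).comp ih hcO).congr fun t ht => (hc t ht).deriv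

/-- A smooth nonvanishing vector field has a complete injective integral curve through a given
point, after a change of parameter. -/
theorem exists_injective_curve [CompleteSpace E] {v : E → E} {O : Set E} (hO : IsOpen O)
    (hv : ContDiffOn ℝ ∞ v O) {x : E} (hx : x ∈ O) (hvx : v x ≠ 0) :
    ∃ (c : ℝ → E) (ρ : ℝ → ℝ), ContDiff ℝ ∞ c ∧ (∀ t, c t ∈ O) ∧ Injective c ∧ c 0 = x ∧
      ∀ t, ρ t ≠ 0 ∧ v (c t) ≠ 0 ∧ HasDerivAt c (ρ t • v (c t)) t := by
  -- The functional `ℓ` is positive on `v` near `x`, so it increases strictly along the curve. This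
  -- makes the curve injective.
  obtain ⟨ℓ, -, hℓ⟩ := exists_dual_vector ℝ (v x) (norm_ne_zero_iff.2 hvx)
  have hℓ0 : 0 < ℓ (v x) := by rw [hℓ]; simpa using hvx
  have hcv : ContinuousOn (fun y => ℓ (v y)) O := ℓ.continuous.comp_continuousOn hv.continuousOn
  have hO' : IsOpen (O ∩ (fun y => ℓ (v y)) ⁻¹' Ioi 0) := hcv.isOpen_inter_preimage hO isOpen_Ioi
  obtain ⟨c, hc0, ε, hε, hc⟩ :=
    ContDiffAt.exists_forall_mem_closedBall_exists_eq_forall_mem_Ioo_hasDerivAt₀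
      ((hv.contDiffAt (hO.mem_nhds hx)).of_le (by exact_mod_cast le_top)) 0
  rw [zero_sub, zero_add] at hc
  have hcc : ContinuousAt c 0 := (hc 0 ⟨by linarith, hε⟩).continuousAt
  obtain ⟨δ', hδ', hball⟩ := Metric.mem_nhds_iff.1
    (hcc.preimage_mem_nhds (hO'.mem_nhds (by rw [hc0]; exact ⟨hx, hℓ0⟩)))
  set δ := min ε δ' with hδ
  have hδ0 : 0 < δ := lt_min hε hδ'
  have hJ : ∀ t ∈ Ioo (-δ) δ, c t ∈ O ∧ 0 < ℓ (v (c t)) := fun t ht => by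
    have : t ∈ Metric.ball (0 : ℝ) δ' := by
      rw [Metric.mem_ball, dist_zero_right, Real.norm_eq_abs, abs_lt]
      exact ⟨by linarith [ht.1, min_le_right ε δ'], by linarith [ht.2, min_le_right ε δ']⟩
    exact hball this
  have hcJ : ∀ t ∈ Ioo (-δ) δ, HasDerivAt c (v (c t)) t := fun t ht =>
    hc t ⟨by linarith [ht.1, min_le_left ε δ'], by linarith [ht.2, min_le_left ε δ']⟩
  have hsm : ContDiffOn ℝ ∞ c (Ioo (-δ) δ) :=
    contDiffOn_integralCurve isOpen_Ioo hv (fun t ht => (hJ t ht).1) hcJ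
  -- As `|arctan| < π / 2 < 2`, the map `g` takes the whole line into `(-δ, δ)`, with positive
  -- derivative and `g 0 = 0`.
  let g : ℝ → ℝ := fun t => δ / 2 * Real.arctan t
  have hg : ∀ t, g t ∈ Ioo (-δ) δ := fun t => by
    have h1 := Real.arctan_lt_pi_div_two t
    have h2 := Real.neg_pi_div_two_lt_arctan t
    have h3 := Real.pi_lt_four
    constructor <;> simp only [g] <;> nlinarith
  have hgd : ∀ t, HasDerivAt g (δ / 2 * (1 / (1 + t ^ 2))) t := fun t =>
    (Real.hasDerivAt_arctan t).const_mul _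
  have hgpos : ∀ t : ℝ, 0 < δ / 2 * (1 / (1 + t ^ 2)) := fun t => by positivity
  have hder : ∀ t, HasDerivAt (c ∘ g) ((δ / 2 * (1 / (1 + t ^ 2))) • v (c (g t))) t := fun t =>
    HasDerivAt.scomp t (hcJ _ (hg t)) (hgd t)
  refine ⟨c ∘ g, fun t => δ / 2 * (1 / (1 + t ^ 2)), ?_, fun t => (hJ _ (hg t)).1, ?_, ?_,
    fun t => ⟨(hgpos t).ne', fun h0 => ?_, hder t⟩⟩
  · exact hsm.comp_contDiff (contDiff_const.mul Real.contDiff_arctan) hg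
  · have hmono : StrictMono (ℓ ∘ c ∘ g) := by
      apply strictMono_of_deriv_pos
      intro t
      rw [(ℓ.hasFDerivAt.comp_hasDerivAt t (hder t)).deriv, map_smul]
      exact mul_pos (hgpos t) (hJ _ (hg t)).2
    exact fun a b hab => hmono.injective (congrArg ℓ hab)
  · simp [g, hc0]
  · have := (hJ _ (hg t)).2
    rw [show v (c (g t)) = 0 from h0, map_zero] at this
    exact lt_irrefl _ this

end IntegralCurve

/-! ### The Codazzi equation and constancy along principal directions -/

namespace CurvatureData

variable {E : Type*} [NormedAddCommGroup E] [NormedSpace ℝ E] {n : ℕ}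
  {p q : ℕ} {U : Set E} {A B : E → LieVec n} {α β : E → ℝ}

theorem differentiableAt_left (h : CurvatureData p q U A B α β) {x : E} (hx : x ∈ U) :
    DifferentiableAt ℝ α x :=
  (h.smooth_left.contDiffAt (h.isOpen.mem_nhds hx)).differentiableAt (by simp)

theorem lieProd_eq_zero (h : CurvatureData p q U A B α β) {x : E} (hx : x ∈ U) (V W : E) :
    lieProd (α x • fderiv ℝ A x V + fderiv ℝ B x V) (β x • fderiv ℝ A x W + fderiv ℝ B x W) = 0 :=
  h.lieProd_curvature_eq_zero hx (h.injective x hx) (h.ne x hx)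
    (by rw [h.finrank_left x hx, h.finrank_right x hx]) V W

theorem hasFDerivAt_curvature (h : CurvatureData p q U A B α β) {x : E} (hx : x ∈ U) (V : E) :
    HasFDerivAt (fun y => α y • fderiv ℝ A y V + fderiv ℝ B y V)
      ((α x • fderiv ℝ (fun y => fderiv ℝ A y V) x +
        (fderiv ℝ α x).smulRight (fderiv ℝ A x V)) + fderiv ℝ (fun y => fderiv ℝ B y V) x) x :=
  ((h.differentiableAt_left hx).hasFDerivAt.smul
    ((h.differentiableAt_fderiv_fst hx).clm_apply (differentiableAt_const V)).hasFDerivAt).add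
    ((h.differentiableAt_fderiv_snd hx).clm_apply (differentiableAt_const V)).hasFDerivAt

/-- The equation of Codazzi. -/
theorem smul_eq_smul (h : CurvatureData p q U A B α β) {x : E} (hx : x ∈ U) {X Y : E}
    (hX : X ∈ curvKer A B x (α x) 1) (hY : Y ∈ curvKer A B x (α x) 1) :
    fderiv ℝ α x X • Y = fderiv ℝ α x Y • X := by
  -- Differentiate `⟨αdA Y + dB Y, βdA Z + dB Z⟩ = 0` along `X`. At `x` the first factor vanishes
  -- and the second is `(β - α) dA Z`, so only the derivative of the first factor contributes.
  have key : ∀ X ∈ curvKer A B x (α x) 1, ∀ Y ∈ curvKer A B x (α x) 1,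
      ∀ Z ∈ curvKer A B x (α x) 1,
      lieProd (α x • fderiv ℝ (fderiv ℝ A) x X Y + fderiv ℝ (fderiv ℝ B) x X Y +
        fderiv ℝ α x X • fderiv ℝ A x Y) (fderiv ℝ A x Z) = 0 := by
    intro X hX Y hY Z hZ
    simp only [mem_curvKer, one_smul] at hX hY hZ
    have hF := h.hasFDerivAt_curvature hx Y
    have hG := h.swap.hasFDerivAt_curvature hx Z
    have := lieProd_fderiv_eq_zero hF.differentiableAt hG.differentiableAt
      (by filter_upwards [h.isOpen.mem_nhds hx] with y hy using h.lieProd_eq_zero hy Y Z) X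
    rw [hY, lieProd_zero_left, zero_add, hF.fderiv] at this
    have e : β x • fderiv ℝ A x Z + fderiv ℝ B x Z = (β x - α x) • fderiv ℝ A x Z := by
      rw [show β x • fderiv ℝ A x Z + fderiv ℝ B x Z =
        (α x • fderiv ℝ A x Z + fderiv ℝ B x Z) + (β x - α x) • fderiv ℝ A x Z by module, hZ,
        zero_add]
    rw [e, lieProd_smul_right] at this
    have := (mul_eq_zero.1 this).resolve_left (sub_ne_zero.2 (h.ne x hx).symm)
    simp only [add_apply, smul_apply,
      ContinuousLinearMap.smulRight_apply,
      fderiv_fderiv_apply (h.differentiableAt_fderiv_fst hx),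
      fderiv_fderiv_apply (h.differentiableAt_fderiv_snd hx)] at this
    rw [← this]
    congr 1
    abel
  -- Antisymmetrizing `key` in `X` and `Y` removes the second derivatives and leaves `dα(X) dA Y -
  -- dα(Y) dA X` orthogonal to `dA Z`. This choice of `Z` makes that vector equal to `dA Z`, which
  -- therefore has length zero.
  set Z := fderiv ℝ α x X • Y - fderiv ℝ α x Y • X with hZ
  have hZm : Z ∈ curvKer A B x (α x) 1 :=
    Submodule.sub_mem _ (Submodule.smul_mem _ _ hY) (Submodule.smul_mem _ _ hX)
  have e1 := key X hX Y hY Z hZm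
  have e2 := key Y hY X hX Z hZm
  rw [h.fderiv_fderiv_fst_symm hx, h.fderiv_fderiv_snd_symm hx] at e1
  have e3 : lieProd (fderiv ℝ A x Z) (fderiv ℝ A x Z) = 0 := by
    have hAZ : fderiv ℝ A x Z = fderiv ℝ α x X • fderiv ℝ A x Y -
        fderiv ℝ α x Y • fderiv ℝ A x X := by rw [hZ, map_sub, map_smul, map_smul]
    rw [lieProd_add_left] at e1 e2
    conv_lhs => enter [1]; rw [hAZ]
    rw [lieProd_sub_left]
    linarith
  have := h.injective x hx Z (lieProd_horizontal_self_eq_zero (h.horizontal_fst x hx Z).1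
    (h.horizontal_fst x hx Z).2 e3)
  exact sub_eq_zero.1 this

/-- A field of principal vectors. -/
theorem exists_principal_field (h : CurvatureData p q U A B α β) {x : E} (hx : x ∈ U) {X : E}
    (hX : X ∈ curvKer A B x (α x) 1) :
    ∃ (O : Set E) (v : E → E), IsOpen O ∧ x ∈ O ∧ O ⊆ U ∧ ContDiffOn ℝ ∞ v O ∧
      v x = (β x - α x) • X ∧ ∀ y ∈ O, v y ∈ curvKer A B y (α y) 1 := by
  have := h.finiteDimensional
  have : CompleteSpace E := FiniteDimensional.complete ℝ E
  obtain ⟨L, hL⟩ := (fderiv ℝ A x).toLinearMap.exists_leftInverse_of_injective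
    ((Submodule.eq_bot_iff _).2 (h.injective x hx))
  let L₀ : LieVec n →L[ℝ] E := LinearMap.toContinuousLinearMap L
  have hL₀ : ∀ Z, L₀ (fderiv ℝ A x Z) = Z := fun Z => LinearMap.congr_fun hL Z
  let S : E → E →L[ℝ] E := fun y => L₀ ∘L fderiv ℝ A y
  have dA : ContDiffOn ℝ ∞ (fderiv ℝ A) U :=
    h.smooth_fst.fderiv_of_isOpen h.isOpen (by exact_mod_cast le_top)
  have dB : ContDiffOn ℝ ∞ (fderiv ℝ B) U :=
    h.smooth_snd.fderiv_of_isOpen h.isOpen (by exact_mod_cast le_top)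
  have sS : ContDiffOn ℝ ∞ S U := contDiffOn_const.clm_comp dA
  have hSx : S x = 1 := by ext Z; exact hL₀ Z
  -- The operator `βdA + dB` kills the component of `X` in the principal space of `β` and acts on
  -- the other one as `(β - α) dA`. Inverting `S`, which is the identity at `x`, removes `dA` and
  -- leaves a smooth principal field.
  let w : E → E := fun y => L₀ (β y • fderiv ℝ A y X + fderiv ℝ B y X)
  have sw : ContDiffOn ℝ ∞ w U := L₀.contDiff.comp_contDiffOn
    ((h.smooth_right.smul (dA.clm_apply contDiffOn_const)).add (dB.clm_apply contDiffOn_const))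
  let v : E → E := fun y => Ring.inverse (S y) (w y)
  let O : Set E := U ∩ S ⁻¹' {T | IsUnit T}
  have hO : IsOpen O := sS.continuousOn.isOpen_inter_preimage h.isOpen Units.isOpen
  have wcalc : ∀ y ∈ U, ∀ Y ∈ curvKer A B y (α y) 1, ∀ Z ∈ curvKer A B y (β y) 1, Y + Z = X →
      w y = (β y - α y) • S y Y := by
    intro y hy Y hY Z hZ hYZ
    simp only [mem_curvKer, one_smul] at hY hZ
    have e : β y • fderiv ℝ A y X + fderiv ℝ B y X = (β y - α y) • fderiv ℝ A y Y := by
      rw [← hYZ, map_add, map_add, show β y • (fderiv ℝ A y Y + fderiv ℝ A y Z) +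
        (fderiv ℝ B y Y + fderiv ℝ B y Z) = (α y • fderiv ℝ A y Y + fderiv ℝ B y Y) +
        (β y • fderiv ℝ A y Z + fderiv ℝ B y Z) + (β y - α y) • fderiv ℝ A y Y by module, hY, hZ,
        zero_add, zero_add]
    simp only [w, S, ContinuousLinearMap.comp_apply, e, map_smul]
  have vcalc : ∀ y ∈ O, ∀ Y ∈ curvKer A B y (α y) 1, ∀ Z ∈ curvKer A B y (β y) 1, Y + Z = X →
      v y = (β y - α y) • Y := by
    intro y hy Y hY Z hZ hYZ
    simp only [v]
    rw [wcalc y hy.1 Y hY Z hZ hYZ, map_smul, ← mul_apply_eq_comp,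
      Ring.inverse_mul_cancel _ hy.2, one_apply_eq_self]
  have hxO : x ∈ O := ⟨hx, by simp only [mem_preimage, hSx]; exact isUnit_one⟩
  refine ⟨O, v, hO, hxO, inter_subset_left, ?_, ?_, ?_⟩
  · intro y hy
    obtain ⟨u, hu⟩ := hy.2
    have h1 : ContDiffAt ℝ ∞ (Ring.inverse : (E →L[ℝ] E) → _) (S y) := by
      rw [← hu]; exact contDiffAt_ringInverse ℝ u
    exact ((h1.comp y (sS.contDiffAt (h.isOpen.mem_nhds hy.1))).clm_apply
      (sw.contDiffAt (h.isOpen.mem_nhds hy.1))).contDiffWithinAt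
  · exact vcalc x hxO X hX 0 (Submodule.zero_mem _) (add_zero X)
  · intro y hy
    obtain ⟨Y, hY, Z, hZ, hYZ⟩ := exists_add_mem_curvKer (h.injective y hy.1) (h.ne y hy.1)
      (by rw [h.finrank_left y hy.1, h.finrank_right y hy.1, h.finrank_eq]) X
    rw [vcalc y hy Y hY Z hZ hYZ]
    exact Submodule.smul_mem _ _ hY

/-- Each curvature function is constant along its principal directions: by the equation of Codazzi
if the multiplicity is at least two, and by the Dupin condition if it is one. -/
theorem fderiv_left_eq_zero (h : CurvatureData p q U A B α β) {x : E} (hx : x ∈ U) {X : E}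
    (hX : X ∈ curvKer A B x (α x) 1) : fderiv ℝ α x X = 0 := by
  have := h.finiteDimensional
  have : CompleteSpace E := FiniteDimensional.complete ℝ E
  by_contra hne
  have hX0 : X ≠ 0 := by rintro rfl; simp at hne
  have hβα : β x - α x ≠ 0 := sub_ne_zero.2 (h.ne x hx).symm
  -- If `dα(X) ≠ 0`, the Codazzi equation makes every principal vector a multiple of `X`, so the
  -- multiplicity is one.
  have hle : curvKer A B x (α x) 1 ≤ Submodule.span ℝ {X} := fun Y hY => by
    rw [Submodule.mem_span_singleton]
    refine ⟨(fderiv ℝ α x X)⁻¹ * fderiv ℝ α x Y, ?_⟩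
    rw [mul_smul, ← h.smul_eq_smul hx hX hY, smul_smul, inv_mul_cancel₀ hne, one_smul]
  have hp1 : p = 1 := by
    have h1 := Submodule.finrank_mono hle
    rw [h.finrank_left x hx, finrank_span_singleton hX0] at h1
    have := h.pos_left
    omega
  obtain ⟨O, v, hO, hxO, hOU, sv, hvx, hv⟩ := h.exists_principal_field hx hX
  obtain ⟨c, ρ, sc, hcO, hci, hc0, hcd⟩ := exists_injective_curve hO sv hxO
    (by rw [hvx]; exact smul_ne_zero hβα hX0)
  have hder : ∀ t, deriv c t = ρ t • v (c t) := fun t => (hcd t).2.2.deriv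
  have hd0 : ∀ t, deriv c t ≠ 0 := fun t => by
    rw [hder]; exact smul_ne_zero (hcd t).1 (hcd t).2.1
  -- An integral curve of the principal field is then a curvature surface. The Dupin condition makes
  -- `α` constant along it, although its derivative at `x` is a nonzero multiple of `dα(X)`.
  have hconst := h.dupin c sc (fun t => hOU (hcO t)) hci hd0 (fun t => α (c t)) (fun _ => 1)
    (fun t => ⟨Or.inr one_ne_zero, ?_⟩)
  · have hcon : (α ∘ c) = fun _ => α (c 0) := by
      funext t
      have := hconst t 0
      simp only [mul_one] at this
      exact sub_eq_zero.1 this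
    have hd := (h.differentiableAt_left (x := c 0) (by rw [hc0]; exact hx)).hasFDerivAt.comp_hasDerivAt
      0 (hcd 0).2.2
    rw [hcon, hc0, hvx, map_smul, map_smul] at hd
    have := hd.unique (hasDerivAt_const 0 _)
    simp only [smul_eq_mul, mul_eq_zero, (hcd 0).1, hβα, hne, or_false] at this
  · refine (Submodule.eq_of_le_of_finrank_eq ?_ ?_).symm
    · rw [Submodule.span_singleton_le_iff_mem, hder]
      exact Submodule.smul_mem _ _ (hv _ (hcO t))
    · rw [finrank_span_singleton (hd0 t), h.finrank_left _ (hOU (hcO t)), hp1]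

end CurvatureData

end LieSphere

end

noncomputable section

namespace LieSphere

open scoped Topology
open Filter

/-! ### Local product structure -/

section Product

variable {E W : Type*} [NormedAddCommGroup E] [NormedSpace ℝ E]
  [NormedAddCommGroup W] [NormedSpace ℝ W] [FiniteDimensional ℝ W]

theorem exists_leftInverse_on (T : E →L[ℝ] W) (F : Submodule ℝ E)
    (hT : ∀ X ∈ F, T X = 0 → X = 0) : ∃ G : W →L[ℝ] F, ∀ X : F, G (T X) = X := by
  obtain ⟨L, hL⟩ := (T.toLinearMap.domRestrict F).exists_leftInverse_of_injective
    ((Submodule.eq_bot_iff _).2 fun X hX => Subtype.ext (hT X X.2 hX))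
  exact ⟨LinearMap.toContinuousLinearMap L, fun X => LinearMap.congr_fun hL X⟩

/-- Two functions the kernels of whose derivatives are complementary vary independently of each
other on suitable arbitrarily small neighbourhoods of a given point. -/
theorem exists_isBox [FiniteDimensional ℝ E] {U : Set E} (hU : IsOpen U) {k₁ k₂ : E → W} (s₁ : ContDiffOn ℝ ∞ k₁ U)
    (s₂ : ContDiffOn ℝ ∞ k₂ U)
    (hsup : ∀ y ∈ U, ∀ X, ∃ Y Z, fderiv ℝ k₁ y Y = 0 ∧ fderiv ℝ k₂ y Z = 0 ∧ Y + Z = X)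
    (hinf : ∀ y ∈ U, ∀ X, fderiv ℝ k₁ y X = 0 → fderiv ℝ k₂ y X = 0 → X = 0)
    {x₀ : E} (hx₀ : x₀ ∈ U) :
    ∃ V ⊆ U, IsOpen V ∧ x₀ ∈ V ∧ IsBox V k₁ k₂ := by
  have : CompleteSpace E := FiniteDimensional.complete ℝ E
  set T₁ : Submodule ℝ E := LinearMap.ker (fderiv ℝ k₁ x₀).toLinearMap with hT₁
  set T₂ : Submodule ℝ E := LinearMap.ker (fderiv ℝ k₂ x₀).toLinearMap with hT₂
  have hdis : Disjoint T₂ T₁ := by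
    rw [Submodule.disjoint_def]
    exact fun X h2 h1 => hinf x₀ hx₀ X h1 h2
  have htop : T₂ ⊔ T₁ = ⊤ := by
    rw [eq_top_iff]
    intro X _
    obtain ⟨Y, Z, hY, hZ, rfl⟩ := hsup x₀ hx₀ X
    rw [add_comm]
    exact Submodule.add_mem_sup hZ hY
  have hrank : finrank ℝ E = finrank ℝ (T₂ × T₁) := by
    rw [finrank_prod, Submodule.finrank_add_eq_of_isCompl ⟨hdis, codisjoint_iff.2 htop⟩]
  obtain ⟨G₁, hG₁⟩ := exists_leftInverse_on (fderiv ℝ k₁ x₀) T₂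
    fun X h2 h1 => hinf x₀ hx₀ X h1 h2
  obtain ⟨G₂, hG₂⟩ := exists_leftInverse_on (fderiv ℝ k₂ x₀) T₁
    fun X h1 h2 => hinf x₀ hx₀ X h1 h2
  -- `Φ` compresses `k₁` and `k₂` to as many coordinates as they have independent directions at
  -- `x₀`. Its derivative there is injective, hence an isomorphism by dimension, and `Φ` is a local
  -- chart.
  let Φ : E → T₂ × T₁ := fun y => (G₁ (k₁ y), G₂ (k₂ y))
  have sΦ : ContDiffOn ℝ ∞ Φ U :=
    (G₁.contDiff.comp_contDiffOn s₁).prodMk (G₂.contDiff.comp_contDiffOn s₂)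
  have d₁ : ∀ y ∈ U, HasFDerivAt k₁ (fderiv ℝ k₁ y) y := fun y hy =>
    ((s₁.contDiffAt (hU.mem_nhds hy)).differentiableAt (by simp)).hasFDerivAt
  have d₂ : ∀ y ∈ U, HasFDerivAt k₂ (fderiv ℝ k₂ y) y := fun y hy =>
    ((s₂.contDiffAt (hU.mem_nhds hy)).differentiableAt (by simp)).hasFDerivAt
  have dΦ : ∀ y ∈ U, HasFDerivAt Φ ((G₁ ∘L fderiv ℝ k₁ y).prod (G₂ ∘L fderiv ℝ k₂ y)) y :=
    fun y hy => (G₁.hasFDerivAt.comp y (d₁ y hy)).prodMk (G₂.hasFDerivAt.comp y (d₂ y hy))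
  have dΦa : ∀ y ∈ U, ∀ X, fderiv ℝ Φ y X = (G₁ (fderiv ℝ k₁ y X), G₂ (fderiv ℝ k₂ y X)) :=
    fun y hy X => by rw [(dΦ y hy).fderiv]; rfl
  have inj₀ : ∀ X, fderiv ℝ Φ x₀ X = 0 → X = 0 := by
    intro X hX
    obtain ⟨Y, Z, hY, hZ, rfl⟩ := hsup x₀ hx₀ X
    rw [dΦa x₀ hx₀, map_add (fderiv ℝ k₁ x₀), map_add (fderiv ℝ k₂ x₀), hY, hZ, zero_add, add_zero,
      Prod.mk_eq_zero] at hX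
    have e1 := hG₁ ⟨Z, hZ⟩
    have e2 := hG₂ ⟨Y, hY⟩
    simp only at e1 e2
    rw [hX.1] at e1
    rw [hX.2] at e2
    have z1 : Z = 0 := congrArg Subtype.val e1.symm
    have z2 : Y = 0 := congrArg Subtype.val e2.symm
    rw [z1, z2, add_zero]
  have cΦ : ContinuousAt (fderiv ℝ Φ) x₀ :=
    ((sΦ.fderiv_of_isOpen hU (m := ∞) (by exact_mod_cast le_top)).continuousOn).continuousAt
      (hU.mem_nhds hx₀)
  have hev : ∀ᶠ y in 𝓝 x₀, y ∈ U ∧ ∀ X, fderiv ℝ Φ y X = 0 → X = 0 := by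
    filter_upwards [hU.mem_nhds hx₀, eventually_finrank_ker_le cΦ] with y hy hk
    have hb : LinearMap.ker (fderiv ℝ Φ x₀ : E →ₗ[ℝ] T₂ × T₁) = ⊥ :=
      (Submodule.eq_bot_iff _).2 inj₀
    rw [hb, finrank_bot, Nat.le_zero, Submodule.finrank_eq_zero] at hk
    exact ⟨hy, (Submodule.eq_bot_iff _).1 hk⟩
  obtain ⟨O, hO, hOo, hxO⟩ := eventually_nhds_iff.1 hev
  have eqv : ∀ y ∈ O, ∃ f' : E ≃L[ℝ] T₂ × T₁, HasFDerivAt Φ (f' : E →L[ℝ] T₂ × T₁) y := by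
    intro y hy
    let f := (LinearEquiv.ofInjectiveOfFinrankEq (fderiv ℝ Φ y).toLinearMap
      (LinearMap.ker_eq_bot.1 ((Submodule.eq_bot_iff _).2 (hO y hy).2)) hrank).toContinuousLinearEquiv
    refine ⟨f, ?_⟩
    have : (f : E →L[ℝ] T₂ × T₁) = fderiv ℝ Φ y := by ext X <;> rfl
    rw [this]
    exact (dΦ y (hO y hy).1).differentiableAt.hasFDerivAt
  obtain ⟨f₀, hf₀⟩ := eqv x₀ hxO
  have hc₀ : ContDiffAt ℝ ∞ Φ x₀ := sΦ.contDiffAt (hU.mem_nhds hx₀)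
  let e := hc₀.toOpenPartialHomeomorph Φ hf₀ (by simp)
  have he : ∀ y, e y = Φ y := fun y => rfl
  have hxe : x₀ ∈ e.source := hc₀.mem_toOpenPartialHomeomorph_source hf₀ (by simp)
  have hW : IsOpen (e.target ∩ e.symm ⁻¹' O) := e.isOpen_inter_preimage_symm hOo
  have hxW : Φ x₀ ∈ e.target ∩ e.symm ⁻¹' O :=
    ⟨e.map_source hxe, by rw [mem_preimage, ← he, e.left_inv hxe]; exact hxO⟩
  obtain ⟨r, hr, hball⟩ := Metric.isOpen_iff.1 hW _ hxW
  rw [← Prod.mk.eta (p := Φ x₀), ← ball_prod_same] at hball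
  set b₁ := Metric.ball (Φ x₀).1 r
  set b₂ := Metric.ball (Φ x₀).2 r
  -- the two functions depend on one variable each
  have dsymm : ∀ v ∈ b₁, ∀ u ∈ b₂, ∃ f' : T₂ × T₁ →L[ℝ] E,
      HasFDerivAt e.symm f' (v, u) ∧ e.symm (v, u) ∈ U ∧
      (∀ X, fderiv ℝ Φ (e.symm (v, u)) (f' X) = X) ∧
      ∀ X, fderiv ℝ Φ (e.symm (v, u)) X = 0 → X = 0 := by
    intro v hv u hu
    obtain ⟨ht, hO'⟩ := hball (⟨hv, hu⟩ : (v, u) ∈ b₁ ×ˢ b₂)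
    obtain ⟨f', hf'⟩ := eqv _ hO'
    refine ⟨f'.symm, e.hasFDerivAt_symm ht hf', (hO _ hO').1, fun X => ?_, (hO _ hO').2⟩
    rw [hf'.fderiv]
    simp
  have const₁ : ∀ v ∈ b₁, ∀ u ∈ b₂, ∀ u' ∈ b₂, k₁ (e.symm (v, u)) = k₁ (e.symm (v, u')) := by
    intro v hv u hu u' hu'
    have hd : ∀ u ∈ b₂, HasFDerivAt (fun u => k₁ (e.symm (v, u))) (0 : T₁ →L[ℝ] W) u := by
      intro u hu
      obtain ⟨f', hf', hmem, hr, hi⟩ := dsymm v hv u hu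
      have hcomp := (d₁ _ hmem).comp u (HasFDerivAt.comp (g := e.symm) u hf'
        (hasFDerivAt_prodMk_right (𝕜 := ℝ) v u))
      suffices h0 : fderiv ℝ k₁ (e.symm (v, u)) ∘L f' ∘L ContinuousLinearMap.inr ℝ T₂ T₁ = 0 by
        rw [h0] at hcomp; exact hcomp
      ext1 X
      simp only [zero_apply, ContinuousLinearMap.comp_apply, ContinuousLinearMap.inr_apply]
      -- Split the coordinate vector along the two kernels. Its part `Z` satisfies `dk₂ Z = 0` and
      -- `G₁ (dk₁ Z) = 0`, so `dΦ` kills it and `Z = 0`. What remains lies in the kernel of `dk₁`.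
      obtain ⟨Y, Z, hY, hZ, hYZ⟩ := hsup _ hmem (f' (0, X))
      have h1 := hr (0, X)
      rw [dΦa _ hmem] at h1
      have h2 : G₁ (fderiv ℝ k₁ (e.symm (v, u)) (f' (0, X))) = 0 := congrArg Prod.fst h1
      have h3 : Z = 0 := hi Z (by
        rw [dΦa _ hmem, hZ, map_zero]
        rw [← hYZ, map_add, hY, zero_add] at h2
        rw [h2]; rfl)
      rw [← hYZ, map_add, hY, h3, map_zero, add_zero]
    exact Metric.isOpen_ball.is_const_of_fderiv_eq_zero (𝕜 := ℝ)
      (convex_ball _ _).isPreconnected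
      (fun u hu => (hd u hu).differentiableAt.differentiableWithinAt)
      (fun u hu => (hd u hu).fderiv) hu hu'
  have const₂ : ∀ u ∈ b₂, ∀ v ∈ b₁, ∀ v' ∈ b₁, k₂ (e.symm (v, u)) = k₂ (e.symm (v', u)) := by
    intro u hu v hv v' hv'
    have hd : ∀ v ∈ b₁, HasFDerivAt (fun v => k₂ (e.symm (v, u))) (0 : T₂ →L[ℝ] W) v := by
      intro v hv
      obtain ⟨f', hf', hmem, hr, hi⟩ := dsymm v hv u hu
      have hcomp := (d₂ _ hmem).comp v (HasFDerivAt.comp (g := e.symm) v hf'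
        (hasFDerivAt_prodMk_left (𝕜 := ℝ) v u))
      suffices h0 : fderiv ℝ k₂ (e.symm (v, u)) ∘L f' ∘L ContinuousLinearMap.inl ℝ T₂ T₁ = 0 by
        rw [h0] at hcomp; exact hcomp
      ext1 X
      simp only [zero_apply, ContinuousLinearMap.comp_apply, ContinuousLinearMap.inl_apply]
      obtain ⟨Y, Z, hY, hZ, hYZ⟩ := hsup _ hmem (f' (X, 0))
      have h1 := hr (X, 0)
      rw [dΦa _ hmem] at h1
      have h2 : G₂ (fderiv ℝ k₂ (e.symm (v, u)) (f' (X, 0))) = 0 := congrArg Prod.snd h1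
      have h3 : Y = 0 := hi Y (by
        rw [dΦa _ hmem, hY, map_zero]
        rw [← hYZ, map_add, hZ, add_zero] at h2
        rw [h2]; rfl)
      rw [← hYZ, map_add, hZ, h3, map_zero, zero_add]
    exact Metric.isOpen_ball.is_const_of_fderiv_eq_zero (𝕜 := ℝ)
      (convex_ball _ _).isPreconnected
      (fun u hu => (hd u hu).differentiableAt.differentiableWithinAt)
      (fun u hu => (hd u hu).fderiv) hv hv'
  refine ⟨e.source ∩ e ⁻¹' (b₁ ×ˢ b₂), fun y hy => ?_,
    e.isOpen_inter_preimage (Metric.isOpen_ball.prod Metric.isOpen_ball),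
    ⟨hxe, Metric.mem_ball_self hr, Metric.mem_ball_self hr⟩, ?_⟩
  · have := (hball hy.2).2
    rw [mem_preimage, e.left_inv hy.1] at this
    exact (hO y this).1
  · intro y hy z hz
    have hb : ((e y).1, (e z).2) ∈ b₁ ×ˢ b₂ := ⟨hy.2.1, hz.2.2⟩
    have ht := (hball hb).1
    -- In the chart `k₁` depends only on the first coordinate and `k₂` only on the second; the
    -- required point takes one from `y` and the other from `z`.
    refine ⟨e.symm ((e y).1, (e z).2), ⟨e.map_target ht, ?_⟩, ?_, ?_⟩
    · rw [mem_preimage, e.right_inv ht]; exact hb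
    · rw [const₁ _ hy.2.1 _ hz.2.2 _ hy.2.2, Prod.mk.eta, e.left_inv hy.1]
    · rw [const₂ _ hz.2.2 _ hy.2.1 _ hz.2.1, Prod.mk.eta, e.left_inv hz.1]

/-- The derivative of a function with values in a subspace has values in this subspace. -/
theorem fderiv_mem_of_eventually_mem {k : E → W} {x : E} (hk : DifferentiableAt ℝ k x)
    {F : Submodule ℝ W} (hF : ∀ᶠ y in 𝓝 x, k y ∈ F) (X : E) : fderiv ℝ k x X ∈ F := by
  obtain ⟨F', hF'⟩ := F.exists_isCompl
  let P : W →L[ℝ] F' := LinearMap.toContinuousLinearMap (F'.projectionOnto F hF'.symm)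
  have hP : ∀ w, P w = 0 ↔ w ∈ F := fun w => Submodule.projectionOnto_apply_eq_zero_iff hF'.symm
  rw [← hP]
  have h1 : fderiv ℝ (fun y => P (k y)) x = P ∘L fderiv ℝ k x :=
    (P.hasFDerivAt.comp x hk.hasFDerivAt).fderiv
  have h2 : fderiv ℝ (fun y => P (k y)) x = 0 := by
    rw [EventuallyEq.fderiv_eq (f := fun _ => (0 : F'))]
    · simp
    · filter_upwards [hF] with y hy using (hP _).2 hy
  rw [h2] at h1
  exact (congrArg (fun T => T X) h1).symm

end Product

/-! ### The curvature sphere maps and the subspaces they span -/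

namespace CurvatureData

variable {E : Type*} [NormedAddCommGroup E] [NormedSpace ℝ E] {n : ℕ}
  {p q : ℕ} {U : Set E} {A B : E → LieVec n} {α β : E → ℝ}

theorem hasFDerivAt_sphere (h : CurvatureData p q U A B α β) {x : E} (hx : x ∈ U) :
    HasFDerivAt (fun y => α y • A y + B y)
      (α x • fderiv ℝ A x + (fderiv ℝ α x).smulRight (A x) + fderiv ℝ B x) x :=
  ((h.differentiableAt_left hx).hasFDerivAt.smul (h.differentiableAt_fst hx).hasFDerivAt).add
    (h.differentiableAt_snd hx).hasFDerivAt

theorem fderiv_sphere (h : CurvatureData p q U A B α β) {x : E} (hx : x ∈ U) (X : E) :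
    fderiv ℝ (fun y => α y • A y + B y) x X =
      α x • fderiv ℝ A x X + fderiv ℝ B x X + fderiv ℝ α x X • A x := by
  rw [(h.hasFDerivAt_sphere hx).fderiv]
  simp only [add_apply, smul_apply, ContinuousLinearMap.smulRight_apply]
  abel

/-- The extra term `dα(X) A` is null and orthogonal to all first derivatives of the frame, so it
does not contribute to the length. -/
theorem lieProd_fderiv_sphere_self (h : CurvatureData p q U A B α β) {x : E} (hx : x ∈ U) (X : E) :
    lieProd (fderiv ℝ (fun y => α y • A y + B y) x X) (fderiv ℝ (fun y => α y • A y + B y) x X) =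
      lieProd (α x • fderiv ℝ A x X + fderiv ℝ B x X)
        (α x • fderiv ℝ A x X + fderiv ℝ B x X) := by
  rw [h.fderiv_sphere hx]
  have e : lieProd (A x) (α x • fderiv ℝ A x X + fderiv ℝ B x X) = 0 := by
    rw [lieProd_add_right, lieProd_smul_right, h.lieProd_fst_fderiv_fst hx,
      h.lieProd_fst_fderiv_snd hx]; ring
  generalize α x • fderiv ℝ A x X + fderiv ℝ B x X = η at e ⊢
  simp only [lieProd_add_left, lieProd_add_right, lieProd_smul_left, lieProd_smul_right,
    lieProd_comm η (A x), e, h.null_fst x hx]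
  ring

/-- The vector `αdA X + dB X` is horizontal, so it vanishes as soon as its square does. -/
theorem mem_curvKer_of_null (h : CurvatureData p q U A B α β) {x : E} (hx : x ∈ U) {X : E}
    (h0 : lieProd (fderiv ℝ (fun y => α y • A y + B y) x X)
      (fderiv ℝ (fun y => α y • A y + B y) x X) = 0) : X ∈ curvKer A B x (α x) 1 := by
  rw [h.lieProd_fderiv_sphere_self hx] at h0
  rw [mem_curvKer, one_smul]
  obtain ⟨a, b⟩ := h.horizontal_fst x hx X
  obtain ⟨c, d⟩ := h.horizontal_snd x hx X
  exact lieProd_horizontal_self_eq_zero (by simp [a, c]) (by simp [b, d]) h0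

/-- Constancy of the curvature along its principal directions enters here: it removes the term
`dα(X) A`. So the curvature sphere moves only transversally to its principal space. -/
theorem fderiv_sphere_eq_zero (h : CurvatureData p q U A B α β) {x : E} (hx : x ∈ U) {X : E} :
    fderiv ℝ (fun y => α y • A y + B y) x X = 0 ↔ X ∈ curvKer A B x (α x) 1 := by
  refine ⟨fun h0 => h.mem_curvKer_of_null hx (by rw [h0, lieProd_zero_left]), fun hX => ?_⟩
  rw [h.fderiv_sphere hx, h.fderiv_left_eq_zero hx hX, zero_smul, add_zero]
  simpa [mem_curvKer] using hX

theorem lieProd_sphere_self (h : CurvatureData p q U A B α β) {x : E} (hx : x ∈ U) :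
    lieProd (α x • A x + B x) (α x • A x + B x) = 0 := by
  simp only [lieProd_add_left, lieProd_add_right, lieProd_smul_left, lieProd_smul_right,
    h.null_fst x hx, h.null_snd x hx, h.isotropic x hx, lieProd_comm (B x) (A x)]
  ring

theorem lieProd_sphere_fderiv (h : CurvatureData p q U A B α β) {x : E} (hx : x ∈ U) (X : E) :
    lieProd (α x • A x + B x) (fderiv ℝ (fun y => α y • A y + B y) x X) = 0 := by
  have hd := (h.hasFDerivAt_sphere hx).differentiableAt
  have := lieProd_fderiv_eq_zero hd hd
    (by filter_upwards [h.isOpen.mem_nhds hx] with y hy using h.lieProd_sphere_self hy) X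
  rw [lieProd_comm (fderiv ℝ _ x X)] at this
  linarith

theorem eq_zero_of_mem_of_mem (h : CurvatureData p q U A B α β) {x : E} (hx : x ∈ U) {X : E}
    (h1 : X ∈ curvKer A B x (α x) 1) (h2 : X ∈ curvKer A B x (β x) 1) : X = 0 := by
  rw [mem_curvKer] at h1 h2
  apply h.injective x hx
  have : (α x - β x) • fderiv ℝ A x X = 0 := by
    rw [show (α x - β x) • fderiv ℝ A x X = (α x • fderiv ℝ A x X + (1 : ℝ) • fderiv ℝ B x X) -
      (β x • fderiv ℝ A x X + (1 : ℝ) • fderiv ℝ B x X) by module, h1, h2, sub_zero]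
  exact (smul_eq_zero.1 this).resolve_left (sub_ne_zero.2 (h.ne x hx))

theorem smooth_sphere (h : CurvatureData p q U A B α β) :
    ContDiffOn ℝ ∞ (fun y => α y • A y + B y) U :=
  (h.smooth_left.smul h.smooth_fst).add h.smooth_snd

theorem exists_isBox (h : CurvatureData p q U A B α β) {x₀ : E} (hx₀ : x₀ ∈ U) :
    ∃ V ⊆ U, IsOpen V ∧ x₀ ∈ V ∧
      IsBox V (fun y => α y • A y + B y) (fun y => β y • A y + B y) := by
  have := h.finiteDimensional
  refine LieSphere.exists_isBox h.isOpen h.smooth_sphere h.swap.smooth_sphere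
    (fun y hy X => ?_) (fun y hy X h1 h2 => ?_) hx₀
  · obtain ⟨Y, hY, Z, hZ, hYZ⟩ := exists_add_mem_curvKer (h.injective y hy) (h.ne y hy)
      (by rw [h.finrank_left y hy, h.finrank_right y hy, h.finrank_eq]) X
    exact ⟨Y, Z, (h.fderiv_sphere_eq_zero hy).2 hY, (h.swap.fderiv_sphere_eq_zero hy).2 hZ, hYZ⟩
  · exact h.eq_zero_of_mem_of_mem hy ((h.fderiv_sphere_eq_zero hy).1 h1)
      ((h.swap.fderiv_sphere_eq_zero hy).1 h2)

/-- The curvature spheres at the points of an open set span a subspace of dimension at least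
`q + 2` which contains a negative vector. -/
theorem le_finrank_span (h : CurvatureData p q U A B α β) {V : Set E} (hVU : V ⊆ U)
    (hV : IsOpen V) (hne : V.Nonempty) :
    q + 2 ≤ finrank ℝ (Submodule.span ℝ ((fun y => α y • A y + B y) '' V)) ∧
      ∃ x ∈ Submodule.span ℝ ((fun y => α y • A y + B y) '' V), lieProd x x < 0 := by
  have := h.finiteDimensional
  set k : E → LieVec n := fun y => α y • A y + B y with hk
  set F := Submodule.span ℝ (k '' V) with hF
  have hkF : ∀ y ∈ V, k y ∈ F := fun y hy => Submodule.subset_span ⟨y, hy, rfl⟩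
  have hdF : ∀ y ∈ V, ∀ X, fderiv ℝ k y X ∈ F := fun y hy X =>
    fderiv_mem_of_eventually_mem (h.hasFDerivAt_sphere (hVU hy)).differentiableAt
      (by filter_upwards [hV.mem_nhds hy] with z hz using hkF z hz) X
  -- Otherwise the span would be totally isotropic. But it contains the derivatives of `k`, and
  -- those in the principal directions of `β` have positive square.
  obtain ⟨x, hx, y, hy, hxy⟩ : ∃ x ∈ V, ∃ y ∈ V, lieProd (k x) (k y) ≠ 0 := by
    by_contra! hcon
    have hiso : ∀ a ∈ F, ∀ b ∈ F, lieProd a b = 0 := by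
      intro a ha b hb
      induction ha using Submodule.span_induction with
      | mem a ha =>
        obtain ⟨x, hx, rfl⟩ := ha
        induction hb using Submodule.span_induction with
        | mem b hb =>
          obtain ⟨y, hy, rfl⟩ := hb
          exact hcon x hx y hy
        | zero => simp
        | add x y _ _ h₁ h₂ => rw [lieProd_add_right, h₁, h₂, add_zero]
        | smul a x _ h => rw [lieProd_smul_right, h, mul_zero]
      | zero => simp
      | add x y _ _ h₁ h₂ => rw [lieProd_add_left, h₁, h₂, add_zero]
      | smul a x _ h => rw [lieProd_smul_left, h, mul_zero]
    obtain ⟨x, hx⟩ := hne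
    obtain ⟨Z, hZ, hZ0⟩ : ∃ Z ∈ curvKer A B x (β x) 1, Z ≠ 0 := by
      apply Submodule.exists_mem_ne_zero_of_ne_bot
      intro e
      have := h.finrank_right x (hVU hx)
      rw [e, finrank_bot] at this
      have := h.pos_right
      omega
    exact hZ0 (h.eq_zero_of_mem_of_mem (hVU hx) (h.mem_curvKer_of_null (hVU hx)
      (hiso _ (hdF x hx Z) _ (hdF x hx Z))) hZ)
  have n1 : lieProd (k x) (k x) = 0 := h.lieProd_sphere_self (hVU hx)
  have n2 : lieProd (k y) (k y) = 0 := h.lieProd_sphere_self (hVU hy)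
  constructor
  -- The `q` derivatives of `k` at `x` in the principal directions of `β` are independent, and so
  -- are they together with `k x` and `k y`: pairing with `k x` isolates the coefficient of `k y`,
  -- and a null derivative in these directions is zero.
  · let f : ℝ × ℝ × curvKer A B x (β x) 1 →ₗ[ℝ] F :=
      LinearMap.codRestrict F
        ((LinearMap.fst ℝ ℝ _).smulRight (k x) +
          ((LinearMap.fst ℝ ℝ _).smulRight (k y) +
            (fderiv ℝ k x).toLinearMap ∘ₗ (Submodule.subtype _) ∘ₗ LinearMap.snd ℝ ℝ _) ∘ₗ
              LinearMap.snd ℝ ℝ _)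
        (fun z => F.add_mem (F.smul_mem _ (hkF x hx))
          (F.add_mem (F.smul_mem _ (hkF y hy)) (hdF x hx _)))
    have hf : Injective f := by
      rw [injective_iff_map_eq_zero]
      rintro ⟨c, d, X⟩ h0
      have h0' : c • k x + (d • k y + fderiv ℝ k x X) = 0 := congrArg Subtype.val h0
      have hd : d = 0 := by
        have := congrArg (lieProd (k x)) h0'
        rw [lieProd_add_right, lieProd_add_right, lieProd_smul_right, lieProd_smul_right, n1,
          h.lieProd_sphere_fderiv (hVU hx), lieProd_zero_right, mul_zero, zero_add, add_zero] at this
        exact (mul_eq_zero.1 this).resolve_right hxy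
      rw [hd, zero_smul, zero_add] at h0'
      have hX : (X : E) = 0 := by
        have e : fderiv ℝ k x X = (-c) • k x := by
          rw [neg_smul]; exact eq_neg_of_add_eq_zero_right h0'
        refine h.eq_zero_of_mem_of_mem (hVU hx) (h.mem_curvKer_of_null (hVU hx) ?_) X.2
        change lieProd (fderiv ℝ k x X) (fderiv ℝ k x X) = 0
        rw [e, lieProd_smul_left, lieProd_smul_right, n1]
        ring
      rw [hX, map_zero, add_zero] at h0'
      have hc : c = 0 := by
        rcases smul_eq_zero.1 h0' with h' | h'
        · exact h'
        · exact absurd (by rw [h', lieProd_zero_left]) hxy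
      rw [hc, hd, show X = 0 from Subtype.ext hX]
      rfl
    have := LinearMap.finrank_le_finrank_of_injective hf
    rw [finrank_prod, finrank_prod, finrank_self, h.finrank_right x (hVU hx)] at this
    omega
  -- For null vectors with product `m`, the combination `k x - m k y` has square `-2m²`.
  · refine ⟨k x - lieProd (k x) (k y) • k y,
      F.sub_mem (hkF x hx) (F.smul_mem _ (hkF y hy)), ?_⟩
    rw [lieProd_sub_left, lieProd_sub_right, lieProd_sub_right, lieProd_smul_left,
      lieProd_smul_right, lieProd_smul_left, lieProd_smul_right, n1, n2,
      lieProd_comm (k y) (k x)]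
    have : 0 < lieProd (k x) (k y) * lieProd (k x) (k y) := mul_self_pos.2 hxy
    linarith

end CurvatureData

/-- Near each of its points a local cyclide is spanned by two families of spheres which vary
independently of each other. -/
theorem LocalCyclide.exists_box {E : Type*} [NormedAddCommGroup E] [NormedSpace ℝ E] {n : ℕ}
    {p q : ℕ} {U : Set E} {A B : E → LieVec n} (h : LocalCyclide p q U A B) {x₀ : E}
    (hx₀ : x₀ ∈ U) {N : Set E} (hN : N ∈ 𝓝 x₀) :
    ∃ V ⊆ U ∩ N, V ∈ 𝓝 x₀ ∧ ∃ k₁ k₂ : E → LieVec n,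
      (∀ y ∈ V, Submodule.span ℝ {A y, B y} = Submodule.span ℝ {k₁ y, k₂ y}) ∧
      IsBox V k₁ k₂ ∧
      q + 2 ≤ finrank ℝ (Submodule.span ℝ (k₁ '' V)) ∧
      p + 2 ≤ finrank ℝ (Submodule.span ℝ (k₂ '' V)) ∧
      (∃ x ∈ Submodule.span ℝ (k₁ '' V), lieProd x x < 0) ∧
      (∃ x ∈ Submodule.span ℝ (k₂ '' V), lieProd x x < 0) := by
  obtain ⟨N', hN', hN'o, hxN'⟩ := mem_nhds_iff.1 hN
  have h' := h.mono (inter_subset_left (t := N')) (h.isOpen.inter hN'o)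
  obtain ⟨t, ht⟩ := h'.exists_shear_injective ⟨hx₀, hxN'⟩
  obtain ⟨U', hU', hxU', α, β, hD⟩ := (h'.shear t).exists_curvatureData ⟨hx₀, hxN'⟩ ht
  obtain ⟨V, hVU, hVo, hxV, hbox⟩ := hD.exists_isBox hxU'
  obtain ⟨d₁, n₁⟩ := hD.le_finrank_span hVU hVo ⟨x₀, hxV⟩
  obtain ⟨d₂, n₂⟩ := hD.swap.le_finrank_span hVU hVo ⟨x₀, hxV⟩
  refine ⟨V, fun y hy => ⟨(hU' (hVU hy)).1, hN' (hU' (hVU hy)).2⟩, hVo.mem_nhds hxV, _, _,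
    fun y hy => ?_, hbox, d₁, d₂, n₁, n₂⟩
  have hne : α y - β y ≠ 0 := sub_ne_zero.2 (hD.ne y (hVU hy))
  apply le_antisymm <;> rw [Submodule.span_le] <;> rintro x (rfl | rfl) <;>
    rw [SetLike.mem_coe, Submodule.mem_span_pair]
  -- The spheres are `αA + (αt + 1)B` and `βA + (βt + 1)B` in the original frame. The determinant of
  -- this change of frame is `α - β`, and the coefficients are those of its inverse.
  · refine ⟨(α y - β y)⁻¹ * (1 + t * β y), -((α y - β y)⁻¹ * (1 + t * α y)), ?_⟩
    match_scalars <;> field_simp <;> ring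
  · refine ⟨-((α y - β y)⁻¹ * β y), (α y - β y)⁻¹ * α y, ?_⟩
    match_scalars <;> field_simp <;> ring
  · exact ⟨α y, α y * t + 1, by module⟩
  · exact ⟨β y, β y * t + 1, by module⟩

end LieSphere

end

noncomputable section

namespace LieSphere

open scoped Topology
open Filter

/-! ### The inverse function theorem on manifolds -/

section InverseFunction

variable {E : Type*} [NormedAddCommGroup E] [NormedSpace ℝ E]
  {H : Type*} [TopologicalSpace H] {I : ModelWithCorners ℝ E H}
  {E' : Type*} [NormedAddCommGroup E'] [NormedSpace ℝ E']
  {H' : Type*} [TopologicalSpace H'] {J : ModelWithCorners ℝ E' H'}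
  {N : Type*} [TopologicalSpace N] [ChartedSpace H' N]
  {M : Type*} [TopologicalSpace M] [ChartedSpace H M]

/-- The restriction of a partial diffeomorphism to an open set. -/
def restrOpen (Φ : PartialDiffeomorph I J M N ∞) (U : Set M) (hU : IsOpen U) :
    PartialDiffeomorph I J M N ∞ where
  toPartialEquiv := (Φ.toOpenPartialHomeomorph.restrOpen U hU).toPartialEquiv
  open_source := (Φ.toOpenPartialHomeomorph.restrOpen U hU).open_source
  open_target := (Φ.toOpenPartialHomeomorph.restrOpen U hU).open_target
  contMDiffOn_toFun := Φ.contMDiffOn_toFun.mono inter_subset_left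
  contMDiffOn_invFun := Φ.contMDiffOn_invFun.mono inter_subset_left

theorem isLocalDiffeomorphAt_congr {f g : M → N} {x : M} (hf : IsLocalDiffeomorphAt I J ∞ f x)
    (hfg : g =ᶠ[𝓝 x] f) : IsLocalDiffeomorphAt I J ∞ g x := by
  obtain ⟨Φ, hx, hΦ⟩ := hf
  obtain ⟨U, hU, hUo, hxU⟩ := mem_nhds_iff.1 hfg
  refine ⟨restrOpen Φ U hUo, ⟨hx, hxU⟩, fun y hy => ?_⟩
  exact (hU hy.2).trans (hΦ hy.1)

theorem isLocalDiffeomorphAt_of_contDiffOn [FiniteDimensional ℝ E] [FiniteDimensional ℝ E']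
    (hd : finrank ℝ E = finrank ℝ E') {g : E → E'} {U : Set E} (hU : IsOpen U)
    (hg : ContDiffOn ℝ ∞ g U) {a : E} (ha : a ∈ U) (hinj : Injective (fderiv ℝ g a)) :
    IsLocalDiffeomorphAt 𝓘(ℝ, E) 𝓘(ℝ, E') ∞ g a := by
  have hga : ∀ y ∈ U, ContDiffAt ℝ ∞ g y := fun y hy => hg.contDiffAt (hU.mem_nhds hy)
  have hne : (∞ : WithTop ℕ∞) ≠ 0 := by simp
  let L : E ≃L[ℝ] E' :=
    (LinearEquiv.ofInjectiveOfFinrankEq (fderiv ℝ g a).toLinearMap hinj hd).toContinuousLinearEquiv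
  have hL : (L : E →L[ℝ] E') = fderiv ℝ g a := by ext v; rfl
  have hder : HasFDerivAt g (L : E →L[ℝ] E') a := by
    rw [hL]; exact ((hga a ha).differentiableAt hne).hasFDerivAt
  let e := (hga a ha).toOpenPartialHomeomorph g hder hne
  have he : ∀ y, e y = g y := fun y => rfl
  -- Shrinking to the open set where the derivative is invertible makes the inverse smooth on its
  -- whole domain and not only at the image of `a`.
  let V : Set E := U ∩ fderiv ℝ g ⁻¹' range ((↑) : (E ≃L[ℝ] E') → E →L[ℝ] E')
  have hV : IsOpen V :=
    (hg.continuousOn_fderiv_of_isOpen hU (by exact_mod_cast le_top)).isOpen_inter_preimage hU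
      ContinuousLinearEquiv.isOpen
  let e' := e.restrOpen V hV
  have hsym : ∀ y ∈ e'.target, ContDiffAt ℝ ∞ e'.symm y := by
    intro y hy
    have hy1 := e'.map_target hy
    obtain ⟨L', hL'⟩ := hy1.2.2
    refine e'.contDiffAt_symm (f₀' := L') hy ?_ (hga _ hy1.2.1)
    rw [hL']
    exact ((hga _ hy1.2.1).differentiableAt hne).hasFDerivAt
  refine ⟨{ toPartialEquiv := e'.toPartialEquiv
            open_source := e'.open_source
            open_target := e'.open_target
            contMDiffOn_toFun := ?_
            contMDiffOn_invFun := ?_ }, ⟨?_, ha, L, hL⟩, fun y _ => rfl⟩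
  · exact (hg.mono fun y hy => hy.2.1).contMDiffOn
  · exact contMDiffOn_iff_contDiffOn.2 fun y hy => (hsym y hy).contDiffWithinAt
  · exact (hga a ha).mem_toOpenPartialHomeomorph_source hder hne

variable [IsManifold I ∞ M] [IsManifold J ∞ N] [I.Boundaryless] [J.Boundaryless]

variable (I) in
/-- A chart as a partial diffeomorphism. -/
def chartDiffeo (x : M) : PartialDiffeomorph I 𝓘(ℝ, E) M E ∞ where
  toPartialEquiv := extChartAt I x
  open_source := isOpen_extChartAt_source x
  open_target := isOpen_extChartAt_target x
  contMDiffOn_toFun := by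
    rw [extChartAt_source]
    exact contMDiffOn_extChartAt
  contMDiffOn_invFun := contMDiffOn_extChartAt_symm x

theorem bijective_mfderiv_extChartAt_symm (x : M) {e : E} (he : e ∈ (extChartAt I x).target) :
    Bijective (mfderiv 𝓘(ℝ, E) I (extChartAt I x).symm e) := by
  have h := isInvertible_mfderivWithin_extChartAt_symm (I := I) he
  rw [I.range_eq_univ, mfderivWithin_univ] at h
  exact h.bijective

theorem mdifferentiableAt_extChartAt_symm' (x : M) {e : E} (he : e ∈ (extChartAt I x).target) :
    MDifferentiableAt 𝓘(ℝ, E) I (extChartAt I x).symm e :=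
  (chartDiffeo I x).symm.mdifferentiableAt (by simp) he

theorem isLocalDiffeomorphAt_of_injective_mfderiv [FiniteDimensional ℝ E]
    [FiniteDimensional ℝ E'] (hd : finrank ℝ E = finrank ℝ E') {f : M → N}
    (hf : ContMDiff I J ∞ f) (x : M) (hinj : Injective (mfderiv I J f x)) :
    IsLocalDiffeomorphAt I J ∞ f x := by
  have hne : (∞ : WithTop ℕ∞) ≠ 0 := by simp
  let c₁ := extChartAt I x
  let c₂ := extChartAt J (f x)
  let g : E → E' := c₂ ∘ f ∘ c₁.symm
  let U : Set E := c₁.target ∩ (f ∘ c₁.symm) ⁻¹' c₂.source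
  have hfc : ContMDiffOn 𝓘(ℝ, E) J ∞ (f ∘ c₁.symm) c₁.target :=
    hf.comp_contMDiffOn (contMDiffOn_extChartAt_symm x)
  have hU : IsOpen U :=
    hfc.continuousOn.isOpen_inter_preimage (isOpen_extChartAt_target x)
      (isOpen_extChartAt_source (f x))
  have hx : c₁ x ∈ c₁.target := mem_extChartAt_target x
  have hxx : c₁.symm (c₁ x) = x := extChartAt_to_inv x
  have hxU : c₁ x ∈ U := ⟨hx, by
    simp only [mem_preimage, comp_apply, hxx]; exact mem_extChartAt_source (f x)⟩
  have hgU : ContMDiffOn 𝓘(ℝ, E) 𝓘(ℝ, E') ∞ g U :=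
    (chartDiffeo J (f x)).contMDiffOn.comp (hfc.mono inter_subset_left) inter_subset_right
  have hd1 : MDifferentiableAt 𝓘(ℝ, E) I c₁.symm (c₁ x) := mdifferentiableAt_extChartAt_symm' x hx
  have hfx : MDifferentiableAt I J f (c₁.symm (c₁ x)) := hf.mdifferentiable hne _
  have hd2 : MDifferentiableAt J 𝓘(ℝ, E') c₂ (f (c₁.symm (c₁ x))) := by
    rw [hxx]
    exact (chartDiffeo J (f x)).mdifferentiableAt hne (mem_extChartAt_source (f x))
  have hgd : mfderiv 𝓘(ℝ, E) 𝓘(ℝ, E') g (c₁ x) =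
      (mfderiv J 𝓘(ℝ, E') c₂ (f (c₁.symm (c₁ x)))).comp
        ((mfderiv I J f (c₁.symm (c₁ x))).comp (mfderiv 𝓘(ℝ, E) I c₁.symm (c₁ x))) := by
    rw [mfderiv_comp (c₁ x) hd2 (hfx.comp _ hd1), mfderiv_comp (c₁ x) hfx hd1]
    rfl
  have hginj : Injective (fderiv ℝ g (c₁ x)) := by
    rw [← mfderiv_eq_fderiv, hgd]
    have h2 : Injective (mfderiv J 𝓘(ℝ, E') c₂ (f (c₁.symm (c₁ x)))) := by
      rw [hxx]
      exact (isInvertible_mfderiv_extChartAt (mem_extChartAt_source (f x))).injective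
    have h1 : Injective (mfderiv I J f (c₁.symm (c₁ x))) := by rw [hxx]; exact hinj
    exact h2.comp (h1.comp (bijective_mfderiv_extChartAt_symm x hx).1)
  have hg := isLocalDiffeomorphAt_of_contDiffOn hd hU hgU.contDiffOn hxU hginj
  have hc₁ : IsLocalDiffeomorphAt I 𝓘(ℝ, E) ∞ c₁ x :=
    PartialDiffeomorph.isLocalDiffeomorphAt _ _ _ (chartDiffeo I x) (mem_extChartAt_source x)
  have hc₂ : IsLocalDiffeomorphAt 𝓘(ℝ, E') J ∞ c₂.symm (g (c₁ x)) :=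
    PartialDiffeomorph.isLocalDiffeomorphAt _ _ _ (chartDiffeo J (f x)).symm (c₂.map_source hxU.2)
  refine isLocalDiffeomorphAt_congr (hc₁.comp J N (hg.comp J N hc₂)) ?_
  have hcont : ContinuousAt f x := hf.continuous.continuousAt
  filter_upwards [extChartAt_source_mem_nhds (I := I) x,
    hcont.preimage_mem_nhds (extChartAt_source_mem_nhds (I := J) (f x))] with y hy1 hy2
  have hy3 : c₁.symm (c₁ y) = y := c₁.left_inv hy1
  simp only [comp_apply, g, hy3]
  exact (c₂.left_inv hy2).symm

end InverseFunction

end LieSphere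

end

noncomputable section

namespace LieSphere

open scoped Topology
open Filter

/-! ### Differentials of vector-valued maps -/

section Differentials

variable {E : Type*} [NormedAddCommGroup E] [NormedSpace ℝ E]
  {H : Type*} [TopologicalSpace H] {I : ModelWithCorners ℝ E H}
  {M : Type*} [TopologicalSpace M] [ChartedSpace H M]
  {E' : Type*} [NormedAddCommGroup E'] [NormedSpace ℝ E']
  {H' : Type*} [TopologicalSpace H'] {J : ModelWithCorners ℝ E' H'}
  {N : Type*} [TopologicalSpace N] [ChartedSpace H' N]
  {F : Type*} [NormedAddCommGroup F] [NormedSpace ℝ F]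
  {G : Type*} [NormedAddCommGroup G] [NormedSpace ℝ G]

theorem mvfderiv_comp_mfderiv {f : M → N} {g : N → F} (x : M)
    (hg : MDifferentiableAt J 𝓘(ℝ, F) g (f x)) (hf : MDifferentiableAt I J f x)
    (X : TangentSpace I x) :
    mvfderiv I (fun y => g (f y)) x X = mvfderiv J g (f x) (mfderiv I J f x X) :=
  mfderiv_comp_apply x hg hf X

theorem mvfderiv_fderiv_comp {g : M → F} {Φ : F → G} (x : M) (hΦ : DifferentiableAt ℝ Φ (g x))
    (hg : MDifferentiableAt I 𝓘(ℝ, F) g x) (X : TangentSpace I x) :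
    mvfderiv I (fun y => Φ (g y)) x X = fderiv ℝ Φ (g x) (mvfderiv I g x X) := by
  have h := mfderiv_comp_apply x hΦ.mdifferentiableAt hg X
  rw [mfderiv_eq_fderiv] at h
  exact h

theorem mvfderiv_clm_comp {g : M → F} (L : F →L[ℝ] G) (x : M)
    (hg : MDifferentiableAt I 𝓘(ℝ, F) g x) (X : TangentSpace I x) :
    mvfderiv I (fun y => L (g y)) x X = L (mvfderiv I g x X) := by
  rw [mvfderiv_fderiv_comp x L.differentiableAt hg, L.fderiv]

theorem mvfderiv_eq_fderiv (g : E → F) (x : E) (X : E) :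
    mvfderiv 𝓘(ℝ, E) g x X = fderiv ℝ g x X := by
  have : mfderiv 𝓘(ℝ, E) 𝓘(ℝ, F) g x X = fderiv ℝ g x X := by
    rw [mfderiv_eq_fderiv]; rfl
  exact this

theorem mvfderiv_smul_apply {a : M → ℝ} {g : M → F} {x : M}
    (ha : MDifferentiableAt I 𝓘(ℝ, ℝ) a x) (hg : MDifferentiableAt I 𝓘(ℝ, F) g x)
    (X : TangentSpace I x) :
    mvfderiv I (fun y => a y • g y) x X =
      a x • mvfderiv I g x X + (mvfderiv I a x X) • g x := by
  have := mvfderiv_smul ha hg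
  have h2 : mvfderiv I (fun y => a y • g y) x X = mvfderiv I (a • g) x X := rfl
  rw [h2, this]
  simp

theorem mvfderiv_add_apply {f g : M → F} {x : M}
    (hf : MDifferentiableAt I 𝓘(ℝ, F) f x) (hg : MDifferentiableAt I 𝓘(ℝ, F) g x)
    (X : TangentSpace I x) :
    mvfderiv I (fun y => f y + g y) x X = mvfderiv I f x X + mvfderiv I g x X := by
  have := mvfderiv_add hf hg
  have h2 : mvfderiv I (fun y => f y + g y) x X = mvfderiv I (f + g) x X := rfl
  rw [h2, this]
  simp

theorem _root_.ContMDiff.clm_comp' {g : M → F} (hg : ContMDiff I 𝓘(ℝ, F) ∞ g) (L : F →L[ℝ] G) :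
    ContMDiff I 𝓘(ℝ, G) ∞ (fun y => L (g y)) :=
  L.contMDiff.comp hg

end Differentials

/-! ### Lifts to the unit tangent bundle -/

section Lift

variable {E : Type*} [NormedAddCommGroup E] [NormedSpace ℝ E]
  {H : Type*} [TopologicalSpace H] {I : ModelWithCorners ℝ E H}
  {M : Type*} [TopologicalSpace M] [ChartedSpace H M] {n : ℕ}
  {lam : M → LieLine n} {f ξ : M → Euc (n + 1)}

/-- The inclusion of `ℝ^{n+1}` in `ℝ^{n+3}` as the middle coordinates. -/
def horizontal (n : ℕ) : Euc (n + 1) →L[ℝ] LieVec n :=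
  (ContinuousLinearMap.inr ℝ ℝ (Euc (n + 1) × ℝ)).comp (ContinuousLinearMap.inl ℝ (Euc (n + 1)) ℝ)

@[simp] theorem horizontal_apply (x : Euc (n + 1)) : horizontal n x = (0, x, 0) := rfl

theorem pointSphere_eq (x : Euc (n + 1)) : pointSphere x = (1, 0, 0) + horizontal n x := by
  simp [pointSphere]

theorem greatSphere_eq (x : Euc (n + 1)) : greatSphere x = (0, 0, 1) + horizontal n x := by
  simp [greatSphere]

/-- Isotropy excludes vectors of positive square. Consequently a derivative lies in the line exactly
when its horizontal part vanishes, which reduces the definition of principal spaces to equations for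
`df` and `dξ`. -/
theorem horizontal_mem_plane (ℓ : LieLine n) {x : Euc (n + 1)} :
    horizontal n x ∈ ℓ.plane ↔ x = 0 := by
  refine ⟨fun h => ?_, fun h => by rw [h, map_zero]; exact zero_mem _⟩
  have := lieProd_horizontal_self_eq_zero (x := horizontal n x) rfl rfl (ℓ.isotropic _ h _ h)
  exact congrArg (fun z : LieVec n => z.2.1) this

theorem contDiff_pointSphere : ContDiff ℝ ∞ (pointSphere : Euc (n + 1) → LieVec n) := by
  rw [funext pointSphere_eq]
  exact contDiff_const.add (horizontal n).contDiff

theorem contDiff_greatSphere : ContDiff ℝ ∞ (greatSphere : Euc (n + 1) → LieVec n) := by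
  rw [funext greatSphere_eq]
  exact contDiff_const.add (horizontal n).contDiff

theorem fderiv_pointSphere (x X : Euc (n + 1)) : fderiv ℝ pointSphere x X = horizontal n X := by
  rw [funext pointSphere_eq, fderiv_const_add, ContinuousLinearMap.fderiv]

theorem fderiv_greatSphere (x X : Euc (n + 1)) : fderiv ℝ greatSphere x X = horizontal n X := by
  rw [funext greatSphere_eq, fderiv_const_add, ContinuousLinearMap.fderiv]

variable (I) in
/-- `(f, ξ)` is the smooth map into the unit tangent bundle corresponding to `lam`. -/
structure IsLift (lam : M → LieLine n) (f ξ : M → Euc (n + 1)) : Prop where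
  smooth_fst : ContMDiff I 𝓘(ℝ, Euc (n + 1)) ∞ f
  smooth_snd : ContMDiff I 𝓘(ℝ, Euc (n + 1)) ∞ ξ
  plane_eq : ∀ x, (lam x).plane = Submodule.span ℝ {pointSphere (f x), greatSphere (ξ x)}

theorem IsLift.mem_unitTangent (h : IsLift I lam f ξ) (x : M) : (f x, ξ x) ∈ unitTangent n := by
  have hZ : pointSphere (f x) ∈ (lam x).plane := by
    rw [h.plane_eq]; exact Submodule.mem_span_of_mem (by simp)
  have hW : greatSphere (ξ x) ∈ (lam x).plane := by
    rw [h.plane_eq]; exact Submodule.mem_span_of_mem (by simp)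
  have h1 := (lam x).isotropic _ hZ _ hZ
  have h2 := (lam x).isotropic _ hW _ hW
  have h3 := (lam x).isotropic _ hZ _ hW
  simp only [lieProd, pointSphere, greatSphere, real_inner_self_eq_norm_sq] at h1 h2 h3
  refine ⟨?_, ?_, by linarith⟩
  · nlinarith [norm_nonneg (f x)]
  · nlinarith [norm_nonneg (ξ x)]

/-- The equations of the unit tangent bundle follow from the isotropy of the lines, so it is enough
to carry two smooth vector-valued maps that span them. -/
theorem isLegendre_iff : IsLegendre I lam ↔ finrank ℝ E + 1 = n ∧ ∃ f ξ, IsLift I lam f ξ ∧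
    (∀ (x : M) (X : TangentSpace I x), mvfderiv I f x X = 0 → mvfderiv I ξ x X = 0 → X = 0) ∧
    ∀ (x : M) (X : TangentSpace I x), inner ℝ (mvfderiv I f x X) (ξ x) = 0 := by
  refine and_congr_right fun _ => ⟨?_, ?_⟩
  · rintro ⟨μ, h1, h2, h3, h4, h5⟩
    exact ⟨_, _, ⟨h2, h3, fun x => by rw [h1]; rfl⟩, h4, h5⟩
  · rintro ⟨f, ξ, h, h4, h5⟩
    refine ⟨fun x => ⟨(f x, ξ x), h.mem_unitTangent x⟩, fun x => ?_, h.smooth_fst, h.smooth_snd,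
      h4, h5⟩
    exact LieLine.ext_plane (h.plane_eq x)

theorem ne_zero_infty : (∞ : WithTop ℕ∞) ≠ 0 := by simp

theorem IsLift.pointSphere_mem (h : IsLift I lam f ξ) (x : M) :
    pointSphere (f x) ∈ (lam x).plane := by
  rw [h.plane_eq]; exact Submodule.mem_span_of_mem (by simp)

theorem IsLift.greatSphere_mem (h : IsLift I lam f ξ) (x : M) :
    greatSphere (ξ x) ∈ (lam x).plane := by
  rw [h.plane_eq]; exact Submodule.mem_span_of_mem (by simp)

theorem IsLift.eq_combination (h : IsLift I lam f ξ) {x : M} {k : LieVec n}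
    (hk : k ∈ (lam x).plane) : k = k.1 • pointSphere (f x) + k.2.2 • greatSphere (ξ x) := by
  rw [h.plane_eq] at hk
  obtain ⟨a, b, rfl⟩ := Submodule.mem_span_pair.1 hk
  simp [pointSphere, greatSphere]

theorem IsLift.contMDiff_pointSphere (h : IsLift I lam f ξ) :
    ContMDiff I 𝓘(ℝ, LieVec n) ∞ (fun x => pointSphere (f x)) :=
  contDiff_pointSphere.contMDiff.comp h.smooth_fst

theorem IsLift.contMDiff_greatSphere (h : IsLift I lam f ξ) :
    ContMDiff I 𝓘(ℝ, LieVec n) ∞ (fun x => greatSphere (ξ x)) :=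
  contDiff_greatSphere.contMDiff.comp h.smooth_snd

theorem IsLift.mvfderiv_pointSphere (h : IsLift I lam f ξ) (x : M) (X : TangentSpace I x) :
    mvfderiv I (fun y => pointSphere (f y)) x X = horizontal n (mvfderiv I f x X) := by
  rw [mvfderiv_fderiv_comp x (contDiff_pointSphere.differentiable ne_zero_infty _)
    (h.smooth_fst.mdifferentiable ne_zero_infty x), fderiv_pointSphere]

theorem IsLift.mvfderiv_greatSphere (h : IsLift I lam f ξ) (x : M) (X : TangentSpace I x) :
    mvfderiv I (fun y => greatSphere (ξ y)) x X = horizontal n (mvfderiv I ξ x X) := by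
  rw [mvfderiv_fderiv_comp x (contDiff_greatSphere.differentiable ne_zero_infty _)
    (h.smooth_snd.mdifferentiable ne_zero_infty x), fderiv_greatSphere]

theorem IsLift.isParametrization (h : IsLift I lam f ξ) :
    IsParametrization I lam (fun x => pointSphere (f x)) (fun x => greatSphere (ξ x)) :=
  ⟨h.contMDiff_pointSphere, h.contMDiff_greatSphere, h.plane_eq⟩

/-- The coefficients of a section in the frame are its own first and last coordinates. In the
product rule, the terms that differentiate these coefficients stay in the line and the others are
horizontal. -/
theorem IsLift.mvfderiv_section (h : IsLift I lam f ξ) {k : M → LieVec n} {x : M}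
    (hk : MDifferentiableAt I 𝓘(ℝ, LieVec n) k x) (hmem : ∀ y, k y ∈ (lam y).plane)
    (X : TangentSpace I x) : ∃ w ∈ (lam x).plane, mvfderiv I k x X =
      horizontal n ((k x).1 • mvfderiv I f x X + (k x).2.2 • mvfderiv I ξ x X) + w := by
  let L₁ : LieVec n →L[ℝ] ℝ := ContinuousLinearMap.fst ℝ ℝ _
  let L₂ : LieVec n →L[ℝ] ℝ :=
    (ContinuousLinearMap.snd ℝ (Euc (n + 1)) ℝ).comp (ContinuousLinearMap.snd ℝ ℝ _)
  have hL : ∀ (L : LieVec n →L[ℝ] ℝ), MDifferentiableAt I 𝓘(ℝ, ℝ) (fun y => L (k y)) x :=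
    fun L => L.mdifferentiableAt.comp x hk
  have hZ := h.contMDiff_pointSphere.mdifferentiable ne_zero_infty x
  have hW := h.contMDiff_greatSphere.mdifferentiable ne_zero_infty x
  have hkeq : k = fun y => L₁ (k y) • pointSphere (f y) + L₂ (k y) • greatSphere (ξ y) :=
    funext fun y => h.eq_combination (hmem y)
  refine ⟨mvfderiv I (fun y => L₁ (k y)) x X • pointSphere (f x) +
    mvfderiv I (fun y => L₂ (k y)) x X • greatSphere (ξ x), add_mem
      (Submodule.smul_mem _ _ (h.pointSphere_mem x)) (Submodule.smul_mem _ _ (h.greatSphere_mem x)),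
    ?_⟩
  conv_lhs => rw [hkeq]
  have h₁ : MDifferentiableAt I 𝓘(ℝ, LieVec n) (fun y => L₁ (k y) • pointSphere (f y)) x :=
    (hL L₁).smul hZ
  have h₂ : MDifferentiableAt I 𝓘(ℝ, LieVec n) (fun y => L₂ (k y) • greatSphere (ξ y)) x :=
    (hL L₂).smul hW
  rw [mvfderiv_add_apply h₁ h₂,
    mvfderiv_smul_apply (hL L₁) hZ, mvfderiv_smul_apply (hL L₂) hW,
    h.mvfderiv_pointSphere, h.mvfderiv_greatSphere, map_add, map_smul, map_smul,
    add_add_add_comm]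
  rfl

/-- The derivative of a section of `lam` lies in the line exactly when its horizontal part
vanishes. -/
theorem IsLift.mvfderiv_section_mem_iff (h : IsLift I lam f ξ) {k : M → LieVec n} {x : M}
    (hk : MDifferentiableAt I 𝓘(ℝ, LieVec n) k x) (hmem : ∀ y, k y ∈ (lam y).plane)
    (X : TangentSpace I x) :
    mvfderiv I k x X ∈ (lam x).plane ↔
      (k x).1 • mvfderiv I f x X + (k x).2.2 • mvfderiv I ξ x X = 0 := by
  obtain ⟨w, hw, hder⟩ := h.mvfderiv_section hk hmem X
  rw [hder, Submodule.add_mem_iff_left _ hw, horizontal_mem_plane]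

theorem IsLift.mvfderiv_combination_mem_iff (h : IsLift I lam f ξ) {Z W : M → LieVec n}
    (hZW : IsParametrization I lam Z W) {x : M} (r s : ℝ) (X : TangentSpace I x) :
    r • mvfderiv I Z x X + s • mvfderiv I W x X ∈ (lam x).plane ↔
      (r • Z x + s • W x).1 • mvfderiv I f x X + (r • Z x + s • W x).2.2 • mvfderiv I ξ x X = 0 := by
  have hZ := hZW.1.mdifferentiable ne_zero_infty x
  have hW := hZW.2.1.mdifferentiable ne_zero_infty x
  have hmem : ∀ y, r • Z y + s • W y ∈ (lam y).plane := fun y => by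
    rw [hZW.2.2]; exact Submodule.mem_span_pair.2 ⟨r, s, rfl⟩
  let Lr : ∀ c : ℝ, LieVec n →L[ℝ] LieVec n := fun c => c • ContinuousLinearMap.id ℝ _
  have hdZ : MDifferentiableAt I 𝓘(ℝ, LieVec n) (fun y => Lr r (Z y)) x :=
    (Lr r).mdifferentiableAt.comp x hZ
  have hdW : MDifferentiableAt I 𝓘(ℝ, LieVec n) (fun y => Lr s (W y)) x :=
    (Lr s).mdifferentiableAt.comp x hW
  have key := h.mvfderiv_section_mem_iff (k := fun y => Lr r (Z y) + Lr s (W y))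
    (hdZ.add hdW) hmem X
  rw [mvfderiv_add_apply hdZ hdW, mvfderiv_clm_comp _ _ hZ, mvfderiv_clm_comp _ _ hW] at key
  exact key

/-- The definition quantifies over all parametrizations. The equation found for the frame of the
lift depends on `k` only up to scale, and every other parametrization leads to the same equation. -/
theorem IsLift.mem_principalSpace_iff (h : IsLift I lam f ξ) {x : M} {k : LieVec n}
    (hk0 : k ≠ 0) (hk : k ∈ (lam x).plane) (X : TangentSpace I x) :
    X ∈ principalSpace I lam x (Projectivization.mk ℝ k hk0) ↔
      k.1 • mvfderiv I f x X + k.2.2 • mvfderiv I ξ x X = 0 := by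
  constructor
  · intro hX
    have := hX _ _ h.isParametrization k.1 k.2.2 (by
      rw [Projectivization.submodule_mk, ← h.eq_combination hk]
      exact Submodule.mem_span_singleton_self k)
    rw [h.mvfderiv_pointSphere, h.mvfderiv_greatSphere, ← map_smul (horizontal n),
      ← map_smul (horizontal n), ← map_add, horizontal_mem_plane] at this
    exact this
  · intro hX Z W hZW r s hrs
    refine (h.mvfderiv_combination_mem_iff hZW r s X).2 ?_
    rw [Projectivization.submodule_mk] at hrs
    obtain ⟨c, hc⟩ := Submodule.mem_span_singleton.1 hrs
    rw [← hc, Prod.smul_fst, Prod.smul_snd, Prod.smul_snd, smul_eq_mul, smul_eq_mul, mul_smul,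
      mul_smul, ← smul_add, hX, smul_zero]

/-- The principal space of a point of a line, in terms of any parametrization. -/
theorem IsLift.mem_principalSpace_iff_of_isParametrization (h : IsLift I lam f ξ)
    {Z W : M → LieVec n} (hZW : IsParametrization I lam Z W) {x : M} {r s : ℝ}
    (hk0 : r • Z x + s • W x ≠ 0) (X : TangentSpace I x) :
    X ∈ principalSpace I lam x (Projectivization.mk ℝ (r • Z x + s • W x) hk0) ↔
      r • mvfderiv I Z x X + s • mvfderiv I W x X ∈ (lam x).plane := by
  have hmem : r • Z x + s • W x ∈ (lam x).plane := by
    rw [hZW.2.2]; exact Submodule.mem_span_pair.2 ⟨r, s, rfl⟩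
  rw [h.mem_principalSpace_iff hk0 hmem, h.mvfderiv_combination_mem_iff hZW]

end Lift

end LieSphere

end

noncomputable section

namespace LieSphere

open scoped Topology
open Filter

/-! ### A cyclide in a chart -/

section Chart

variable {E : Type*} [NormedAddCommGroup E] [NormedSpace ℝ E]
  {H : Type*} [TopologicalSpace H] {I : ModelWithCorners ℝ E H}
  {M : Type*} [TopologicalSpace M] [ChartedSpace H M] {n : ℕ}
  {lam : M → LieLine n} {f ξ : M → Euc (n + 1)} {x₀ : M} {e : E}

theorem combination_fst (x y : Euc (n + 1)) (r s : ℝ) :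
    (r • pointSphere x + s • greatSphere y).1 = r := by
  simp [pointSphere, greatSphere]

theorem combination_snd_snd (x y : Euc (n + 1)) (r s : ℝ) :
    (r • pointSphere x + s • greatSphere y).2.2 = s := by
  simp [pointSphere, greatSphere]

theorem combination_ne_zero (x y : Euc (n + 1)) {r s : ℝ} (h : r ≠ 0 ∨ s ≠ 0) :
    r • pointSphere x + s • greatSphere y ≠ 0 := by
  intro h0
  have h1 := combination_fst x y r s
  have h2 := combination_snd_snd x y r s
  rw [h0] at h1 h2
  exact h.elim (fun h => h h1.symm) fun h => h h2.symm

theorem IsLift.combination_mem (h : IsLift I lam f ξ) (x : M) (r s : ℝ) :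
    r • pointSphere (f x) + s • greatSphere (ξ x) ∈ (lam x).plane :=
  add_mem (Submodule.smul_mem _ _ (h.pointSphere_mem x))
    (Submodule.smul_mem _ _ (h.greatSphere_mem x))

theorem IsLift.mem_principalSpace_combination (h : IsLift I lam f ξ) {x : M} {r s : ℝ}
    (hrs : r ≠ 0 ∨ s ≠ 0) (X : TangentSpace I x) :
    X ∈ principalSpace I lam x (Projectivization.mk ℝ _ (combination_ne_zero (f x) (ξ x) hrs)) ↔
      r • mvfderiv I f x X + s • mvfderiv I ξ x X = 0 := by
  rw [h.mem_principalSpace_iff _ (h.combination_mem x r s), combination_fst, combination_snd_snd]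

theorem mk_combination_eq_iff (x y : Euc (n + 1)) {r s r' s' : ℝ} (h : r ≠ 0 ∨ s ≠ 0)
    (h' : r' ≠ 0 ∨ s' ≠ 0) :
    Projectivization.mk ℝ _ (combination_ne_zero x y h) =
      Projectivization.mk ℝ _ (combination_ne_zero x y h') ↔ r * s' - r' * s = 0 := by
  rw [Projectivization.mk_eq_mk_iff']
  constructor
  · rintro ⟨c, hc⟩
    have h1 := congrArg (fun z : LieVec n => z.1) hc
    have h2 := congrArg (fun z : LieVec n => z.2.2) hc
    simp only [Prod.smul_fst, Prod.smul_snd, combination_fst, combination_snd_snd,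
      smul_eq_mul] at h1 h2
    rw [← h1, ← h2]; ring
  · intro h0
    have key : ∀ c : ℝ, c * r' = r → c * s' = s →
        c • (r' • pointSphere x + s' • greatSphere y) = r • pointSphere x + s • greatSphere y := by
      rintro c rfl rfl
      rw [smul_add, smul_smul, smul_smul]
    rcases h' with h' | h'
    · refine ⟨r / r', key _ (div_mul_cancel₀ _ h') ?_⟩
      field_simp; linarith
    · refine ⟨s / s', key _ ?_ (div_mul_cancel₀ _ h')⟩
      field_simp; linarith

theorem IsLift.exists_mk_combination (h : IsLift I lam f ξ) {x : M} {K : ℙ ℝ (LieVec n)}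
    (hK : K.submodule ≤ (lam x).plane) : ∃ (r s : ℝ) (hrs : r ≠ 0 ∨ s ≠ 0),
      K = Projectivization.mk ℝ _ (combination_ne_zero (f x) (ξ x) hrs) := by
  induction K using Projectivization.ind with
  | h k hk0 =>
    rw [Projectivization.submodule_mk, Submodule.span_singleton_le_iff_mem] at hK
    have hk := h.eq_combination hK
    have hrs : k.1 ≠ 0 ∨ k.2.2 ≠ 0 := by
      by_contra! h0
      rw [h0.1, h0.2, zero_smul, zero_smul, add_zero] at hk
      exact hk0 hk
    refine ⟨k.1, k.2.2, hrs, ?_⟩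
    congr 1

variable [IsManifold I ∞ M] [I.Boundaryless]

theorem mvfderiv_comp_extChartAt_symm {F : Type*} [NormedAddCommGroup F] [NormedSpace ℝ F]
    {g : M → F} (hg : ContMDiff I 𝓘(ℝ, F) ∞ g) (he : e ∈ (extChartAt I x₀).target) (X : E) :
    fderiv ℝ (fun y => g ((extChartAt I x₀).symm y)) e X =
      mvfderiv I g ((extChartAt I x₀).symm e) (mfderiv 𝓘(ℝ, E) I (extChartAt I x₀).symm e X) := by
  rw [← mvfderiv_eq_fderiv]
  exact mvfderiv_comp_mfderiv _ (hg.mdifferentiable ne_zero_infty _)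
    (mdifferentiableAt_extChartAt_symm' x₀ he) X

theorem IsLift.fderiv_pointSphere_chart (h : IsLift I lam f ξ)
    (he : e ∈ (extChartAt I x₀).target) (X : E) :
    fderiv ℝ (fun y => pointSphere (f ((extChartAt I x₀).symm y))) e X =
      horizontal n (mvfderiv I f ((extChartAt I x₀).symm e)
        (mfderiv 𝓘(ℝ, E) I (extChartAt I x₀).symm e X)) := by
  rw [mvfderiv_comp_extChartAt_symm h.contMDiff_pointSphere he, h.mvfderiv_pointSphere]

theorem IsLift.fderiv_greatSphere_chart (h : IsLift I lam f ξ)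
    (he : e ∈ (extChartAt I x₀).target) (X : E) :
    fderiv ℝ (fun y => greatSphere (ξ ((extChartAt I x₀).symm y))) e X =
      horizontal n (mvfderiv I ξ ((extChartAt I x₀).symm e)
        (mfderiv 𝓘(ℝ, E) I (extChartAt I x₀).symm e X)) := by
  rw [mvfderiv_comp_extChartAt_symm h.contMDiff_greatSphere he, h.mvfderiv_greatSphere]

variable (I) in
/-- The isomorphism of tangent spaces given by the inverse of a chart. -/
def tangentEquiv (x₀ : M) (he : e ∈ (extChartAt I x₀).target) :
    E ≃ₗ[ℝ] TangentSpace I ((extChartAt I x₀).symm e) :=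
  LinearEquiv.ofBijective (mfderiv 𝓘(ℝ, E) I (extChartAt I x₀).symm e).toLinearMap
    (bijective_mfderiv_extChartAt_symm x₀ he)

theorem IsLift.mem_curvKer_chart (h : IsLift I lam f ξ) (he : e ∈ (extChartAt I x₀).target)
    {r s : ℝ} (hrs : r ≠ 0 ∨ s ≠ 0) (X : E) :
    X ∈ curvKer (fun y => pointSphere (f ((extChartAt I x₀).symm y)))
        (fun y => greatSphere (ξ ((extChartAt I x₀).symm y))) e r s ↔
      tangentEquiv I x₀ he X ∈ principalSpace I lam ((extChartAt I x₀).symm e)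
        (Projectivization.mk ℝ _ (combination_ne_zero (f ((extChartAt I x₀).symm e))
          (ξ ((extChartAt I x₀).symm e)) hrs)) := by
  rw [mem_curvKer, h.mem_principalSpace_combination hrs, h.fderiv_pointSphere_chart he,
    h.fderiv_greatSphere_chart he, ← map_smul (horizontal n), ← map_smul (horizontal n), ← map_add]
  constructor
  · intro h0
    exact congrArg (fun z : LieVec n => z.2.1) h0
  · intro h0
    refine (congrArg (horizontal n) h0).trans (map_zero _)

theorem IsLift.curvKer_chart (h : IsLift I lam f ξ) (he : e ∈ (extChartAt I x₀).target)
    {r s : ℝ} (hrs : r ≠ 0 ∨ s ≠ 0) :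
    (curvKer (fun y => pointSphere (f ((extChartAt I x₀).symm y)))
        (fun y => greatSphere (ξ ((extChartAt I x₀).symm y))) e r s).map
      (tangentEquiv I x₀ he).toLinearMap =
      principalSpace I lam ((extChartAt I x₀).symm e)
        (Projectivization.mk ℝ _ (combination_ne_zero (f ((extChartAt I x₀).symm e))
          (ξ ((extChartAt I x₀).symm e)) hrs)) := by
  ext Y
  rw [Submodule.mem_map]
  constructor
  · rintro ⟨X, hX, rfl⟩
    exact (h.mem_curvKer_chart he hrs X).1 hX
  · intro hY
    refine ⟨(tangentEquiv I x₀ he).symm Y, (h.mem_curvKer_chart he hrs _).2 ?_, ?_⟩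
    · rwa [LinearEquiv.apply_symm_apply]
    · exact LinearEquiv.apply_symm_apply _ _

theorem IsLift.finrank_curvKer_chart (h : IsLift I lam f ξ) (he : e ∈ (extChartAt I x₀).target)
    {r s : ℝ} (hrs : r ≠ 0 ∨ s ≠ 0) :
    finrank ℝ (curvKer (fun y => pointSphere (f ((extChartAt I x₀).symm y)))
        (fun y => greatSphere (ξ ((extChartAt I x₀).symm y))) e r s) =
      multiplicity I lam ((extChartAt I x₀).symm e)
        (Projectivization.mk ℝ _ (combination_ne_zero (f ((extChartAt I x₀).symm e))
          (ξ ((extChartAt I x₀).symm e)) hrs)) := by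
  rw [multiplicity, ← h.curvKer_chart he hrs]
  exact (LinearEquiv.finrank_map_eq (tangentEquiv I x₀ he) _).symm

end Chart

end LieSphere

end

noncomputable section

namespace LieSphere

open scoped Topology
open Filter

/-! ### From cyclides on manifolds to local cyclides and boxes -/

section LocalForm

variable {E : Type*} [NormedAddCommGroup E] [NormedSpace ℝ E]
  {H : Type*} [TopologicalSpace H] {I : ModelWithCorners ℝ E H}
  {M : Type*} [TopologicalSpace M] [ChartedSpace H M] {n : ℕ}
  {lam : M → LieLine n} {f ξ : M → Euc (n + 1)} {p q : ℕ}
  [IsManifold I ∞ M] [I.Boundaryless]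

theorem IsCyclide.two_of_isLift (hc : IsCyclide I p q lam) (h : IsLift I lam f ξ) (x₀ : M) {e : E}
    (he : e ∈ (extChartAt I x₀).target) :
    ∃ r₁ s₁ r₂ s₂ : ℝ, r₁ * s₂ - r₂ * s₁ ≠ 0 ∧
    finrank ℝ (curvKer (fun y => pointSphere (f ((extChartAt I x₀).symm y)))
        (fun y => greatSphere (ξ ((extChartAt I x₀).symm y))) e r₁ s₁) = p ∧
    finrank ℝ (curvKer (fun y => pointSphere (f ((extChartAt I x₀).symm y)))
        (fun y => greatSphere (ξ ((extChartAt I x₀).symm y))) e r₂ s₂) = q ∧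
    ∀ r s, curvKer (fun y => pointSphere (f ((extChartAt I x₀).symm y)))
        (fun y => greatSphere (ξ ((extChartAt I x₀).symm y))) e r s ≠ ⊥ →
      r * s₁ - r₁ * s = 0 ∨ r * s₂ - r₂ * s = 0 := by
  obtain ⟨K₁, K₂, hne, hK, hm₁, hm₂⟩ := hc.2 ((extChartAt I x₀).symm e)
  have hK₁ : IsCurvatureSphere I lam ((extChartAt I x₀).symm e) K₁ := by
    have : K₁ ∈ {K | IsCurvatureSphere I lam ((extChartAt I x₀).symm e) K} := by rw [hK]; simp
    exact this
  have hK₂ : IsCurvatureSphere I lam ((extChartAt I x₀).symm e) K₂ := by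
    have : K₂ ∈ {K | IsCurvatureSphere I lam ((extChartAt I x₀).symm e) K} := by rw [hK]; simp
    exact this
  obtain ⟨r₁, s₁, h₁, rfl⟩ := h.exists_mk_combination hK₁.1
  obtain ⟨r₂, s₂, h₂, rfl⟩ := h.exists_mk_combination hK₂.1
  refine ⟨r₁, s₁, r₂, s₂, fun h0 => hne ((mk_combination_eq_iff _ _ h₁ h₂).2 h0), ?_, ?_, ?_⟩
  · rw [h.finrank_curvKer_chart he h₁, hm₁]
  · rw [h.finrank_curvKer_chart he h₂, hm₂]
  · intro r s hrs
    by_cases h0 : r ≠ 0 ∨ s ≠ 0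
    · obtain ⟨X, hX, hX0⟩ := Submodule.exists_mem_ne_zero_of_ne_bot hrs
      have hmem : Projectivization.mk ℝ _ (combination_ne_zero (f ((extChartAt I x₀).symm e))
          (ξ ((extChartAt I x₀).symm e)) h0) ∈
          {K | IsCurvatureSphere I lam ((extChartAt I x₀).symm e) K} := by
        refine ⟨?_, _, (h.mem_curvKer_chart he h0 X).1 hX, ?_⟩
        · rw [Projectivization.submodule_mk, Submodule.span_singleton_le_iff_mem]
          exact h.combination_mem _ _ _
        · exact (LinearEquiv.map_ne_zero_iff _).2 hX0
      rw [hK] at hmem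
      rcases hmem with hmem | hmem
      · exact Or.inl ((mk_combination_eq_iff _ _ h0 h₁).1 hmem)
      · exact Or.inr ((mk_combination_eq_iff _ _ h0 h₂).1 hmem)
    · push Not at h0
      rw [h0.1, h0.2]
      left; ring

/-- A line of curvature in a chart defines a one-dimensional curvature surface. -/
theorem IsDupin.chart_curve (hc : IsDupin I lam) (h : IsLift I lam f ξ) (x₀ : M) {c : ℝ → E}
    (hcs : ContDiff ℝ ∞ c) (hcU : ∀ t, c t ∈ (extChartAt I x₀).target) (hinj : Injective c)
    (hc' : ∀ t, deriv c t ≠ 0) {r s : ℝ → ℝ} (hrs : ∀ t, r t ≠ 0 ∨ s t ≠ 0)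
    (hker : ∀ t, curvKer (fun y => pointSphere (f ((extChartAt I x₀).symm y)))
        (fun y => greatSphere (ξ ((extChartAt I x₀).symm y))) (c t) (r t) (s t) =
      Submodule.span ℝ {deriv c t}) (t t' : ℝ) : r t * s t' - r t' * s t = 0 := by
  let γ : Euc 1 → E := fun z => c (z 0)
  let P : Euc 1 →L[ℝ] ℝ := EuclideanSpace.proj 0
  let ι : Euc 1 → M := fun z => (extChartAt I x₀).symm (γ z)
  let K : Euc 1 → ℙ ℝ (LieVec n) := fun z =>
    Projectivization.mk ℝ _ (combination_ne_zero (f (ι z)) (ξ (ι z)) (hrs (z 0)))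
  have hP : Injective P := by
    intro z w hzw
    ext i
    rw [Subsingleton.elim i 0]
    exact hzw
  have hγd : ∀ z, HasFDerivAt γ ((ContinuousLinearMap.toSpanSingleton ℝ (deriv c (z 0))).comp P)
      z := by
    intro z
    have h1 : HasFDerivAt c (ContinuousLinearMap.toSpanSingleton ℝ (deriv c (z 0))) (P z) :=
      ((hcs.differentiable ne_zero_infty) _).hasDerivAt.hasFDerivAt
    exact h1.comp z P.hasFDerivAt
  have hγs : ContMDiff (𝓡 1) 𝓘(ℝ, E) ∞ γ := (hcs.comp P.contDiff).contMDiff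
  have hι : ∀ (z : Euc 1) (X : Euc 1), mfderiv (𝓡 1) I ι z X =
      X 0 • tangentEquiv I x₀ (hcU (z 0)) (deriv c (z 0)) := by
    intro z X
    have h1 := mfderiv_comp_apply z (mdifferentiableAt_extChartAt_symm' x₀ (hcU (z 0)))
      (hγs.mdifferentiable ne_zero_infty z) X
    refine h1.trans ?_
    have h2 : mfderiv (𝓡 1) 𝓘(ℝ, E) γ z X = X 0 • deriv c (z 0) := by
      rw [mfderiv_eq_fderiv, (hγd z).fderiv]
      rfl
    rw [h2]
    exact map_smul (tangentEquiv I x₀ (hcU (z 0))) _ _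
  have hprin : ∀ z, principalSpace I lam (ι z) (K z) =
      Submodule.span ℝ {tangentEquiv I x₀ (hcU (z 0)) (deriv c (z 0))} := by
    intro z
    rw [← h.curvKer_chart (hcU (z 0)) (hrs (z 0)), hker, Submodule.map_span, image_singleton]
    rfl
  have hne : ∀ z : Euc 1, tangentEquiv I x₀ (hcU (z 0)) (deriv c (z 0)) ≠ 0 := fun z =>
    (LinearEquiv.map_ne_zero_iff _).2 (hc' _)
  have hsurf : IsCurvatureSurface I lam 1 ι K := by
    refine ⟨inferInstance, ?_, ?_, ?_, fun z => ⟨⟨?_, ?_⟩, ?_⟩⟩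
    · intro z w hzw
      exact hP (hinj ((extChartAt I x₀).symm.injOn (hcU _) (hcU _) hzw))
    · exact (contMDiffOn_extChartAt_symm x₀).comp_contMDiff hγs fun z => hcU _
    · intro z
      refine (injective_iff_map_eq_zero _).2 fun X hX => ?_
      rw [hι z X] at hX
      exact hP (((smul_eq_zero_iff_left (hne z)).1 hX).trans (map_zero P).symm)
    · rw [Projectivization.submodule_mk, Submodule.span_singleton_le_iff_mem]
      exact h.combination_mem _ _ _
    · refine ⟨_, ?_, hne z⟩
      rw [hprin]
      exact Submodule.mem_span_singleton_self _
    · rw [hprin]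
      ext Y
      rw [LinearMap.mem_range, Submodule.mem_span_singleton]
      constructor
      · rintro ⟨X, rfl⟩
        exact ⟨P X, (hι z X).symm⟩
      · rintro ⟨a, rfl⟩
        exact ⟨EuclideanSpace.single 0 a, (hι z _).trans (by simp; rfl)⟩
  have hK := hc.2 1 (Euc 1) ι K hsurf
  have hcurve : ∀ t, ∃ z : Euc 1, z 0 = t := fun t => ⟨EuclideanSpace.single 0 t, by simp⟩
  obtain ⟨z, rfl⟩ := hcurve t
  obtain ⟨w, rfl⟩ := hcurve t'
  have hzw := hK z w
  rw [Projectivization.mk_eq_mk_iff'] at hzw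
  obtain ⟨a, ha⟩ := hzw
  have h1 := congrArg (fun z : LieVec n => z.1) ha
  have h2 := congrArg (fun z : LieVec n => z.2.2) ha
  simp only [Prod.smul_fst, Prod.smul_snd, combination_fst, combination_snd_snd,
    smul_eq_mul] at h1 h2
  rw [← h1, ← h2]; ring

theorem IsCyclide.localCyclide (hp : 1 ≤ p) (hq : 1 ≤ q) (hn : p + q + 1 = n)
    (hc : IsCyclide I p q lam) (h : IsLift I lam f ξ)
    (hcontact : ∀ (x : M) (X : TangentSpace I x), inner ℝ (mvfderiv I f x X) (ξ x) = 0) (x₀ : M) :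
    LocalCyclide p q (extChartAt I x₀).target
      (fun y => pointSphere (f ((extChartAt I x₀).symm y)))
      (fun y => greatSphere (ξ ((extChartAt I x₀).symm y))) where
  pos_left := hp
  pos_right := hq
  finrank_eq := by
    have := hc.1.1.1.1
    omega
  isOpen := isOpen_extChartAt_target x₀
  smooth_fst := (h.contMDiff_pointSphere.comp_contMDiffOn
    (contMDiffOn_extChartAt_symm x₀)).contDiffOn
  smooth_snd := (h.contMDiff_greatSphere.comp_contMDiffOn
    (contMDiffOn_extChartAt_symm x₀)).contDiffOn
  null_fst := fun y _ => (lam _).isotropic _ (h.pointSphere_mem _) _ (h.pointSphere_mem _)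
  null_snd := fun y _ => (lam _).isotropic _ (h.greatSphere_mem _) _ (h.greatSphere_mem _)
  isotropic := fun y _ => (lam _).isotropic _ (h.pointSphere_mem _) _ (h.greatSphere_mem _)
  contact := fun y hy X => by
    rw [h.fderiv_pointSphere_chart hy]
    simp only [lieProd, horizontal_apply, greatSphere, zero_mul, neg_zero, zero_add, sub_zero]
    exact hcontact _ _
  horizontal_fst := fun y hy X => by
    rw [h.fderiv_pointSphere_chart hy]
    exact ⟨rfl, rfl⟩
  horizontal_snd := fun y hy X => by
    rw [h.fderiv_greatSphere_chart hy]
    exact ⟨rfl, rfl⟩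
  two := fun e he => hc.two_of_isLift h x₀ he
  dupin := fun c hcs hcU hinj hc' r s hrs =>
    hc.1.1.chart_curve h x₀ hcs hcU hinj hc' (fun t => (hrs t).1) fun t => (hrs t).2

/-- Near each of its points a cyclide is spanned by two families of spheres which vary
independently of each other. -/
theorem IsCyclide.exists_box (hp : 1 ≤ p) (hq : 1 ≤ q) (hn : p + q + 1 = n)
    (hc : IsCyclide I p q lam) (x : M) {N : Set M} (hN : N ∈ 𝓝 x) :
    ∃ V ⊆ N, V ∈ 𝓝 x ∧ ∃ k₁ k₂ : M → LieVec n,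
      (∀ y ∈ V, (lam y).plane = Submodule.span ℝ {k₁ y, k₂ y}) ∧
      IsBox V k₁ k₂ ∧
      q + 2 ≤ finrank ℝ (Submodule.span ℝ (k₁ '' V)) ∧
      p + 2 ≤ finrank ℝ (Submodule.span ℝ (k₂ '' V)) ∧
      (∃ x ∈ Submodule.span ℝ (k₁ '' V), lieProd x x < 0) ∧
      (∃ x ∈ Submodule.span ℝ (k₂ '' V), lieProd x x < 0) := by
  obtain ⟨-, f, ξ, h, -, hcontact⟩ := isLegendre_iff.1 hc.1.1.1
  have hloc := hc.localCyclide hp hq hn h hcontact x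
  let φ := extChartAt I x
  have hx : φ x ∈ φ.target := mem_extChartAt_target x
  have hN' : φ.symm ⁻¹' N ∈ 𝓝 (φ x) :=
    (continuousAt_extChartAt_symm x).preimage_mem_nhds (by rwa [extChartAt_to_inv])
  obtain ⟨V, hV, hxV, k₁, k₂, hs, hb, h₁, h₂, h₃, h₄⟩ := hloc.exists_box hx hN'
  have him : ∀ k : E → LieVec n, (fun y => k (φ y)) '' (φ.symm '' V) = k '' V := by
    intro k
    rw [image_image]
    refine image_congr fun y hy => ?_
    rw [φ.right_inv (hV hy).1]
  refine ⟨φ.symm '' V, ?_, ?_, fun y => k₁ (φ y), fun y => k₂ (φ y), ?_, ?_, ?_⟩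
  · rintro _ ⟨y, hy, rfl⟩
    exact (hV hy).2
  · filter_upwards [(continuousAt_extChartAt x).preimage_mem_nhds hxV,
      extChartAt_source_mem_nhds (I := I) x] with y hy hy'
    exact ⟨φ y, hy, φ.left_inv hy'⟩
  · rintro _ ⟨y, hy, rfl⟩
    dsimp only
    rw [h.plane_eq, φ.right_inv (hV hy).1]
    exact hs y hy
  · rintro _ ⟨y, hy, rfl⟩ _ ⟨z, hz, rfl⟩
    obtain ⟨w, hw, hw₁, hw₂⟩ := hb y hy z hz
    refine ⟨_, ⟨w, hw, rfl⟩, ?_⟩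
    dsimp only
    rw [φ.right_inv (hV hy).1, φ.right_inv (hV hz).1, φ.right_inv (hV hw).1]
    exact ⟨hw₁, hw₂⟩
  · rw [him, him]
    exact ⟨h₁, h₂, h₃, h₄⟩

end LocalForm

end LieSphere

end

noncomputable section

namespace LieSphere

open scoped Topology
open Filter

/-! ### A connected cyclide lies in a single standard one -/

section Global

variable {E : Type*} [NormedAddCommGroup E] [NormedSpace ℝ E]
  {H : Type*} [TopologicalSpace H] {I : ModelWithCorners ℝ E H}
  {M : Type*} [TopologicalSpace M] [ChartedSpace H M] {n : ℕ}
  {lam : M → LieLine n} {p q : ℕ} [IsManifold I ∞ M] [I.Boundaryless]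

theorem LieLine.linearIndependent_of_plane_eq {ℓ : LieLine n} {a b : LieVec n}
    (h : ℓ.plane = Submodule.span ℝ {a, b}) : LinearIndependent ℝ ![a, b] := by
  rw [linearIndependent_iff_card_eq_finrank_span, Matrix.range_cons_cons_empty, Set.finrank, ← h,
    ℓ.finrank_eq, Fintype.card_fin]

/-- The two families of a box span orthogonal subspaces large enough to be the factors of some `C`.
Each line of the box meets both of them, in its two curvature spheres. -/
theorem IsCyclide.exists_eventually_mem_range (hp : 1 ≤ p) (hq : 1 ≤ q) (hn : p + q + 1 = n)
    (hc : IsCyclide I p q lam) (x : M) :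
    ∃ C : LieTransf n, ∀ᶠ y in 𝓝 x, lam y ∈ range (fun z => C.act (stdLift hn z)) := by
  obtain ⟨V, -, hxV, k₁, k₂, hk, hb, h₁, h₂, h₃, h₄⟩ := hc.exists_box hp hq hn x univ_mem
  obtain ⟨C, hC₁, hC₂⟩ := exists_lieTransf_of_orthogonal hn (hb.orthogonal hk) h₁ h₂ h₃ h₄
  refine ⟨C, ?_⟩
  filter_upwards [hxV] with y hy
  have hli := LieLine.linearIndependent_of_plane_eq (hk y hy)
  rw [mem_range_act_stdLift]
  refine ⟨⟨k₁ y, ?_, hli.ne_zero 0, (hC₁ _).1 (Submodule.subset_span ⟨y, hy, rfl⟩)⟩,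
    ⟨k₂ y, ?_, hli.ne_zero 1, (hC₂ _).1 (Submodule.subset_span ⟨y, hy, rfl⟩)⟩⟩
  · rw [hk y hy]; exact Submodule.subset_span (by simp)
  · rw [hk y hy]; exact Submodule.subset_span (by simp)

theorem IsCyclide.range_eq_range_of_eventually (hp : 1 ≤ p) (hq : 1 ≤ q) (hn : p + q + 1 = n)
    (hc : IsCyclide I p q lam) (x : M) {C D : LieTransf n}
    (hC : ∀ᶠ y in 𝓝 x, lam y ∈ range (fun z => C.act (stdLift hn z)))
    (hD : ∀ᶠ y in 𝓝 x, lam y ∈ range (fun z => D.act (stdLift hn z))) :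
    range (fun z => C.act (stdLift hn z)) = range (fun z => D.act (stdLift hn z)) := by
  obtain ⟨V, hV, -, k₁, k₂, hk, hb, h₁, h₂, -, -⟩ := hc.exists_box hp hq hn x (hC.and hD)
  exact hb.range_eq_range hn hp hq hk h₁ h₂ C D (fun y hy => (hV hy).1) fun y hy => (hV hy).2

theorem IsCyclide.exists_forall_mem_range [ConnectedSpace M] (hp : 1 ≤ p) (hq : 1 ≤ q)
    (hn : p + q + 1 = n) (hc : IsCyclide I p q lam) :
    ∃ C : LieTransf n, ∀ x, lam x ∈ range (fun z => C.act (stdLift hn z)) := by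
  obtain ⟨x₀⟩ : Nonempty M := inferInstance
  obtain ⟨C, hC⟩ := hc.exists_eventually_mem_range hp hq hn x₀
  refine ⟨C, fun x => ?_⟩
  let S : Set M := {x | ∀ᶠ y in 𝓝 x, lam y ∈ range (fun z => C.act (stdLift hn z))}
  have hopen : IsOpen S := isOpen_setOfPred_eventually_nhds
  have hclosed : IsClosed S := by
    refine isClosed_of_closure_subset fun x hx => ?_
    obtain ⟨D, hD⟩ := hc.exists_eventually_mem_range hp hq hn x
    -- At a limit point `x` of `S` the cyclide lies near `x` in an image under some `D`. A nearby
    -- point of `S` carries germs in both images, and rigidity identifies them.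
    obtain ⟨z, hz, hzS⟩ := mem_closure_iff_nhds.1 hx _ (eventually_eventually_nhds.2 hD)
    have := hc.range_eq_range_of_eventually hp hq hn z hzS hz
    change ∀ᶠ y in 𝓝 x, lam y ∈ range (fun z => C.act (stdLift hn z))
    rw [this]
    exact hD
  have huniv : S = univ := IsClopen.eq_univ ⟨hclosed, hopen⟩ ⟨x₀, hC⟩
  have hx : x ∈ S := huniv ▸ mem_univ x
  exact hx.self_of_nhds

end Global

/-! ### Legendre submanifolds given by a frame -/

section Frame

variable {E : Type*} [NormedAddCommGroup E] [NormedSpace ℝ E]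
  {H : Type*} [TopologicalSpace H] {I : ModelWithCorners ℝ E H}
  {M : Type*} [TopologicalSpace M] [ChartedSpace H M] {n : ℕ}
  {lam : M → LieLine n}

/-- The first and last coordinates are injective on an isotropic plane, since a vector on which both
vanish is horizontal. -/
theorem LieLine.det_ne_zero {ℓ : LieLine n} {a b : LieVec n}
    (h : ℓ.plane = Submodule.span ℝ {a, b}) : a.1 * b.2.2 - a.2.2 * b.1 ≠ 0 := by
  intro hD
  have hli := LinearIndependent.pair_iff.1 (LieLine.linearIndependent_of_plane_eq h)
  have hmem : ∀ r s : ℝ, r • a + s • b ∈ ℓ.plane := fun r s => by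
    rw [h]; exact Submodule.mem_span_pair.2 ⟨r, s, rfl⟩
  have key : ∀ r s : ℝ, r * a.1 + s * b.1 = 0 → r * a.2.2 + s * b.2.2 = 0 → r = 0 ∧ s = 0 :=
    fun r s h1 h2 => hli r s (lieProd_horizontal_self_eq_zero (by simpa using h1)
      (by simpa using h2) (ℓ.isotropic _ (hmem r s) _ (hmem r s)))
  have h1 := key b.1 (-a.1) (by ring) (by linarith)
  have h2 := key b.2.2 (-a.2.2) (by linarith) (by ring)
  exact one_ne_zero (key 1 0 (by linarith [h1.2]) (by linarith [h2.2])).1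

/-- By Cramer's rule, using the nonvanishing determinant of the first and last coordinates, the
spheres `(1, f, 0)` and `(0, ξ, 1)` of the line are smooth combinations of any smooth frame. -/
theorem IsParametrization.exists_isLift {Z W : M → LieVec n} (h : IsParametrization I lam Z W) :
    ∃ f ξ, IsLift I lam f ξ := by
  have hD : ∀ x, (Z x).1 * (W x).2.2 - (Z x).2.2 * (W x).1 ≠ 0 :=
    fun x => LieLine.det_ne_zero (h.2.2 x)
  let L₁ : LieVec n →L[ℝ] ℝ := ContinuousLinearMap.fst ℝ ℝ _
  let L₂ : LieVec n →L[ℝ] ℝ :=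
    (ContinuousLinearMap.snd ℝ (Euc (n + 1)) ℝ).comp (ContinuousLinearMap.snd ℝ ℝ _)
  let P : LieVec n →L[ℝ] Euc (n + 1) :=
    (ContinuousLinearMap.fst ℝ (Euc (n + 1)) ℝ).comp (ContinuousLinearMap.snd ℝ ℝ _)
  let D : M → ℝ := fun x => L₁ (Z x) * L₂ (W x) - L₂ (Z x) * L₁ (W x)
  have hD' : ∀ x, D x ≠ 0 := hD
  have hDs : ContMDiff I 𝓘(ℝ, ℝ) ∞ fun x => (D x)⁻¹ :=
    (((h.1.clm_comp' L₁).mul (h.2.1.clm_comp' L₂)).sub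
      ((h.1.clm_comp' L₂).mul (h.2.1.clm_comp' L₁))).inv₀ hD'
  refine ⟨fun x => (D x)⁻¹ • (L₂ (W x) • P (Z x) - L₂ (Z x) • P (W x)),
    fun x => (D x)⁻¹ • (L₁ (Z x) • P (W x) - L₁ (W x) • P (Z x)), ?_, ?_, ?_⟩
  · exact hDs.smul (((h.2.1.clm_comp' L₂).smul (h.1.clm_comp' P)).sub
      ((h.1.clm_comp' L₂).smul (h.2.1.clm_comp' P)))
  · exact hDs.smul (((h.1.clm_comp' L₁).smul (h.2.1.clm_comp' P)).sub
      ((h.2.1.clm_comp' L₁).smul (h.1.clm_comp' P)))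
  · intro x
    have e₁ : pointSphere ((D x)⁻¹ • (L₂ (W x) • P (Z x) - L₂ (Z x) • P (W x))) =
        ((D x)⁻¹ * L₂ (W x)) • Z x + (-((D x)⁻¹ * L₂ (Z x))) • W x := by
      refine Prod.ext ?_ (Prod.ext ?_ ?_)
      · change 1 = (D x)⁻¹ * L₂ (W x) * L₁ (Z x) + -((D x)⁻¹ * L₂ (Z x)) * L₁ (W x)
        rw [← inv_mul_cancel₀ (hD' x)]; ring
      · change (D x)⁻¹ • (L₂ (W x) • P (Z x) - L₂ (Z x) • P (W x)) =
          ((D x)⁻¹ * L₂ (W x)) • P (Z x) + (-((D x)⁻¹ * L₂ (Z x))) • P (W x)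
        module
      · change 0 = (D x)⁻¹ * L₂ (W x) * L₂ (Z x) + -((D x)⁻¹ * L₂ (Z x)) * L₂ (W x)
        ring
    have e₂ : greatSphere ((D x)⁻¹ • (L₁ (Z x) • P (W x) - L₁ (W x) • P (Z x))) =
        (-((D x)⁻¹ * L₁ (W x))) • Z x + ((D x)⁻¹ * L₁ (Z x)) • W x := by
      refine Prod.ext ?_ (Prod.ext ?_ ?_)
      · change 0 = -((D x)⁻¹ * L₁ (W x)) * L₁ (Z x) + (D x)⁻¹ * L₁ (Z x) * L₁ (W x)
        ring
      · change (D x)⁻¹ • (L₁ (Z x) • P (W x) - L₁ (W x) • P (Z x)) =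
          (-((D x)⁻¹ * L₁ (W x))) • P (Z x) + ((D x)⁻¹ * L₁ (Z x)) • P (W x)
        module
      · change 1 = -((D x)⁻¹ * L₁ (W x)) * L₂ (Z x) + (D x)⁻¹ * L₁ (Z x) * L₂ (W x)
        rw [← inv_mul_cancel₀ (hD' x)]; ring
    symm
    refine Submodule.eq_of_le_of_finrank_eq ?_ ?_
    · rw [Submodule.span_le, insert_subset_iff, singleton_subset_iff]
      refine ⟨?_, ?_⟩
      · rw [SetLike.mem_coe, e₁, h.2.2]; exact Submodule.mem_span_pair.2 ⟨_, _, rfl⟩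
      · rw [SetLike.mem_coe, e₂, h.2.2]; exact Submodule.mem_span_pair.2 ⟨_, _, rfl⟩
    · rw [finrank_span_contact, (lam x).finrank_eq]

theorem IsParametrization.fst_mem {Z W : M → LieVec n} (h : IsParametrization I lam Z W) (x : M) :
    Z x ∈ (lam x).plane := by
  rw [h.2.2]; exact Submodule.subset_span (by simp)

theorem IsParametrization.snd_mem {Z W : M → LieVec n} (h : IsParametrization I lam Z W) (x : M) :
    W x ∈ (lam x).plane := by
  rw [h.2.2]; exact Submodule.subset_span (by simp)

theorem IsParametrization.isLegendre {Z W : M → LieVec n} (h : IsParametrization I lam Z W)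
    (hd : finrank ℝ E + 1 = n)
    (hcontact : ∀ (x : M) (X : TangentSpace I x), ∀ k ∈ (lam x).plane,
      lieProd (mvfderiv I Z x X) k = 0 ∧ lieProd (mvfderiv I W x X) k = 0)
    (himm : ∀ (x : M) (X : TangentSpace I x), mvfderiv I Z x X ∈ (lam x).plane →
      mvfderiv I W x X ∈ (lam x).plane → X = 0) : IsLegendre I lam := by
  obtain ⟨f, ξ, hl⟩ := h.exists_isLift
  refine isLegendre_iff.2 ⟨hd, f, ξ, hl, fun x X h1 h2 => ?_, fun x X => ?_⟩
  · refine himm x X ?_ ?_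
    · rw [hl.mvfderiv_section_mem_iff (h.1.mdifferentiable ne_zero_infty x) h.fst_mem, h1, h2]
      simp
    · rw [hl.mvfderiv_section_mem_iff (h.2.1.mdifferentiable ne_zero_infty x) h.snd_mem, h1, h2]
      simp
  · obtain ⟨z, hz, hZ⟩ := hl.mvfderiv_section (h.1.mdifferentiable ne_zero_infty x) h.fst_mem X
    obtain ⟨w, hw, hW⟩ := hl.mvfderiv_section (h.2.1.mdifferentiable ne_zero_infty x) h.snd_mem X
    have hg := hl.greatSphere_mem x
    have h1 := (hcontact x X _ hg).1
    have h2 := (hcontact x X _ hg).2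
    rw [hZ, lieProd_add_left, (lam x).isotropic _ hz _ hg, add_zero] at h1
    rw [hW, lieProd_add_left, (lam x).isotropic _ hw _ hg, add_zero] at h2
    simp only [lieProd, horizontal_apply, greatSphere, zero_mul, neg_zero, zero_add, sub_zero,
      inner_add_left, inner_smul_left, RCLike.conj_to_real] at h1 h2
    have hD := LieLine.det_ne_zero (h.2.2 x)
    refine (mul_eq_zero.1 ?_).resolve_left hD
    -- Eliminating `⟨dξ, ξ⟩` from the two contact equations leaves the determinant times `⟨df, ξ⟩`.
    linear_combination (W x).2.2 * h1 - (Z x).2.2 * h2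

end Frame

end LieSphere

end

noncomputable section

namespace LieSphere

open scoped Topology
open Filter

/-! ### Vanishing of differentials -/

section Vanishing

variable {E : Type*} [NormedAddCommGroup E] [NormedSpace ℝ E]
  {H : Type*} [TopologicalSpace H] {I : ModelWithCorners ℝ E H}
  {M : Type*} [TopologicalSpace M] [ChartedSpace H M] [IsManifold I ∞ M] [I.Boundaryless]
  {F : Type*} [NormedAddCommGroup F] [NormedSpace ℝ F] {g : M → F}

theorem fderiv_chart_eq_zero_iff (hg : ContMDiff I 𝓘(ℝ, F) ∞ g) {x₀ : M} {e : E}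
    (he : e ∈ (extChartAt I x₀).target) :
    fderiv ℝ (fun y => g ((extChartAt I x₀).symm y)) e = 0 ↔
      mvfderiv I g ((extChartAt I x₀).symm e) = 0 := by
  constructor
  · intro h
    ext X
    obtain ⟨Y, rfl⟩ := (bijective_mfderiv_extChartAt_symm (I := I) x₀ he).2 X
    refine (mvfderiv_comp_extChartAt_symm hg he Y).symm.trans ?_
    rw [h]
    rfl
  · intro h
    ext X
    rw [mvfderiv_comp_extChartAt_symm hg he, h]
    rfl

theorem isOpen_mvfderiv_ne_zero (hg : ContMDiff I 𝓘(ℝ, F) ∞ g) :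
    IsOpen {x | mvfderiv I g x ≠ 0} := by
  refine isOpen_iff_mem_nhds.2 fun x hx => ?_
  let φ := extChartAt I x
  have hgs : ContDiffOn ℝ ∞ (fun y => g (φ.symm y)) φ.target :=
    (hg.comp_contMDiffOn (contMDiffOn_extChartAt_symm x)).contDiffOn
  have hcont := hgs.continuousOn_fderiv_of_isOpen (isOpen_extChartAt_target x)
    (by exact_mod_cast le_top)
  have hxt : φ x ∈ φ.target := mem_extChartAt_target x
  have hx' : fderiv ℝ (fun y => g (φ.symm y)) (φ x) ≠ 0 := by
    rw [Ne, fderiv_chart_eq_zero_iff hg hxt, extChartAt_to_inv]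
    exact hx
  have hev : ∀ᶠ e in 𝓝 (φ x), fderiv ℝ (fun y => g (φ.symm y)) e ≠ 0 :=
    (hcont.continuousAt ((isOpen_extChartAt_target x).mem_nhds hxt)).eventually_ne hx'
  filter_upwards [(continuousAt_extChartAt (I := I) x).eventually hev,
    extChartAt_source_mem_nhds (I := I) x] with y hy hys
  rw [Ne, fderiv_chart_eq_zero_iff hg (φ.map_source hys), φ.left_inv hys] at hy
  exact hy

theorem eq_of_mvfderiv_eq_zero [PreconnectedSpace M] (hg : ContMDiff I 𝓘(ℝ, F) ∞ g)
    (h : ∀ x, mvfderiv I g x = 0) (x y : M) : g x = g y := by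
  refine IsLocallyConstant.apply_eq_of_preconnectedSpace ?_ x y
  refine (IsLocallyConstant.iff_eventually_eq _).2 fun x => ?_
  let φ := extChartAt I x
  have hgs : ContDiffOn ℝ ∞ (fun y => g (φ.symm y)) φ.target :=
    (hg.comp_contMDiffOn (contMDiffOn_extChartAt_symm x)).contDiffOn
  obtain ⟨ε, hε, hball⟩ := Metric.isOpen_iff.1 (isOpen_extChartAt_target (I := I) x) _
    (mem_extChartAt_target x)
  have hconst : ∀ e ∈ Metric.ball (φ x) ε, g (φ.symm e) = g (φ.symm (φ x)) := fun e he =>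
    Metric.isOpen_ball.is_const_of_fderiv_eq_zero (convex_ball _ _).isPreconnected
      ((hgs.differentiableOn ne_zero_infty).mono hball)
      (fun z hz => (fderiv_chart_eq_zero_iff hg (hball hz)).2 (h _)) he (Metric.mem_ball_self hε)
  filter_upwards [(continuousAt_extChartAt (I := I) x).preimage_mem_nhds
    (Metric.ball_mem_nhds _ hε), extChartAt_source_mem_nhds (I := I) x] with y hy hys
  have := hconst _ hy
  rwa [φ.left_inv hys, extChartAt_to_inv] at this

end Vanishing

/-! ### The images of the standard product -/

theorem fact_finrank_euc (k : ℕ) : Fact (finrank ℝ (Euc (k + 1)) = k + 1) :=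
  ⟨finrank_euclideanSpace_fin⟩

theorem contMDiff_coe_sph (k : ℕ) :
    ContMDiff (𝓡 k) 𝓘(ℝ, Euc (k + 1)) ∞ ((↑) : Sph k → Euc (k + 1)) :=
  have := fact_finrank_euc k
  contMDiff_coe_sphere

theorem injective_mvfderiv_coe_sph {k : ℕ} (v : Sph k) :
    Injective (mvfderiv (𝓡 k) ((↑) : Sph k → Euc (k + 1)) v) :=
  have := fact_finrank_euc k
  injective_mvfderiv_subtypeVal_sphere v

theorem inner_mvfderiv_coe_sph {k : ℕ} (v : Sph k) (X : TangentSpace (𝓡 k) v) :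
    inner ℝ (mvfderiv (𝓡 k) ((↑) : Sph k → Euc (k + 1)) v X) (v : Euc (k + 1)) = 0 := by
  have := fact_finrank_euc k
  rw [← Submodule.mem_orthogonal_singleton_iff_inner_left]
  exact (range_mvfderiv_subtypeVal v).le (LinearMap.mem_range_self
    (mvfderiv (𝓡 k) ((↑) : Sph k → Euc (k + 1)) v).toLinearMap X)

theorem contMDiff_sph_of_coe {k : ℕ} {E : Type*} [NormedAddCommGroup E] [NormedSpace ℝ E]
    {H : Type*} [TopologicalSpace H] {I : ModelWithCorners ℝ E H}
    {M : Type*} [TopologicalSpace M] [ChartedSpace H M] [IsManifold I ∞ M] {g : M → Sph k}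
    (hg : ContMDiff I 𝓘(ℝ, Euc (k + 1)) ∞ (fun x => (g x : Euc (k + 1)))) :
    ContMDiff I (𝓡 k) ∞ g :=
  have := fact_finrank_euc k
  hg.codRestrict_sphere fun x => (g x).2

section Standard

variable {p q n : ℕ} (hn : p + q + 1 = n)

/-- The linear part of `stdOne`. -/
def stdOneLin : Euc (q + 1) →L[ℝ] LieVec n :=
  LinearMap.toContinuousLinearMap
    ((horizontal n).toLinearMap ∘ₗ (√2 • glueL hn ∘ₗ LinearMap.inl ℝ (Euc (q + 1)) (Euc (p + 1))))

/-- The linear part of `stdTwo`. -/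
def stdTwoLin : Euc (p + 1) →L[ℝ] LieVec n :=
  LinearMap.toContinuousLinearMap
    ((horizontal n).toLinearMap ∘ₗ (√2 • glueL hn ∘ₗ LinearMap.inr ℝ (Euc (q + 1)) (Euc (p + 1))))

theorem stdOneLin_apply (v : Euc (q + 1)) : stdOneLin hn v = (0, √2 • glue hn v 0, 0) := rfl

theorem stdTwoLin_apply (u : Euc (p + 1)) : stdTwoLin hn u = (0, √2 • glue hn 0 u, 0) := rfl

theorem stdOne_eq (v : Euc (q + 1)) : stdOne hn v = (1, 0, 1) + stdOneLin hn v := by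
  simp [stdOne, stdOneLin_apply]

theorem stdTwo_eq (u : Euc (p + 1)) : stdTwo hn u = (1, 0, -1) + stdTwoLin hn u := by
  simp [stdTwo, stdTwoLin_apply]

@[simp] theorem coordOne_stdOneLin (v : Euc (q + 1)) :
    coordOne hn (stdOneLin hn v) = (0, √2 • v) := by
  simp [coordOne, stdOneLin_apply]

@[simp] theorem coordTwo_stdOneLin (v : Euc (q + 1)) : coordTwo hn (stdOneLin hn v) = 0 := by
  simp [coordTwo, stdOneLin_apply]

@[simp] theorem coordOne_stdTwoLin (u : Euc (p + 1)) : coordOne hn (stdTwoLin hn u) = 0 := by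
  simp [coordOne, stdTwoLin_apply]

@[simp] theorem coordTwo_stdTwoLin (u : Euc (p + 1)) :
    coordTwo hn (stdTwoLin hn u) = (0, √2 • u) := by
  simp [coordTwo, stdTwoLin_apply]

/-- The inclusion of the first factor of `S^q × S^p`. -/
def sphOne (y : Sph q × Sph p) : Euc (q + 1) := y.1

/-- The inclusion of the second factor of `S^q × S^p`. -/
def sphTwo (y : Sph q × Sph p) : Euc (p + 1) := y.2

theorem contMDiff_sphOne : ContMDiff ((𝓡 q).prod (𝓡 p)) 𝓘(ℝ, Euc (q + 1)) ∞
    (sphOne : Sph q × Sph p → Euc (q + 1)) :=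
  (contMDiff_coe_sph q).comp contMDiff_fst

theorem contMDiff_sphTwo : ContMDiff ((𝓡 q).prod (𝓡 p)) 𝓘(ℝ, Euc (p + 1)) ∞
    (sphTwo : Sph q × Sph p → Euc (p + 1)) :=
  (contMDiff_coe_sph p).comp contMDiff_snd

theorem mvfderiv_sphOne (y : Sph q × Sph p) (X : TangentSpace ((𝓡 q).prod (𝓡 p)) y) :
    mvfderiv ((𝓡 q).prod (𝓡 p)) sphOne y X =
      mvfderiv (𝓡 q) ((↑) : Sph q → Euc (q + 1)) y.1 X.1 := by
  have := mvfderiv_comp_mfderiv (I := (𝓡 q).prod (𝓡 p)) (J := 𝓡 q) (f := Prod.fst)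
    (g := ((↑) : Sph q → Euc (q + 1))) y
    ((contMDiff_coe_sph q).mdifferentiable ne_zero_infty _) mdifferentiableAt_fst X
  rw [mfderiv_fst] at this
  exact this

theorem mvfderiv_sphTwo (y : Sph q × Sph p) (X : TangentSpace ((𝓡 q).prod (𝓡 p)) y) :
    mvfderiv ((𝓡 q).prod (𝓡 p)) sphTwo y X =
      mvfderiv (𝓡 p) ((↑) : Sph p → Euc (p + 1)) y.2 X.2 := by
  have := mvfderiv_comp_mfderiv (I := (𝓡 q).prod (𝓡 p)) (J := 𝓡 p) (f := Prod.snd)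
    (g := ((↑) : Sph p → Euc (p + 1))) y
    ((contMDiff_coe_sph p).mdifferentiable ne_zero_infty _) mdifferentiableAt_snd X
  rw [mfderiv_snd] at this
  exact this

theorem mvfderiv_sphOne_eq_zero {y : Sph q × Sph p} {X : TangentSpace ((𝓡 q).prod (𝓡 p)) y} :
    mvfderiv ((𝓡 q).prod (𝓡 p)) sphOne y X = 0 ↔ X.1 = 0 := by
  rw [mvfderiv_sphOne]
  exact map_eq_zero_iff _ (injective_mvfderiv_coe_sph y.1)

theorem mvfderiv_sphTwo_eq_zero {y : Sph q × Sph p} {X : TangentSpace ((𝓡 q).prod (𝓡 p)) y} :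
    mvfderiv ((𝓡 q).prod (𝓡 p)) sphTwo y X = 0 ↔ X.2 = 0 := by
  rw [mvfderiv_sphTwo]
  exact map_eq_zero_iff _ (injective_mvfderiv_coe_sph y.2)

variable (C : LieTransf n)

/-- A Lie sphere transformation as a continuous linear map. -/
def LieTransf.toCLM : LieVec n →L[ℝ] LieVec n := LinearMap.toContinuousLinearMap C.1.toLinearMap

/-- The first family of curvature spheres of the image of the standard product under `C`. -/
def frameOne (y : Sph q × Sph p) : LieVec n := C.1 (stdOne hn (sphOne y))

/-- The second family of curvature spheres of the image of the standard product under `C`. -/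
def frameTwo (y : Sph q × Sph p) : LieVec n := C.1 (stdTwo hn (sphTwo y))

theorem contDiff_stdOne : ContDiff ℝ ∞ (stdOne hn) := by
  rw [funext (stdOne_eq hn)]
  exact contDiff_const.add (stdOneLin hn).contDiff

theorem contDiff_stdTwo : ContDiff ℝ ∞ (stdTwo hn) := by
  rw [funext (stdTwo_eq hn)]
  exact contDiff_const.add (stdTwoLin hn).contDiff

theorem act_stdLift_plane (y : Sph q × Sph p) :
    (C.act (stdLift hn y)).plane = Submodule.span ℝ {frameOne hn C y, frameTwo hn C y} := by
  have : (C.act (stdLift hn y)).plane = (stdLift hn y).plane.map (C.1 : LieVec n →ₗ[ℝ] LieVec n) :=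
    rfl
  rw [this, stdLift_plane, Submodule.map_span, image_pair]
  rfl

theorem isParametrization_frame : IsParametrization ((𝓡 q).prod (𝓡 p))
    (fun y => C.act (stdLift hn y)) (frameOne hn C) (frameTwo hn C) :=
  ⟨(C.toCLM.contDiff.comp (contDiff_stdOne hn)).contMDiff.comp contMDiff_sphOne,
    (C.toCLM.contDiff.comp (contDiff_stdTwo hn)).contMDiff.comp contMDiff_sphTwo,
    act_stdLift_plane hn C⟩

theorem mvfderiv_frameOne (y : Sph q × Sph p) (X : TangentSpace ((𝓡 q).prod (𝓡 p)) y) :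
    mvfderiv ((𝓡 q).prod (𝓡 p)) (frameOne hn C) y X =
      C.1 (stdOneLin hn (mvfderiv ((𝓡 q).prod (𝓡 p)) sphOne y X)) := by
  have h := mvfderiv_fderiv_comp (I := (𝓡 q).prod (𝓡 p)) (g := sphOne)
    (Φ := fun v => C.toCLM (stdOne hn v)) y
    ((C.toCLM.contDiff.comp (contDiff_stdOne hn)).differentiable ne_zero_infty _)
    (contMDiff_sphOne.mdifferentiable ne_zero_infty y) X
  have hd : HasFDerivAt (fun v => C.toCLM (stdOne hn v)) (C.toCLM.comp (stdOneLin hn))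
      (sphOne y) := by
    rw [funext (stdOne_eq hn)]
    exact C.toCLM.hasFDerivAt.comp _ ((stdOneLin hn).hasFDerivAt.const_add _)
  rw [hd.fderiv] at h
  exact h

theorem mvfderiv_frameTwo (y : Sph q × Sph p) (X : TangentSpace ((𝓡 q).prod (𝓡 p)) y) :
    mvfderiv ((𝓡 q).prod (𝓡 p)) (frameTwo hn C) y X =
      C.1 (stdTwoLin hn (mvfderiv ((𝓡 q).prod (𝓡 p)) sphTwo y X)) := by
  have h := mvfderiv_fderiv_comp (I := (𝓡 q).prod (𝓡 p)) (g := sphTwo)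
    (Φ := fun v => C.toCLM (stdTwo hn v)) y
    ((C.toCLM.contDiff.comp (contDiff_stdTwo hn)).differentiable ne_zero_infty _)
    (contMDiff_sphTwo.mdifferentiable ne_zero_infty y) X
  have hd : HasFDerivAt (fun v => C.toCLM (stdTwo hn v)) (C.toCLM.comp (stdTwoLin hn))
      (sphTwo y) := by
    rw [funext (stdTwo_eq hn)]
    exact C.toCLM.hasFDerivAt.comp _ ((stdTwoLin hn).hasFDerivAt.const_add _)
  rw [hd.fderiv] at h
  exact h

/-- Derivatives of the two spheres have zero time coordinates in both factors, whereas `stdOne` and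
`stdTwo` have time coordinate 2. So both coefficients of a combination in the line must vanish. -/
theorem combination_lin_mem_iff (y : Sph q × Sph p) (v : Euc (q + 1)) (u : Euc (p + 1)) :
    stdOneLin hn v + stdTwoLin hn u ∈ (stdLift hn y).plane ↔ v = 0 ∧ u = 0 := by
  have hs : √2 ≠ 0 := by positivity
  constructor
  · intro h
    rw [stdLift_plane] at h
    obtain ⟨a, b, hab⟩ := Submodule.mem_span_pair.1 h
    have h1 := congrArg (coordOne hn) hab
    have h2 := congrArg (coordTwo hn) hab
    simp only [map_add, map_smul, coordOne_stdOne, coordOne_stdTwo, coordTwo_stdOne,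
      coordTwo_stdTwo, coordOne_stdOneLin, coordTwo_stdOneLin, coordOne_stdTwoLin,
      coordTwo_stdTwoLin, smul_zero, add_zero, zero_add, Prod.smul_mk, Prod.mk.injEq, smul_eq_mul,
      mul_eq_zero, OfNat.ofNat_ne_zero, or_false] at h1 h2
    obtain ⟨rfl, h1⟩ := h1
    obtain ⟨rfl, h2⟩ := h2
    rw [zero_smul, eq_comm, smul_eq_zero_iff_right hs] at h1 h2
    exact ⟨h1, h2⟩
  · rintro ⟨rfl, rfl⟩
    simp

theorem mvfderiv_frame_mem_iff (y : Sph q × Sph p) (X : TangentSpace ((𝓡 q).prod (𝓡 p)) y)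
    (r s : ℝ) :
    r • mvfderiv ((𝓡 q).prod (𝓡 p)) (frameOne hn C) y X +
      s • mvfderiv ((𝓡 q).prod (𝓡 p)) (frameTwo hn C) y X ∈ (C.act (stdLift hn y)).plane ↔
      (r = 0 ∨ X.1 = 0) ∧ (s = 0 ∨ X.2 = 0) := by
  rw [mvfderiv_frameOne, mvfderiv_frameTwo, ← map_smul C.1, ← map_smul C.1, ← map_add C.1,
    C.mem_act_plane, LinearEquiv.symm_apply_apply, ← map_smul (stdOneLin hn),
    ← map_smul (stdTwoLin hn), combination_lin_mem_iff, smul_eq_zero, smul_eq_zero,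
    mvfderiv_sphOne_eq_zero, mvfderiv_sphTwo_eq_zero]

theorem isLegendre_act_stdLift :
    IsLegendre ((𝓡 q).prod (𝓡 p)) (fun y => C.act (stdLift hn y)) := by
  refine (isParametrization_frame hn C).isLegendre ?_ ?_ ?_
  · rw [finrank_prod, finrank_euclideanSpace_fin, finrank_euclideanSpace_fin]
    omega
  · intro y X k hk
    rw [C.mem_act_plane, stdLift_plane] at hk
    obtain ⟨a, b, hab⟩ := Submodule.mem_span_pair.1 hk
    have hk' : k = C.1 (a • stdOne hn (sphOne y) + b • stdTwo hn (sphTwo y)) := by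
      rw [← LinearEquiv.apply_symm_apply C.1 k, ← hab]
      rfl
    have horth₁ : inner ℝ (mvfderiv ((𝓡 q).prod (𝓡 p)) sphOne y X) (sphOne y) = 0 := by
      rw [mvfderiv_sphOne]
      exact inner_mvfderiv_coe_sph y.1 X.1
    have horth₂ : inner ℝ (mvfderiv ((𝓡 q).prod (𝓡 p)) sphTwo y X) (sphTwo y) = 0 := by
      rw [mvfderiv_sphTwo]
      exact inner_mvfderiv_coe_sph y.2 X.2
    rw [mvfderiv_frameOne, mvfderiv_frameTwo, hk', C.2, C.2, lieProd_eq_coord hn,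
      lieProd_eq_coord hn]
    simp [inner_smul_left, inner_smul_right, horth₁, horth₂]
  · intro y X h1 h2
    have h1' := (mvfderiv_frame_mem_iff hn C y X 1 0).1 (by simpa using h1)
    have h2' := (mvfderiv_frame_mem_iff hn C y X 0 1).1 (by simpa using h2)
    exact Prod.ext (h1'.1.resolve_left one_ne_zero) (h2'.2.resolve_left one_ne_zero)

end Standard

end LieSphere

end

noncomputable section

namespace LieSphere

open scoped Topology
open Filter

/-! ### The images of the standard product are cyclides -/

section StandardCyclide

variable {p q n : ℕ} (hn : p + q + 1 = n) (C : LieTransf n)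

theorem linearIndependent_frame (y : Sph q × Sph p) :
    LinearIndependent ℝ ![frameOne hn C y, frameTwo hn C y] :=
  LieLine.linearIndependent_of_plane_eq (act_stdLift_plane hn C y)

theorem frame_combination_ne_zero (y : Sph q × Sph p) {r s : ℝ} (hrs : r ≠ 0 ∨ s ≠ 0) :
    r • frameOne hn C y + s • frameTwo hn C y ≠ 0 := by
  intro h
  have := LinearIndependent.pair_iff.1 (linearIndependent_frame hn C y) r s h
  exact hrs.elim (fun h => h this.1) fun h => h this.2

theorem frameOne_ne_zero (y : Sph q × Sph p) : frameOne hn C y ≠ 0 :=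
  (linearIndependent_frame hn C y).ne_zero 0

theorem frameTwo_ne_zero (y : Sph q × Sph p) : frameTwo hn C y ≠ 0 :=
  (linearIndependent_frame hn C y).ne_zero 1

/-- The first curvature sphere of the image of the standard product under `C`. -/
def curvOne (y : Sph q × Sph p) : ℙ ℝ (LieVec n) :=
  Projectivization.mk ℝ (frameOne hn C y) (frameOne_ne_zero hn C y)

/-- The second curvature sphere of the image of the standard product under `C`. -/
def curvTwo (y : Sph q × Sph p) : ℙ ℝ (LieVec n) :=
  Projectivization.mk ℝ (frameTwo hn C y) (frameTwo_ne_zero hn C y)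

theorem curvOne_ne_curvTwo (y : Sph q × Sph p) : curvOne hn C y ≠ curvTwo hn C y := by
  intro h
  obtain ⟨a, ha⟩ := (Projectivization.mk_eq_mk_iff' ℝ _ _ _ _).1 h
  have := LinearIndependent.pair_iff.1 (linearIndependent_frame hn C y) 1 (-a)
    (by rw [← ha]; module)
  exact one_ne_zero this.1

theorem mem_principalSpace_frame (y : Sph q × Sph p) {r s : ℝ} (hrs : r ≠ 0 ∨ s ≠ 0)
    (X : TangentSpace ((𝓡 q).prod (𝓡 p)) y) :
    X ∈ principalSpace ((𝓡 q).prod (𝓡 p)) (fun y => C.act (stdLift hn y)) y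
        (Projectivization.mk ℝ _ (frame_combination_ne_zero hn C y hrs)) ↔
      (r = 0 ∨ X.1 = 0) ∧ (s = 0 ∨ X.2 = 0) := by
  obtain ⟨f, ξ, h⟩ := (isParametrization_frame hn C).exists_isLift
  rw [h.mem_principalSpace_iff_of_isParametrization (isParametrization_frame hn C),
    mvfderiv_frame_mem_iff]

theorem mem_principalSpace_curvOne (y : Sph q × Sph p) (X : TangentSpace ((𝓡 q).prod (𝓡 p)) y) :
    X ∈ principalSpace ((𝓡 q).prod (𝓡 p)) (fun y => C.act (stdLift hn y)) y (curvOne hn C y) ↔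
      X.1 = 0 := by
  have h := mem_principalSpace_frame hn C y (r := 1) (s := 0) (Or.inl one_ne_zero) X
  simp only [one_smul, zero_smul, add_zero, one_ne_zero, false_or, true_or, and_true] at h
  exact h

theorem mem_principalSpace_curvTwo (y : Sph q × Sph p) (X : TangentSpace ((𝓡 q).prod (𝓡 p)) y) :
    X ∈ principalSpace ((𝓡 q).prod (𝓡 p)) (fun y => C.act (stdLift hn y)) y (curvTwo hn C y) ↔
      X.2 = 0 := by
  have h := mem_principalSpace_frame hn C y (r := 0) (s := 1) (Or.inr one_ne_zero) X
  simp only [one_smul, zero_smul, zero_add, one_ne_zero, false_or, true_or, true_and] at h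
  exact h

theorem multiplicity_curvOne (y : Sph q × Sph p) :
    multiplicity ((𝓡 q).prod (𝓡 p)) (fun y => C.act (stdLift hn y)) y (curvOne hn C y) = p := by
  have h : principalSpace ((𝓡 q).prod (𝓡 p)) (fun y => C.act (stdLift hn y)) y (curvOne hn C y) =
      LinearMap.range (LinearMap.inr ℝ (Euc q) (Euc p)) := by
    ext X
    rw [mem_principalSpace_curvOne]
    constructor
    · intro hX
      exact ⟨X.2, Prod.ext hX.symm rfl⟩
    · rintro ⟨Y, rfl⟩
      rfl
  have h2 : finrank ℝ (LinearMap.range (LinearMap.inr ℝ (Euc q) (Euc p))) = p :=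
    (LinearMap.finrank_range_of_inj LinearMap.inr_injective).trans finrank_euclideanSpace_fin
  rw [multiplicity, h]
  exact h2

theorem multiplicity_curvTwo (y : Sph q × Sph p) :
    multiplicity ((𝓡 q).prod (𝓡 p)) (fun y => C.act (stdLift hn y)) y (curvTwo hn C y) = q := by
  have h : principalSpace ((𝓡 q).prod (𝓡 p)) (fun y => C.act (stdLift hn y)) y (curvTwo hn C y) =
      LinearMap.range (LinearMap.inl ℝ (Euc q) (Euc p)) := by
    ext X
    rw [mem_principalSpace_curvTwo]
    constructor
    · intro hX
      exact ⟨X.1, Prod.ext rfl hX.symm⟩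
    · rintro ⟨Y, rfl⟩
      rfl
  have h2 : finrank ℝ (LinearMap.range (LinearMap.inl ℝ (Euc q) (Euc p))) = q :=
    (LinearMap.finrank_range_of_inj LinearMap.inl_injective).trans finrank_euclideanSpace_fin
  rw [multiplicity, h]
  exact h2

theorem exists_ne_zero_of_one_le {k : ℕ} (hk : 1 ≤ k) : ∃ X : Euc k, X ≠ 0 := by
  have : Nontrivial (Euc k) := by
    refine Module.nontrivial_of_finrank_pos (R := ℝ) ?_
    rw [finrank_euclideanSpace_fin]; exact hk
  exact exists_ne 0

theorem curvatureSpheres_act_stdLift (hp : 1 ≤ p) (hq : 1 ≤ q) (y : Sph q × Sph p) :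
    {K | IsCurvatureSphere ((𝓡 q).prod (𝓡 p)) (fun y => C.act (stdLift hn y)) y K} =
      {curvOne hn C y, curvTwo hn C y} := by
  have hpar := isParametrization_frame hn C
  ext K
  constructor
  · rintro ⟨hK, X, hX, hX0⟩
    induction K using Projectivization.ind with
    | h k hk0 =>
      rw [Projectivization.submodule_mk, Submodule.span_singleton_le_iff_mem,
        act_stdLift_plane] at hK
      obtain ⟨r, s, rfl⟩ := Submodule.mem_span_pair.1 hK
      have hrs : r ≠ 0 ∨ s ≠ 0 := by
        by_contra! h0
        exact hk0 (by rw [h0.1, h0.2]; simp)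
      have hX' := (mem_principalSpace_frame hn C y hrs X).1 hX
      by_cases hs : s = 0
      · left
        refine (Projectivization.mk_eq_mk_iff' ℝ _ _ _ _).2 ⟨r, ?_⟩
        rw [hs, zero_smul, add_zero]
      · right
        have hr : r = 0 := by
          by_contra hr
          exact hX0 (Prod.ext (hX'.1.resolve_left hr) (hX'.2.resolve_left hs))
        refine (Projectivization.mk_eq_mk_iff' ℝ _ _ _ _).2 ⟨s, ?_⟩
        rw [hr, zero_smul, zero_add]
  · rintro (rfl | rfl)
    · obtain ⟨X, hX⟩ := exists_ne_zero_of_one_le hp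
      refine ⟨?_, ((0 : Euc q), X), ?_, fun h => hX (congrArg Prod.snd h)⟩
      · rw [curvOne, Projectivization.submodule_mk, Submodule.span_singleton_le_iff_mem]
        exact hpar.fst_mem y
      · exact (mem_principalSpace_curvOne hn C y ((0 : Euc q), X)).2 rfl
    · obtain ⟨X, hX⟩ := exists_ne_zero_of_one_le hq
      refine ⟨?_, (X, (0 : Euc p)), ?_, fun h => hX (congrArg Prod.fst h)⟩
      · rw [curvTwo, Projectivization.submodule_mk, Submodule.span_singleton_le_iff_mem]
        exact hpar.snd_mem y
      · exact (mem_principalSpace_curvTwo hn C y (X, (0 : Euc p))).2 rfl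

/-- Along a curvature surface the kind of curvature sphere cannot change: the sets where the `S^q`
component and where the `S^p` component have nonzero derivative are open and complementary, and the
surface is connected. The component that determines the sphere is then stationary throughout, hence
constant. -/
theorem isDupin_act_stdLift (hp : 1 ≤ p) (hq : 1 ≤ q) :
    IsDupin ((𝓡 q).prod (𝓡 p)) (fun y => C.act (stdLift hn y)) := by
  refine ⟨isLegendre_act_stdLift hn C, ?_⟩
  intro m S _ _ _ _ _ ι K ⟨hconn, hinj, hsm, himm, hK⟩
  have hmd : ∀ s, MDifferentiableAt (𝓡 m) ((𝓡 q).prod (𝓡 p)) ι s :=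
    hsm.mdifferentiable ne_zero_infty
  have hv : ContMDiff (𝓡 m) 𝓘(ℝ, Euc (q + 1)) ∞ fun s => sphOne (ι s) := contMDiff_sphOne.comp hsm
  have hu : ContMDiff (𝓡 m) 𝓘(ℝ, Euc (p + 1)) ∞ fun s => sphTwo (ι s) := contMDiff_sphTwo.comp hsm
  have hdv : ∀ s X, mvfderiv (𝓡 m) (fun s => sphOne (ι s)) s X = 0 ↔
      (mfderiv (𝓡 m) ((𝓡 q).prod (𝓡 p)) ι s X).1 = 0 := fun s X => by
    rw [mvfderiv_comp_mfderiv s (contMDiff_sphOne.mdifferentiable ne_zero_infty _) (hmd s) X,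
      mvfderiv_sphOne_eq_zero]
  have hdu : ∀ s X, mvfderiv (𝓡 m) (fun s => sphTwo (ι s)) s X = 0 ↔
      (mfderiv (𝓡 m) ((𝓡 q).prod (𝓡 p)) ι s X).2 = 0 := fun s X => by
    rw [mvfderiv_comp_mfderiv s (contMDiff_sphTwo.mdifferentiable ne_zero_infty _) (hmd s) X,
      mvfderiv_sphTwo_eq_zero]
  have hcase : ∀ s, K s = curvOne hn C (ι s) ∨ K s = curvTwo hn C (ι s) := fun s => by
    have : K s ∈ {K | IsCurvatureSphere ((𝓡 q).prod (𝓡 p)) (fun y => C.act (stdLift hn y))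
        (ι s) K} := (hK s).1
    rw [curvatureSpheres_act_stdLift hn C hp hq] at this
    exact this
  -- on the first kind of curvature surface `v` is stationary and `u` is not, and vice versa
  have hone : ∀ s, K s = curvOne hn C (ι s) → mvfderiv (𝓡 m) (fun s => sphOne (ι s)) s = 0 ∧
      mvfderiv (𝓡 m) (fun s => sphTwo (ι s)) s ≠ 0 := by
    intro s hs
    have hr := (hK s).2
    rw [hs] at hr
    constructor
    · ext1 X
      refine (hdv s X).2 ((mem_principalSpace_curvOne hn C _ _).1 ?_)
      rw [← hr]
      exact LinearMap.mem_range_self _ X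
    · intro h0
      obtain ⟨Y, hY⟩ := exists_ne_zero_of_one_le hp
      have hY' : ((0 : Euc q), Y) ∈ principalSpace ((𝓡 q).prod (𝓡 p))
          (fun y => C.act (stdLift hn y)) (ι s) (curvOne hn C (ι s)) :=
        (mem_principalSpace_curvOne hn C (ι s) ((0 : Euc q), Y)).2 rfl
      rw [← hr] at hY'
      obtain ⟨X, hX⟩ := hY'
      have h1 := (hdu s X).1 (by rw [h0]; rfl)
      exact hY ((congrArg Prod.snd hX).symm.trans h1)
  have htwo : ∀ s, K s = curvTwo hn C (ι s) → mvfderiv (𝓡 m) (fun s => sphTwo (ι s)) s = 0 ∧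
      mvfderiv (𝓡 m) (fun s => sphOne (ι s)) s ≠ 0 := by
    intro s hs
    have hr := (hK s).2
    rw [hs] at hr
    constructor
    · ext1 X
      refine (hdu s X).2 ((mem_principalSpace_curvTwo hn C _ _).1 ?_)
      rw [← hr]
      exact LinearMap.mem_range_self _ X
    · intro h0
      obtain ⟨Y, hY⟩ := exists_ne_zero_of_one_le hq
      have hY' : (Y, (0 : Euc p)) ∈ principalSpace ((𝓡 q).prod (𝓡 p))
          (fun y => C.act (stdLift hn y)) (ι s) (curvTwo hn C (ι s)) :=
        (mem_principalSpace_curvTwo hn C (ι s) (Y, (0 : Euc p))).2 rfl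
      rw [← hr] at hY'
      obtain ⟨X, hX⟩ := hY'
      have h1 := (hdv s X).1 (by rw [h0]; rfl)
      exact hY ((congrArg Prod.fst hX).symm.trans h1)
  let A : Set S := {s | mvfderiv (𝓡 m) (fun s => sphOne (ι s)) s ≠ 0}
  have hA : IsClopen A := by
    refine ⟨?_, isOpen_mvfderiv_ne_zero hv⟩
    have : Aᶜ = {s | mvfderiv (𝓡 m) (fun s => sphTwo (ι s)) s ≠ 0} := by
      ext s
      rcases hcase s with hs | hs
      · have := hone s hs
        simp [A, this.1, this.2]
      · have := htwo s hs
        simp [A, this.1, this.2]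
    rw [← isOpen_compl_iff, this]
    exact isOpen_mvfderiv_ne_zero hu
  intro s t
  rcases isClopen_iff.1 hA with h0 | h0
  · have h0' : ∀ s, mvfderiv (𝓡 m) (fun s => sphOne (ι s)) s = 0 := fun s => by
      by_contra h
      have : s ∈ A := h
      rw [h0] at this
      exact this
    have hKs : ∀ s, K s = curvOne hn C (ι s) := fun s =>
      (hcase s).resolve_right fun h => (htwo s h).2 (h0' s)
    have hst := eq_of_mvfderiv_eq_zero hv h0' s t
    rw [hKs, hKs]
    simp only [curvOne, frameOne, hst]
  · have h0' : ∀ s, mvfderiv (𝓡 m) (fun s => sphOne (ι s)) s ≠ 0 := fun s => by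
      have : s ∈ A := by rw [h0]; trivial
      exact this
    have hKs : ∀ s, K s = curvTwo hn C (ι s) := fun s =>
      (hcase s).resolve_left fun h => h0' s (hone s h).1
    have hst := eq_of_mvfderiv_eq_zero hu (fun s => (htwo s (hKs s)).1) s t
    rw [hKs, hKs]
    simp only [curvTwo, frameTwo, hst]

theorem isCyclide_act_stdLift (hp : 1 ≤ p) (hq : 1 ≤ q) :
    IsCyclide ((𝓡 q).prod (𝓡 p)) p q (fun y => C.act (stdLift hn y)) := by
  refine ⟨⟨isDupin_act_stdLift hn C hp hq, 2, fun y => ?_⟩, fun y => ⟨curvOne hn C y,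
    curvTwo hn C y, curvOne_ne_curvTwo hn C y, curvatureSpheres_act_stdLift hn C hp hq y,
    multiplicity_curvOne hn C y, multiplicity_curvTwo hn C y⟩⟩
  rw [curvatureSpheres_act_stdLift hn C hp hq y, encard_pair (curvOne_ne_curvTwo hn C y)]
  rfl

end StandardCyclide

end LieSphere

end

noncomputable section

namespace LieSphere

open scoped Topology
open Filter

/-! ### Factorization through the standard product -/

section Factorization

variable {E : Type*} [NormedAddCommGroup E] [NormedSpace ℝ E]
  {H : Type*} [TopologicalSpace H] {I : ModelWithCorners ℝ E H}
  {M : Type*} [TopologicalSpace M] [ChartedSpace H M] {n p q : ℕ} (hn : p + q + 1 = n)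
  {lam : M → LieLine n} {f ξ : M → Euc (n + 1)}

theorem IsLift.unique {f' ξ' : Euc (n + 1)} (h : IsLift I lam f ξ) {x : M}
    (hf : pointSphere f' ∈ (lam x).plane) (hξ : greatSphere ξ' ∈ (lam x).plane) :
    f' = f x ∧ ξ' = ξ x := by
  have h1 := h.eq_combination hf
  have h2 := h.eq_combination hξ
  have hmid₁ := congrArg (fun z : LieVec n => z.2.1) h1
  have hmid₂ := congrArg (fun z : LieVec n => z.2.1) h2
  simpa [pointSphere, greatSphere] using And.intro hmid₁ hmid₂

/-- A quotient of the two components of a smooth map into `ℝ × F` is smooth. -/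
theorem contMDiffAt_of_eventually_eq_smul {F : Type*} [NormedAddCommGroup F] [NormedSpace ℝ F]
    {g : M → ℝ × F} {v : M → F} {x₀ : M} {c : ℝ} (hg : ContMDiff I 𝓘(ℝ, ℝ × F) ∞ g)
    (h0 : (g x₀).1 ≠ 0) (hv : ∀ x, c • (g x).2 = (g x).1 • v x) :
    ContMDiffAt I 𝓘(ℝ, F) ∞ v x₀ := by
  have h1 : ContMDiff I 𝓘(ℝ, ℝ) ∞ fun x => (g x).1 :=
    hg.clm_comp' (ContinuousLinearMap.fst ℝ ℝ F)
  have h2 : ContMDiff I 𝓘(ℝ, F) ∞ fun x => c • (g x).2 :=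
    hg.clm_comp' (c • ContinuousLinearMap.snd ℝ ℝ F)
  have h3 : ContMDiffAt I 𝓘(ℝ, F) ∞ (fun x => ((g x).1)⁻¹ • (c • (g x).2)) x₀ :=
    ((h1 x₀).inv₀ h0).smul (h2 x₀)
  refine h3.congr_of_eventuallyEq ?_
  filter_upwards [h1.continuous.continuousAt.eventually_ne h0] with x hx
  rw [hv, smul_smul, inv_mul_cancel₀ hx, one_smul]

/-- The coordinates of a line's vector in the first factor are `a (2, √2 v)`. The relation recovers
the sphere point `v` as a ratio without knowing `a`, and so smoothly where `a ≠ 0`. -/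
theorem coordOne_of_mem {C : LieTransf n} {y : Sph q × Sph p} {k : LieVec n}
    (hk : k ∈ (C.act (stdLift hn y)).plane) :
    √2 • (coordOne hn (C.1.symm k)).2 = (coordOne hn (C.1.symm k)).1 • sphOne y := by
  have hs2 : √2 * √2 = 2 := Real.mul_self_sqrt (by norm_num)
  rw [C.mem_act_plane, stdLift_plane] at hk
  obtain ⟨a, b, hab⟩ := Submodule.mem_span_pair.1 hk
  rw [← hab]
  simp only [map_add, map_smul, coordOne_stdOne, coordOne_stdTwo, smul_zero, add_zero,
    Prod.smul_mk, smul_eq_mul, smul_smul]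
  rw [show √2 * (a * √2) = a * 2 by linear_combination a * hs2]
  rfl

theorem coordTwo_of_mem {C : LieTransf n} {y : Sph q × Sph p} {k : LieVec n}
    (hk : k ∈ (C.act (stdLift hn y)).plane) :
    √2 • (coordTwo hn (C.1.symm k)).2 = (coordTwo hn (C.1.symm k)).1 • sphTwo y := by
  have hs2 : √2 * √2 = 2 := Real.mul_self_sqrt (by norm_num)
  rw [C.mem_act_plane, stdLift_plane] at hk
  obtain ⟨a, b, hab⟩ := Submodule.mem_span_pair.1 hk
  rw [← hab]
  simp only [map_add, map_smul, coordTwo_stdOne, coordTwo_stdTwo, smul_zero, zero_add,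
    Prod.smul_mk, smul_eq_mul, smul_smul]
  rw [show √2 * (b * √2) = b * 2 by linear_combination b * hs2]
  rfl

/-- `coordOne` in the frame given by `C`, as a continuous linear map. -/
def coordOneCLM (C : LieTransf n) : LieVec n →L[ℝ] ℝ × Euc (q + 1) :=
  LinearMap.toContinuousLinearMap (coordOne hn ∘ₗ C.1.symm.toLinearMap)

/-- `coordTwo` in the frame given by `C`, as a continuous linear map. -/
def coordTwoCLM (C : LieTransf n) : LieVec n →L[ℝ] ℝ × Euc (p + 1) :=
  LinearMap.toContinuousLinearMap (coordTwo hn ∘ₗ C.1.symm.toLinearMap)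

theorem IsLift.exists_ne_zero (h : IsLift I lam f ξ) {x : M} {k : LieVec n}
    (hk : k ∈ (lam x).plane) (L : LieVec n →ₗ[ℝ] ℝ) (hL : L k ≠ 0) :
    L (pointSphere (f x)) ≠ 0 ∨ L (greatSphere (ξ x)) ≠ 0 := by
  by_contra! h0
  rw [h.eq_combination hk, map_add, map_smul, map_smul, h0.1, h0.2] at hL
  simp at hL

theorem IsLift.contMDiff_factor [IsManifold I ∞ M] (h : IsLift I lam f ξ) {C : LieTransf n}
    {φ : M → Sph q × Sph p} (hφ : ∀ x, lam x = C.act (stdLift hn (φ x))) :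
    ContMDiff I ((𝓡 q).prod (𝓡 p)) ∞ φ := by
  have hone : ContMDiff I (𝓡 q) ∞ fun x => (φ x).1 := by
    refine contMDiff_sph_of_coe fun x₀ => ?_
    have key : ∀ k : M → LieVec n, ContMDiff I 𝓘(ℝ, LieVec n) ∞ k →
        (∀ x, k x ∈ (lam x).plane) → (coordOne hn (C.1.symm (k x₀))).1 ≠ 0 →
        ContMDiffAt I 𝓘(ℝ, Euc (q + 1)) ∞ (fun x => sphOne (φ x)) x₀ := by
      intro k hk hmem h0
      refine contMDiffAt_of_eventually_eq_smul (hk.clm_comp' (coordOneCLM hn C)) (c := √2) h0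
        fun x => coordOne_of_mem hn ?_
      rw [← hφ]; exact hmem x
    have hmem : frameOne hn C (φ x₀) ∈ (lam x₀).plane := by
      rw [hφ]; exact (isParametrization_frame hn C).fst_mem (φ x₀)
    -- The denominator of the ratio may vanish on one vector of the smooth frame of the line at
    -- `x₀`, but not on both, since it is nonzero on the curvature sphere they span.
    rcases h.exists_ne_zero hmem
      (LinearMap.fst ℝ ℝ (Euc (q + 1)) ∘ₗ coordOne hn ∘ₗ C.1.symm.toLinearMap)
      (by simp [frameOne]) with h0 | h0
    · exact key _ h.contMDiff_pointSphere h.pointSphere_mem h0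
    · exact key _ h.contMDiff_greatSphere h.greatSphere_mem h0
  have htwo : ContMDiff I (𝓡 p) ∞ fun x => (φ x).2 := by
    refine contMDiff_sph_of_coe fun x₀ => ?_
    have key : ∀ k : M → LieVec n, ContMDiff I 𝓘(ℝ, LieVec n) ∞ k →
        (∀ x, k x ∈ (lam x).plane) → (coordTwo hn (C.1.symm (k x₀))).1 ≠ 0 →
        ContMDiffAt I 𝓘(ℝ, Euc (p + 1)) ∞ (fun x => sphTwo (φ x)) x₀ := by
      intro k hk hmem h0
      refine contMDiffAt_of_eventually_eq_smul (hk.clm_comp' (coordTwoCLM hn C)) (c := √2) h0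
        fun x => coordTwo_of_mem hn ?_
      rw [← hφ]; exact hmem x
    have hmem : frameTwo hn C (φ x₀) ∈ (lam x₀).plane := by
      rw [hφ]; exact (isParametrization_frame hn C).snd_mem (φ x₀)
    rcases h.exists_ne_zero hmem
      (LinearMap.fst ℝ ℝ (Euc (p + 1)) ∘ₗ coordTwo hn ∘ₗ C.1.symm.toLinearMap)
      (by simp [frameTwo]) with h0 | h0
    · exact key _ h.contMDiff_pointSphere h.pointSphere_mem h0
    · exact key _ h.contMDiff_greatSphere h.greatSphere_mem h0
  exact hone.prodMk htwo

/-- A Legendre submanifold all of whose lines are lines of an image of the standard product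
factors through it by a local diffeomorphism. -/
theorem IsLegendre.exists_localDiffeomorph [IsManifold I ∞ M] [I.Boundaryless] (hp : 1 ≤ p)
    (hl : IsLegendre I lam) {C : LieTransf n}
    (hC : ∀ x, lam x ∈ range (fun y => C.act (stdLift hn y))) :
    ∃ φ : M → Sph q × Sph p, IsLocalDiffeomorph I ((𝓡 q).prod (𝓡 p)) ∞ φ ∧
      ∀ x, lam x = C.act (stdLift hn (φ x)) := by
  obtain ⟨hd, f, ξ, h, himm, -⟩ := isLegendre_iff.1 hl
  choose φ hφ' using hC
  have hφ : ∀ x, lam x = C.act (stdLift hn (φ x)) := fun x => (hφ' x).symm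
  have hsm := h.contMDiff_factor hn hφ
  obtain ⟨F, Ξ, hF⟩ := (isParametrization_frame hn C).exists_isLift
  have hcomp : ∀ x, f x = F (φ x) ∧ ξ x = Ξ (φ x) := fun x =>
    hF.unique (x := φ x) (by rw [← hφ]; exact h.pointSphere_mem x)
      (by rw [← hφ]; exact h.greatSphere_mem x)
  have hfF : f = fun x => F (φ x) := funext fun x => (hcomp x).1
  have hξΞ : ξ = fun x => Ξ (φ x) := funext fun x => (hcomp x).2
  have hfin : FiniteDimensional ℝ E := Module.finite_of_finrank_pos (by omega)
  refine ⟨φ, fun x => ?_, hφ⟩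
  refine isLocalDiffeomorphAt_of_injective_mfderiv ?_ hsm x ?_
  · rw [finrank_prod, finrank_euclideanSpace_fin, finrank_euclideanSpace_fin]
    omega
  -- Both `f` and `ξ` factor through `φ`, so a vector killed by `dφ` is killed by `df` and `dξ` and
  -- vanishes by the immersion condition. Equality of dimensions then makes `φ` a local
  -- diffeomorphism.
  · refine (injective_iff_map_eq_zero _).2 fun X hX => himm x X ?_ ?_
    · rw [hfF, mvfderiv_comp_mfderiv x (hF.smooth_fst.mdifferentiable ne_zero_infty _)
        (hsm.mdifferentiable ne_zero_infty x), hX, map_zero]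
    · rw [hξΞ, mvfderiv_comp_mfderiv x (hF.smooth_snd.mdifferentiable ne_zero_infty _)
        (hsm.mdifferentiable ne_zero_infty x), hX, map_zero]

theorem connectedSpace_sph {k : ℕ} (hk : 1 ≤ k) : ConnectedSpace (Sph k) := by
  refine isConnected_iff_connectedSpace.1 (isConnected_sphere ?_ 0 zero_le_one)
  rw [← Module.finrank_eq_rank, finrank_euclideanSpace_fin]
  exact_mod_cast Nat.lt_add_of_pos_left hk

/-- The image is open because `φ` is a local diffeomorphism, and closed because it is compact in a
Hausdorff space. -/
theorem surjective_of_isLocalDiffeomorph {E' : Type*} [NormedAddCommGroup E']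
    [NormedSpace ℝ E'] {H' : Type*} [TopologicalSpace H'] {J : ModelWithCorners ℝ E' H'}
    {N : Type*} [TopologicalSpace N] [ChartedSpace H' N] [T2Space N] [PreconnectedSpace N]
    [CompactSpace M] [Nonempty M] {φ : M → N} (h : IsLocalDiffeomorph I J ∞ φ) : Surjective φ := by
  have hcl : IsClopen (range φ) := ⟨(isCompact_range h.contMDiff.continuous).isClosed, h.isOpen_range⟩
  exact range_eq_univ.1 (hcl.eq_univ (range_nonempty φ))

end Factorization

end LieSphere

end

noncomputable section

namespace LieSphere

/-! ### Compact Legendre submanifolds inside an image of the standard product -/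

section Compact

variable {E : Type*} [NormedAddCommGroup E] [NormedSpace ℝ E]
  {H : Type*} [TopologicalSpace H] {I : ModelWithCorners ℝ E H} [I.Boundaryless]
  {M : Type*} [TopologicalSpace M] [ChartedSpace H M] [IsManifold I ∞ M]
  {n p q : ℕ} (hn : p + q + 1 = n) {lam : M → LieLine n}

/-- A compact Legendre submanifold all of whose lines are lines of an image of the standard
product covers it. -/
theorem IsLegendre.covers [CompactSpace M] [Nonempty M] (hp : 1 ≤ p) (hq : 1 ≤ q)
    (hl : IsLegendre I lam) {C : LieTransf n}
    (hC : ∀ x, lam x ∈ range (fun y => C.act (stdLift hn y))) :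
    range lam = range (fun y => C.act (stdLift hn y)) ∧
    IsCoveringOf I ((𝓡 q).prod (𝓡 p)) lam (fun y => C.act (stdLift hn y)) ∧
    (Injective lam →
      IsReparametrization I ((𝓡 q).prod (𝓡 p)) lam (fun y => C.act (stdLift hn y))) := by
  have := connectedSpace_sph hp
  have := connectedSpace_sph hq
  obtain ⟨φ, hφ, hlam⟩ := hl.exists_localDiffeomorph hn hp hC
  have hsurj := surjective_of_isLocalDiffeomorph hφ
  refine ⟨?_, ⟨φ, hφ, hsurj, hlam⟩, fun hinj => ?_⟩
  · rw [funext hlam]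
    exact hsurj.range_comp (fun y => C.act (stdLift hn y))
  · have hφinj : Injective φ := fun x y hxy => hinj (by rw [hlam, hlam, hxy])
    exact ⟨hφ.diffeomorphOfBijective ⟨hφinj, hsurj⟩, hlam⟩

end Compact

end LieSphere

end

/-! ### Existence, uniqueness and Lie equivalence of compact cyclides -/

theorem theorem10p1 (p q n : ℕ) (hp : 1 ≤ p) (hq : 1 ≤ q) (hn : p + q + 1 = n) :
    -- (a) existence and uniqueness of the compact connected cyclide containing a given one
    (∀ (E : Type*) [NormedAddCommGroup E] [NormedSpace ℝ E] (H : Type*) [TopologicalSpace H]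
        (I : ModelWithCorners ℝ E H) [I.Boundaryless]
        (M : Type*) [TopologicalSpace M] [ChartedSpace H M] [IsManifold I ∞ M]
        [T2Space M] [SecondCountableTopology M] [ConnectedSpace M]
        (lam : M → LieLine n), IsCyclide I p q lam →
      ∃ nu : Sph q × Sph p → LieLine n,
        CompactSpace (Sph q × Sph p) ∧ ConnectedSpace (Sph q × Sph p) ∧
        IsCyclide ((𝓡 q).prod (𝓡 p)) p q nu ∧ Function.Injective nu ∧
        IsRestriction I ((𝓡 q).prod (𝓡 p)) lam nu ∧
        ∀ (E' : Type*) [NormedAddCommGroup E'] [NormedSpace ℝ E']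
          (H' : Type*) [TopologicalSpace H']
          (J : ModelWithCorners ℝ E' H') [J.Boundaryless]
          (N : Type*) [TopologicalSpace N] [ChartedSpace H' N] [IsManifold J ∞ N]
          [T2Space N] [SecondCountableTopology N] [CompactSpace N] [ConnectedSpace N]
          (nu' : N → LieLine n), IsCyclide J p q nu' → Set.range lam ⊆ Set.range nu' →
          Set.range nu' = Set.range nu ∧
          IsCoveringOf J ((𝓡 q).prod (𝓡 p)) nu' nu ∧
          (Function.Injective nu' → IsReparametrization J ((𝓡 q).prod (𝓡 p)) nu' nu)) ∧
    -- (b) Lie equivalence with the Legendre lift of the standard product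
    (∀ (E : Type*) [NormedAddCommGroup E] [NormedSpace ℝ E] (H : Type*) [TopologicalSpace H]
        (I : ModelWithCorners ℝ E H) [I.Boundaryless]
        (M : Type*) [TopologicalSpace M] [ChartedSpace H M] [IsManifold I ∞ M]
        [T2Space M] [SecondCountableTopology M] [CompactSpace M] [ConnectedSpace M]
        (lam : M → LieLine n), IsCyclide I p q lam →
      ∃ β : LieTransf n,
        Set.range (fun x => β.act (lam x)) = Set.range (stdLift hn) ∧
        IsCoveringOf I ((𝓡 q).prod (𝓡 p)) (fun x => β.act (lam x)) (stdLift hn) ∧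
        (Function.Injective lam →
          IsReparametrization I ((𝓡 q).prod (𝓡 p)) (fun x => β.act (lam x)) (stdLift hn))) ∧
    -- Lie equivalence of any two compact connected cyclides
    (∀ (E : Type*) [NormedAddCommGroup E] [NormedSpace ℝ E] (H : Type*) [TopologicalSpace H]
        (I : ModelWithCorners ℝ E H) [I.Boundaryless]
        (M : Type*) [TopologicalSpace M] [ChartedSpace H M] [IsManifold I ∞ M]
        [T2Space M] [SecondCountableTopology M] [CompactSpace M] [ConnectedSpace M]
        (E' : Type*) [NormedAddCommGroup E'] [NormedSpace ℝ E']
        (H' : Type*) [TopologicalSpace H'] (J : ModelWithCorners ℝ E' H') [J.Boundaryless]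
        (N : Type*) [TopologicalSpace N] [ChartedSpace H' N] [IsManifold J ∞ N]
        [T2Space N] [SecondCountableTopology N] [CompactSpace N] [ConnectedSpace N]
        (lam : M → LieLine n) (mu : N → LieLine n),
        IsCyclide I p q lam → IsCyclide J p q mu →
      ∃ β : LieTransf n,
        Set.range (fun x => β.act (lam x)) = Set.range mu ∧
        (Function.Injective lam → Function.Injective mu →
          IsReparametrization I J (fun x => β.act (lam x)) mu)) := by
  have := connectedSpace_sph hp
  have := connectedSpace_sph hq
  refine ⟨?_, ?_, ?_⟩
  · intro E _ _ H _ I _ M _ _ _ _ _ _ lam hc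
    obtain ⟨C, hC⟩ := hc.exists_forall_mem_range hp hq hn
    refine ⟨fun y => C.act (stdLift hn y), inferInstance, inferInstance,
      isCyclide_act_stdLift hn C hp hq, C.act_injective.comp (stdLift_injective hn),
      hc.1.1.1.exists_localDiffeomorph hn hp hC, ?_⟩
    intro E' _ _ H' _ J _ N _ _ _ _ _ _ _ nu' hc' hsub
    obtain ⟨C', hC'⟩ := hc'.exists_forall_mem_range hp hq hn
    obtain ⟨x⟩ : Nonempty M := inferInstance
    -- The compact cyclide `nu'` lies in an image under some `C'`, and therefore so does `lam`.
    -- Rigidity near a single point of `M` identifies the two images, and `nu'` covers the common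
    -- one.
    have hr : Set.range (fun y => C.act (stdLift hn y)) =
        Set.range (fun y => C'.act (stdLift hn y)) := by
      refine hc.range_eq_range_of_eventually hp hq hn x (Filter.Eventually.of_forall hC)
        (Filter.Eventually.of_forall fun z => ?_)
      obtain ⟨w, hw⟩ := hsub ⟨z, rfl⟩
      exact hw ▸ hC' w
    exact hc'.1.1.1.covers hn hp hq fun w => hr ▸ hC' w
  · intro E _ _ H _ I _ M _ _ _ _ _ _ _ lam hc
    obtain ⟨C, hC⟩ := hc.exists_forall_mem_range hp hq hn
    obtain ⟨hr, ⟨φ, hφ, hs, hlam⟩, hinj⟩ := hc.1.1.1.covers hn hp hq hC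
    have hact : ∀ (x : M) (y : Sph q × Sph p), lam x = C.act (stdLift hn y) →
        C.inv.act (lam x) = stdLift hn y := fun x y h => by rw [h, C.inv_act_act]
    refine ⟨C.inv, ?_, ⟨φ, hφ, hs, fun x => hact x _ (hlam x)⟩, fun h => ?_⟩
    · rw [funext fun x => hact x _ (hlam x)]
      exact hs.range_comp (stdLift hn)
    · obtain ⟨Φ, hΦ⟩ := hinj h
      exact ⟨Φ, fun x => hact x _ (hΦ x)⟩
  · intro E _ _ H _ I _ M _ _ _ _ _ _ _ E' _ _ H' _ J _ N _ _ _ _ _ _ _ lam mu hc hc'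
    obtain ⟨C, hC⟩ := hc.exists_forall_mem_range hp hq hn
    obtain ⟨D, hD⟩ := hc'.exists_forall_mem_range hp hq hn
    obtain ⟨-, ⟨φ, -, hs, hlam⟩, hinj⟩ := hc.1.1.1.covers hn hp hq hC
    obtain ⟨hr', -, hinj'⟩ := hc'.1.1.1.covers hn hp hq hD
    have hact : ∀ (x : M) (y : Sph q × Sph p), lam x = C.act (stdLift hn y) →
        (D.comp C.inv).act (lam x) = D.act (stdLift hn y) := fun x y h => by
      rw [h, LieTransf.comp_act, C.inv_act_act]
    refine ⟨D.comp C.inv, ?_, fun h h' => ?_⟩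
    · rw [hr', funext fun x => hact x _ (hlam x)]
      exact hs.range_comp (fun y => D.act (stdLift hn y))
    · obtain ⟨Φ, hΦ⟩ := hinj h
      obtain ⟨Ψ, hΨ⟩ := hinj' h'
      refine ⟨Φ.trans Ψ.symm, fun x => ?_⟩
      refine (hact x _ (hΦ x)).trans ((hΨ _).trans ?_).symm
      exact congrArg (fun y => D.act (stdLift hn y)) (Ψ.apply_symm_apply (Φ x))
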